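/- Let $k$ be a field and let $R$ be a commutative noetherian Gorenstein $k$-algebra with a maximal ideal $m$ such that $k\to R/m$ is an isomorphism and such that $R_p$ is a regular local ring for every prime $p\neq m$ (isolated singularity). Assume that we are in one of the following two cases. * Complete case: $R$ is local and complete with respect to its maximal ideal $m$. * Graded case: $R=\bigoplus_{n\ge 0}R_n$ is an $\mathbb N$-graded $k$-algebra and $m$ is its unique maximal homogeneous ideal. Put $M_0=R$ and let $M_1,\dots,M_l$ be indecomposable finitely generated maximal Cohen-Macaulay $R$-modules that are pairwise non-isomorphic and not isomorphic to $R$ (in the graded case: $\mathbb Z$-graded modules, indecomposable and non-isomorphic as graded modules). Put $M=\bigoplus_{i=0}^l M_i$ and $\Lambda=\operatorname{End}_R(M)$, and assume that $\Lambda$ has finite global dimension. Let $e_0\in\Lambda$ be the projection of $M$ onto $M_0=R$ and put $P_0=\Lambda e_0$. Let $D^b_f(\Lambda)$ be the full subcategory of the derived category of left $\Lambda$-modules on the objects with bounded and finitely generated cohomology, let $\langle P_0\rangle$ be the thick subcategory generated by $P_0$, and let $Q:D^b_f(\Lambda)\to D^b_f(\Lambda)/\langle P_0\rangle$ be the Verdier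 quotient. 1. In both cases, $D^b_f(\Lambda)/\langle P_0\rangle$ is $\operatorname{Hom}$-finite: all its morphism spaces are finite dimensional over $k$. Moreover, sending $a\in \Lambda$ to the image under $Q$ of the right multiplication $\Lambda\to\Lambda$, $x\mapsto xa$, induces an isomorphism of $k$-algebras $$\Lambda/\Lambda e_0\Lambda\;\cong\;\operatorname{End}_{D^b_f(\Lambda)/\langle P_0\rangle}(\Lambda)^{\mathrm{op}}$$ (the opposite ring appears because endomorphisms are composed as functions, written on the left, and act on left modules). 2. In the graded case the same holds for graded modules. Let $\Lambda_n\subset\Lambda$ be the space of endomorphisms of $M$ of degree $n$, let $D^b_f(\operatorname{gr}\Lambda)$ be the analogous full subcategory of the derived category of $\mathbb Z$-graded left $\Lambda$-modules and degree-preserving maps, and divide by the thick subcategory $\langle P_0(n)\mid n\in\mathbb Z\rangle$ generated by all degree twists of $P_0$. This Verdier quotient is $\operatorname{Hom}$-finite, and for every $n\in\mathbb Z$ right multiplication induces an isomorphism of the part of degree $n$ of $\Lambda/\Lambda e_0\Lambda$, that is $\Lambda_n/(\Lambda_n\cap\Lambda e_0\Lambda)$, with $\operatorname{Hom}(\Lambda,\Lambda(n))$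 in the quotient category. -/

import Mathlib

open CategoryTheory Limits

universe u

attribute [instance] HasDerivedCategory.standard

noncomputable section

namespace NCResolution

section CommutativeAlgebra

/-- `R` is noetherian and has finite injective dimension over itself. (For a noetherian ring of
finite Krull dimension this holds if and only if all its localizations are Gorenstein.) -/
def IsGorenstein (R : Type u) [CommRing R] : Prop :=
  IsNoetherianRing R ∧ ∃ n : ℕ, HasInjectiveDimensionLE (ModuleCat.of R R) n

/-- `Spec R ∖ {m}` is regular. -/
def IsIsolatedSingularity {R : Type u} [CommRing R] (m : Ideal R) : Prop :=
  ∀ (p : Ideal R) [p.IsPrime], p ≠ m → IsRegularLocalRing (Localization.AtPrime p)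

/-- `depth_m N = dim R`: there is an `N`-regular sequence in `m` of length `dim R`. -/
def IsMaximalCohenMacaulay {R : Type u} [CommRing R] (m : Ideal R) (N : Type u) [AddCommGroup N]
    [Module R N] : Prop :=
  ∃ rs : List R, (∀ r ∈ rs, r ∈ m) ∧ RingTheory.Sequence.IsRegular N rs ∧
    (rs.length : WithBot ℕ∞) = ringKrullDim R

/-- `Λ` has finite (left) global dimension. -/
def HasFiniteGlobalDimension (Λ : Type u) [Ring Λ] : Prop :=
  ∃ d : ℕ, ∀ M : ModuleCat.{u} Λ, HasProjectiveDimensionLE M d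

/-- A nonzero module that is not a direct sum of two nonzero submodules. -/
def IsIndecomposable (R N : Type u) [CommRing R] [AddCommGroup N] [Module R N] : Prop :=
  Nontrivial N ∧ ∀ A B : Submodule R N, IsCompl A B → A = ⊥ ∨ B = ⊥

end CommutativeAlgebra

section TriangulatedCategories

/-- All morphism spaces are finite dimensional over `k`. -/
def HomFinite (k : Type*) [Field k] (C : Type*) [Category* C] [Preadditive C] [Linear k C] : Prop :=
  ∀ X Y : C, FiniteDimensional k (X ⟶ Y)

/-- The Verdier quotient of a triangulated category by the smallest thick subcategory
that contains the objects satisfying `S`. -/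
abbrev VerdierQuotient {T : Type*} [Category* T] [Preadditive T] [HasZeroObject T] [HasShift T ℤ]
    [∀ n : ℤ, (shiftFunctor T n).Additive] [Pretriangulated T] (S : ObjectProperty T) : Type _ :=
  S.triangEnvelope.trW.Localization

/-- The quotient functor. -/
abbrev toVerdierQuotient {T : Type*} [Category* T] [Preadditive T] [HasZeroObject T] [HasShift T ℤ]
    [∀ n : ℤ, (shiftFunctor T n).Additive] [Pretriangulated T] (S : ObjectProperty T) :
    T ⥤ VerdierQuotient S :=
  S.triangEnvelope.trW.Q

variable {A : Type*} [Category* A] [Abelian A] (P : ObjectProperty A)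

/-- The objects of the derived category with bounded cohomology, whose cohomology objects all
satisfy `P`. -/
def boundedWith : ObjectProperty (DerivedCategory A) :=
  DerivedCategory.TStructure.t.bounded ⊓
    fun X => ∀ n : ℤ, P ((DerivedCategory.homologyFunctor A n).obj X)

variable [P.IsSerreClass]

instance : ObjectProperty.IsClosedUnderIsomorphisms
    (fun X : DerivedCategory A => ∀ n : ℤ, P ((DerivedCategory.homologyFunctor A n).obj X)) where
  of_iso e h n := P.prop_of_iso ((DerivedCategory.homologyFunctor A n).mapIso e) (h n)

open ZeroObject in
instance : ObjectProperty.IsTriangulated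
    (fun X : DerivedCategory A => ∀ n : ℤ, P ((DerivedCategory.homologyFunctor A n).obj X)) where
  exists_zero := ⟨0, isZero_zero _, fun n =>
    P.prop_of_isZero ((DerivedCategory.homologyFunctor A n).map_isZero (isZero_zero _))⟩
  isStableUnderShiftBy a := ⟨fun X hX n => P.prop_of_iso
    (((DerivedCategory.homologyFunctor A 0).shiftIso a n (a + n) rfl).app X).symm (hX (a + n))⟩
  toIsTriangulatedClosed₂ := .mk' fun T hT h₁ h₃ n =>
    P.prop_X₂_of_exact (DerivedCategory.HomologySequence.exact₂ T hT n) (h₁ n) (h₃ n)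

instance : (boundedWith P).IsTriangulated := by
  unfold boundedWith; infer_instance

lemma boundedWith_single (X : A) (hX : P X) :
    boundedWith P ((DerivedCategory.singleFunctor A 0).obj X) := by
  refine ⟨⟨⟨0, ?_⟩, ⟨0, ?_⟩⟩, fun n => ?_⟩
  · exact (inferInstance : ((DerivedCategory.singleFunctor A 0).obj X).IsGE 0)
  · exact (inferInstance : ((DerivedCategory.singleFunctor A 0).obj X).IsLE 0)
  · rcases lt_trichotomy n 0 with h | rfl | h
    · exact P.prop_of_isZero (DerivedCategory.isZero_of_isGE _ 0 n h)
    · exact P.prop_of_iso ((DerivedCategory.homologyFunctor A 0).mapIso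
        ((DerivedCategory.singleFunctorIsoCompQ A 0).app X) ≪≫
          (DerivedCategory.homologyFunctorFactors A 0).app _ ≪≫
          (HomologicalComplex.homologyFunctorSingleIso A (ComplexShape.up ℤ) 0).app X).symm hX
    · exact P.prop_of_isZero (DerivedCategory.isZero_of_isLE _ 0 n h)

/-- Objects of `A` that satisfy `P`, as complexes concentrated in degree `0`. -/
def stalk : P.FullSubcategory ⥤ (boundedWith P).FullSubcategory :=
  (boundedWith P).lift (P.ι ⋙ DerivedCategory.singleFunctor A 0)
    fun X => boundedWith_single P X.1 X.2

end TriangulatedCategories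

section Modules

variable {Λ : Type u} [Ring Λ] [IsNoetherianRing Λ]

instance : (ModuleCat.isFG.{u} Λ).IsSerreClass where
  exists_zero := ⟨.of Λ PUnit, ModuleCat.isZero_of_subsingleton _,
    (inferInstance : Module.Finite Λ PUnit.{u + 1})⟩
  prop_of_mono {M N} f hf (hN : Module.Finite Λ N) :=
    Module.Finite.of_injective f.hom ((ModuleCat.mono_iff_injective f).1 hf)
  prop_of_epi {M N} f hf (hM : Module.Finite Λ M) :=
    Module.Finite.of_surjective f.hom ((ModuleCat.epi_iff_surjective f).1 hf)
  prop_X₂_of_shortExact {S} hS h₁ h₃ := by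
    have h₁ : Module.Finite Λ S.X₁ := h₁
    have h₃ : Module.Finite Λ S.X₃ := h₃
    refine ⟨Submodule.fg_of_fg_map_of_fg_inf_ker S.g.hom ?_ ?_⟩
    · exact IsNoetherian.noetherian _
    · rw [top_inf_eq, ← hS.exact.moduleCat_range_eq_ker, LinearMap.range_eq_map]
      exact h₁.fg_top.map S.f.hom

variable (Λ)

/-- `D^b_f(Λ)`: the full subcategory of the derived category of left `Λ`-modules on the objects
with bounded and finitely generated cohomology. -/
abbrev Dbf : Type _ := (boundedWith (ModuleCat.isFG.{u} Λ)).FullSubcategory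

/-- The left module `Λ`, as an object of `D^b_f(Λ)`. -/
def regularObj : Dbf Λ :=
  (stalk (ModuleCat.isFG.{u} Λ)).obj ⟨.of Λ Λ, (inferInstance : Module.Finite Λ Λ)⟩

variable {Λ}

/-- Right multiplication by `a`, as an endomorphism of `Λ` in `D^b_f(Λ)`. -/
def rightMul (a : Λ) : regularObj Λ ⟶ regularObj Λ :=
  (stalk (ModuleCat.isFG.{u} Λ)).map
    (ObjectProperty.homMk (ModuleCat.ofHom (LinearMap.toSpanSingleton Λ Λ a)))

/-- The left module `Λe`, as an object of `D^b_f(Λ)`. -/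
def leftIdealObj (e : Λ) : Dbf Λ :=
  (stalk (ModuleCat.isFG.{u} Λ)).obj
    ⟨.of Λ (Ideal.span {e} : Ideal Λ), (inferInstance : Module.Finite Λ (Ideal.span {e}))⟩

/-- The Verdier quotient `D^b_f(Λ)/⟨Λe⟩`. -/
abbrev DbfQuotient (e : Λ) : Type _ := VerdierQuotient (.singleton (leftIdealObj e))

/-- The quotient functor `D^b_f(Λ) → D^b_f(Λ)/⟨Λe⟩`. -/
abbrev toDbfQuotient (e : Λ) : Dbf Λ ⥤ DbfQuotient e :=
  toVerdierQuotient (.singleton (leftIdealObj e))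

/-- The two-sided ideal `ΛeΛ`. -/
abbrev twoSided {Λ : Type u} [Ring Λ] (e : Λ) : Ideal Λ := (TwoSidedIdeal.span {e}).asIdeal

end Modules

/-- A graded left module over the `ℤ`-graded `k`-algebra with homogeneous parts `𝒜 i ⊆ Λ`:
a family of `k`-vector spaces `X j` with an action `𝒜 i × X j → X (i + j)`. -/
structure GrMod {k Λ : Type u} [Field k] [Ring Λ] [Algebra k Λ]
    (𝒜 : ℤ → Submodule k Λ) [SetLike.GradedMonoid 𝒜] where
  X : ℤ → Type u
  [addCommGroup : ∀ j, AddCommGroup (X j)]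
  [module : ∀ j, Module k (X j)]
  act : ∀ {i j n : ℤ}, i + j = n → 𝒜 i →ₗ[k] X j →ₗ[k] X n
  one_act : ∀ {j : ℤ} (x : X j), act (zero_add j) ⟨1, SetLike.GradedOne.one_mem⟩ x = x
  mul_act : ∀ {i j l m n : ℤ} (hm : j + l = m) (hn : i + m = n) (h : i + j + l = n)
    (a : 𝒜 i) (b : 𝒜 j) (x : X l),
    act h ⟨(a : Λ) * b, SetLike.GradedMul.mul_mem a.2 b.2⟩ x = act hn a (act hm b x)

namespace GrMod

attribute [instance] GrMod.addCommGroup GrMod.module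

variable {k Λ : Type u} [Field k] [Ring Λ] [Algebra k Λ]
  {𝒜 : ℤ → Submodule k Λ} [SetLike.GradedMonoid 𝒜]

lemma act_congr (M : GrMod 𝒜) {i i' j n : ℤ} (hi : i = i') (h : i + j = n) (h' : i' + j = n)
    {a : 𝒜 i} {a' : 𝒜 i'} (ha : (a : Λ) = a') (x : M.X j) : M.act h a x = M.act h' a' x := by
  subst hi
  rw [Subtype.ext ha]

/-- The `k`-vector space of degree-preserving `Λ`-linear maps. -/
def homs (M N : GrMod 𝒜) : Submodule k (∀ j, M.X j →ₗ[k] N.X j) where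
  carrier := {f | ∀ (i j n : ℤ) (h : i + j = n) (a : 𝒜 i) (x : M.X j),
    f n (M.act h a x) = N.act h a (f j x)}
  zero_mem' _ _ _ _ _ _ := by simp
  add_mem' hf hg _ _ _ _ _ _ := by simp [hf _ _ _ _, hg _ _ _ _]
  smul_mem' c f hf _ _ _ _ _ _ := by simp [hf _ _ _ _]

instance : Category (GrMod 𝒜) where
  Hom M N := homs M N
  id M := ⟨fun _ => LinearMap.id, fun _ _ _ _ _ _ => rfl⟩
  comp f g := ⟨fun j => g.1 j ∘ₗ f.1 j, fun _ _ _ h a x => by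
    simp [f.2 _ _ _ h, g.2 _ _ _ h]⟩

/-- The degree `j` part of a morphism. -/
def app {M N : GrMod 𝒜} (f : M ⟶ N) (j : ℤ) : M.X j →ₗ[k] N.X j := f.1 j

/-- Build a morphism from its homogeneous parts. -/
def ofApp {M N : GrMod 𝒜} (f : ∀ j, M.X j →ₗ[k] N.X j)
    (h : ∀ (i j n : ℤ) (h : i + j = n) (a : 𝒜 i) (x : M.X j),
      f n (M.act h a x) = N.act h a (f j x)) : M ⟶ N := ⟨f, h⟩

variable {M N P : GrMod 𝒜}

@[simp] lemma app_ofApp (f : ∀ j, M.X j →ₗ[k] N.X j) (h) (j : ℤ) : app (ofApp f h) j = f j := rfl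

lemma map_act (f : M ⟶ N) {i j n : ℤ} (h : i + j = n) (a : 𝒜 i) (x : M.X j) :
    app f n (M.act h a x) = N.act h a (app f j x) := f.2 i j n h a x

lemma hom_ext {f g : M ⟶ N} (h : ∀ j x, app f j x = app g j x) : f = g :=
  Subtype.ext (funext fun j => LinearMap.ext (h j))

@[simp] lemma id_app (j : ℤ) (x : M.X j) : app (𝟙 M) j x = x := rfl

@[simp] lemma comp_app (f : M ⟶ N) (g : N ⟶ P) (j : ℤ) (x : M.X j) :
    app (f ≫ g) j x = app g j (app f j x) := rfl

instance : Preadditive (GrMod 𝒜) where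
  homGroup M N := inferInstanceAs (AddCommGroup (homs M N))
  add_comp _ _ _ f f' g := hom_ext fun j x => map_add (app g j) (app f j x) (app f' j x)
  comp_add _ _ _ _ _ _ := rfl

instance : Linear k (GrMod 𝒜) where
  homModule M N := inferInstanceAs (Module k (homs M N))
  smul_comp _ _ _ c f g := hom_ext fun j x => map_smul (app g j) c (app f j x)
  comp_smul _ _ _ _ _ _ := rfl

@[simp] lemma zero_app (j : ℤ) (x : M.X j) : app (0 : M ⟶ N) j x = 0 := rfl

lemma app_eq_zero_of_comp {f : M ⟶ N} {g : N ⟶ P} (w : f ≫ g = 0) (j : ℤ) (x : M.X j) :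
    app g j (app f j x) = 0 := by
  rw [← comp_app, w]; rfl

/-- The kernel of a morphism, computed degreewise. -/
def ker (f : M ⟶ N) : GrMod 𝒜 where
  X j := LinearMap.ker (app f j)
  act {i j n} h := LinearMap.mk₂ k
    (fun a x => ⟨M.act h a x.1, by
      have := x.2
      rw [LinearMap.mem_ker] at this ⊢
      rw [map_act, this, map_zero]⟩)
    (fun _ _ _ => by ext; simp) (fun _ _ _ => by ext; simp)
    (fun _ _ _ => by ext; simp) (fun _ _ _ => by ext; simp)
  one_act x := Subtype.ext (M.one_act x.1)
  mul_act hm hn h a b x := Subtype.ext (M.mul_act hm hn h a b x.1)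

/-- The inclusion of the kernel. -/
def kerι (f : M ⟶ N) : ker f ⟶ M := ofApp (fun j => (LinearMap.ker (app f j)).subtype)
  fun _ _ _ _ _ _ => rfl

lemma kerι_comp (f : M ⟶ N) : kerι f ≫ f = 0 := hom_ext fun _ x => x.2

/-- The universal property of the kernel. -/
def kerIsLimit (f : M ⟶ N) : IsLimit (KernelFork.ofι (kerι f) (kerι_comp f)) :=
  KernelFork.IsLimit.ofι _ _
    (fun g w => ofApp (fun j => (app g j).codRestrict _ (app_eq_zero_of_comp w j))
      fun _ _ _ h a x => Subtype.ext (map_act g h a x))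
    (fun _ _ => rfl)
    (fun _ _ m hm => hom_ext fun j x => Subtype.ext (by subst hm; rfl))

/-- The cokernel of a morphism, computed degreewise. -/
def coker (f : M ⟶ N) : GrMod 𝒜 where
  X j := N.X j ⧸ LinearMap.range (app f j)
  act {i j n} h :=
    { toFun := fun a => Submodule.mapQ _ _ (N.act h a) (by
        rintro _ ⟨x, rfl⟩
        exact ⟨M.act h a x, map_act f h a x⟩)
      map_add' := fun a b => by ext x; simp
      map_smul' := fun c a => by ext x; simp }
  one_act x := by
    obtain ⟨x, rfl⟩ := Submodule.mkQ_surjective _ x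
    exact congrArg (Submodule.mkQ _) (N.one_act x)
  mul_act hm hn h a b x := by
    obtain ⟨x, rfl⟩ := Submodule.mkQ_surjective _ x
    exact congrArg (Submodule.mkQ _) (N.mul_act hm hn h a b x)

/-- The projection to the cokernel. -/
def cokerπ (f : M ⟶ N) : N ⟶ coker f := ofApp (fun j => (LinearMap.range (app f j)).mkQ)
  fun _ _ _ _ _ _ => rfl

lemma comp_cokerπ (f : M ⟶ N) : f ≫ cokerπ f = 0 :=
  hom_ext fun _ x => (Submodule.Quotient.mk_eq_zero _).2 ⟨x, rfl⟩

/-- The universal property of the cokernel. -/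
def cokerIsColimit (f : M ⟶ N) : IsColimit (CokernelCofork.ofπ (cokerπ f) (comp_cokerπ f)) :=
  CokernelCofork.IsColimit.ofπ _ _
    (fun g w => ofApp (fun j => Submodule.liftQ _ (app g j) (by
        rintro _ ⟨x, rfl⟩
        exact app_eq_zero_of_comp w j x))
      fun _ _ _ h a x => by
        obtain ⟨x, rfl⟩ := Submodule.mkQ_surjective _ x
        exact map_act g h a x)
    (fun _ _ => rfl)
    (fun _ _ m hm => hom_ext fun j x => by
      obtain ⟨x, rfl⟩ := Submodule.mkQ_surjective _ x
      subst hm; rfl)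

lemma injective_of_mono (f : M ⟶ N) [Mono f] (j : ℤ) : Function.Injective (app f j) := by
  have h : kerι f = 0 := by rw [← cancel_mono f, kerι_comp, zero_comp]
  rw [injective_iff_map_eq_zero]
  intro x hx
  exact congrArg (fun g : ker f ⟶ M => app g j (⟨x, hx⟩ : LinearMap.ker (app f j))) h

lemma surjective_of_epi (f : M ⟶ N) [Epi f] (j : ℤ) : Function.Surjective (app f j) := by
  have h : cokerπ f = 0 := by rw [← cancel_epi f, comp_cokerπ, comp_zero]
  intro y
  have := congrArg (fun g => app g j y) h
  exact (Submodule.Quotient.mk_eq_zero _).1 this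

/-- Products, computed degreewise. -/
def pi {J : Type} (M : J → GrMod 𝒜) : GrMod 𝒜 where
  X j := ∀ s, (M s).X j
  act {i j n} h := LinearMap.mk₂ k (fun a x s => (M s).act h a (x s))
    (fun _ _ _ => by ext; simp) (fun _ _ _ => by ext; simp)
    (fun _ _ _ => by ext; simp) (fun _ _ _ => by ext; simp)
  one_act x := funext fun s => (M s).one_act (x s)
  mul_act hm hn h a b x := funext fun s => (M s).mul_act hm hn h a b (x s)

/-- The projections of a product. -/
def piProj {J : Type} (M : J → GrMod 𝒜) (s : J) : pi M ⟶ M s :=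
  ofApp (M := pi M) (fun _ => LinearMap.proj (φ := fun s => (M s).X _) s) fun _ _ _ _ _ _ => rfl

/-- The universal property of products. -/
def piIsLimit {J : Type} (M : J → GrMod 𝒜) : IsLimit (Fan.mk (pi M) (piProj M)) :=
  Fan.IsLimit.mk _
    (fun c => ofApp (N := pi M)
      (fun j => LinearMap.pi (φ := fun s => (M s).X j) fun s => app (c.proj s) j)
      fun _ _ _ h a x => funext fun s => map_act (c.proj s) h a x)
    (fun _ _ => rfl)
    (fun c _ hm => hom_ext fun j x => funext fun s =>
      congrArg (fun g : c.pt ⟶ M s => app g j x) (hm s))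

instance : HasFiniteProducts (GrMod 𝒜) where
  out _ := ⟨fun F => @hasLimit_of_iso _ _ _ _ _ _ ⟨⟨_, piIsLimit fun s => F.obj ⟨s⟩⟩⟩
    (Discrete.natIsoFunctor (F := F)).symm⟩

lemma symm_apply_map {V W : Type u} [AddCommGroup V] [AddCommGroup W] [Module k V] [Module k W]
    (f : V →ₗ[k] W) (hf : Function.Surjective f) (x : V) :
    (f.quotKerEquivOfSurjective hf).symm (f x) = Submodule.Quotient.mk x := by
  rw [LinearEquiv.symm_apply_eq]; rfl

instance : Abelian (GrMod 𝒜) where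
  has_kernels := ⟨fun f => ⟨⟨_, kerIsLimit f⟩⟩⟩
  has_cokernels := ⟨fun f => ⟨⟨_, cokerIsColimit f⟩⟩⟩
  normalMonoOfMono {M N} f _ := ⟨
    { Z := coker f
      g := cokerπ f
      w := comp_cokerπ f
      isLimit := KernelFork.IsLimit.ofι _ _
        (fun {W} g w => ofApp
          (fun j => (LinearEquiv.ofInjective _ (injective_of_mono f j)).symm.toLinearMap ∘ₗ
            (app g j).codRestrict _ fun x => (Submodule.Quotient.mk_eq_zero _).1
              (app_eq_zero_of_comp w j x))
          fun i j n h a x => injective_of_mono f n (by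
            rw [map_act]
            simp [map_act]))
        (fun g w => hom_ext fun j x => by simp)
        (fun g w m hm => hom_ext fun j x => injective_of_mono f j (by subst hm; simp)) }⟩
  normalEpiOfEpi {M N} f _ := ⟨
    { W := ker f
      g := kerι f
      w := kerι_comp f
      isColimit := CokernelCofork.IsColimit.ofπ _ _
        (fun g w => ofApp
          (fun j => (LinearMap.ker (app f j)).liftQ (app g j) (fun x hx =>
              app_eq_zero_of_comp w j (⟨x, hx⟩ : LinearMap.ker (app f j))) ∘ₗ
            ((app f j).quotKerEquivOfSurjective (surjective_of_epi f j)).symm.toLinearMap)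
          fun i j n h a x => by
            obtain ⟨x, rfl⟩ := surjective_of_epi f j x
            rw [← map_act]
            simp only [LinearMap.comp_apply, LinearEquiv.coe_coe, symm_apply_map]
            exact map_act g h a x)
        (fun g w => hom_ext fun j x => by
          simp only [comp_app, app_ofApp, LinearMap.comp_apply, LinearEquiv.coe_coe,
            symm_apply_map]
          rfl)
        (fun g w m hm => hom_ext fun j x => by
          obtain ⟨x, rfl⟩ := surjective_of_epi f j x
          subst hm
          simp only [app_ofApp, LinearMap.comp_apply, LinearEquiv.coe_coe, symm_apply_map]
          rfl) }⟩

lemma exists_of_shortExact {S : ShortComplex (GrMod 𝒜)} (hS : S.ShortExact) {j : ℤ}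
    (y : S.X₂.X j) (hy : app S.g j y = 0) : ∃ x, app S.f j x = y := by
  have h := hS.fIsKernel.fac (KernelFork.ofι (kerι S.g) (kerι_comp S.g)) WalkingParallelPair.zero
  exact ⟨_, congrArg (fun g : ker S.g ⟶ S.X₂ => app g j (⟨y, hy⟩ : LinearMap.ker (app S.g j))) h⟩

/-- Finitely generated graded modules: there are finitely many homogeneous elements `x s` of
degrees `d s` such that every homogeneous element is a combination of them with homogeneous
coefficients. -/
def isFG (𝒜 : ℤ → Submodule k Λ) [SetLike.GradedMonoid 𝒜] : ObjectProperty (GrMod 𝒜) := fun M =>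
  ∃ (ι : Type u) (_ : Fintype ι) (d : ι → ℤ) (x : ∀ s, M.X (d s)), ∀ (j : ℤ) (y : M.X j),
    ∃ a : ∀ s, 𝒜 (j - d s), y = ∑ s, M.act (sub_add_cancel j (d s)) (a s) (x s)

lemma isFG_of_epi (f : M ⟶ N) [Epi f] (hM : isFG 𝒜 M) : isFG 𝒜 N := by
  obtain ⟨ι, _, d, x, h⟩ := hM
  refine ⟨ι, inferInstance, d, fun s => app f _ (x s), fun j y => ?_⟩
  obtain ⟨y, rfl⟩ := surjective_of_epi f j y
  obtain ⟨a, rfl⟩ := h j y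
  exact ⟨a, by simp only [map_sum, map_act]⟩

lemma isFG_of_shortExact {S : ShortComplex (GrMod 𝒜)} (hS : S.ShortExact)
    (h₁ : isFG 𝒜 S.X₁) (h₃ : isFG 𝒜 S.X₃) : isFG 𝒜 S.X₂ := by
  obtain ⟨ι, _, d, x, h⟩ := h₁
  obtain ⟨ι', _, d', x', h'⟩ := h₃
  have := hS.epi_g
  choose z hz using fun s => surjective_of_epi S.g (d' s) (x' s)
  refine ⟨ι ⊕ ι', inferInstance, Sum.elim d d', fun s => match s with
    | .inl s => app S.f _ (x s)
    | .inr s => z s, fun j y => ?_⟩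
  obtain ⟨b, hb⟩ := h' j (app S.g j y)
  obtain ⟨w, hw⟩ := exists_of_shortExact hS
    (y - ∑ s, S.X₂.act (sub_add_cancel j (d' s)) (b s) (z s)) (by
      simp only [map_sub, map_sum, map_act, hz, hb, sub_self])
  obtain ⟨a, rfl⟩ := h j w
  refine ⟨fun s => match s with
    | .inl s => a s
    | .inr s => b s, ?_⟩
  rw [Fintype.sum_sum_type]
  simp only [map_sum, map_act] at hw
  exact (sub_eq_iff_eq_add.1 hw.symm)

lemma isFG_of_mono [GradedAlgebra 𝒜] [IsNoetherianRing Λ] (f : M ⟶ N) [Mono f]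
    (hN : isFG 𝒜 N) : isFG 𝒜 M := by
  obtain ⟨ι, _, d, x, h⟩ := hN
  let T : Set (ι → Λ) := {b | ∃ (j : ℤ) (a : ∀ s, 𝒜 (j - d s)) (y : M.X j),
    (∀ s, b s = a s) ∧ app f j y = ∑ s, N.act (sub_add_cancel j (d s)) (a s) (x s)}
  obtain ⟨t, htT, ht⟩ := (Submodule.fg_span_iff_fg_span_finset_subset (R := Λ) T).1
    (IsNoetherian.noetherian _)
  choose e a y hba hy using fun b : t => htT b.2
  refine ⟨t, inferInstance, e, y, fun j z => ?_⟩
  obtain ⟨c, hc⟩ := h j (app f j z)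
  have hmem : (fun s => (c s : Λ)) ∈ Submodule.span Λ (t : Set (ι → Λ)) := by
    rw [← ht]
    exact Submodule.subset_span ⟨j, c, z, fun _ => rfl, hc⟩
  obtain ⟨g, hg⟩ := (Submodule.mem_span_range_iff_exists_fun Λ (v := fun b : t => (b : ι → Λ))).1
    (by simpa using hmem)
  refine ⟨fun b => DirectSum.decompose 𝒜 (g b) (j - e b), injective_of_mono f j ?_⟩
  have hcs : ∀ s, c s = ∑ b : t, (⟨(DirectSum.decompose 𝒜 (g b) (j - e b) : Λ) * a b s, by
      have := SetLike.GradedMul.mul_mem (DirectSum.decompose 𝒜 (g b) (j - e b)).2 (a b s).2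
      rwa [sub_add_sub_cancel] at this⟩ : 𝒜 (j - d s)) := by
    intro s
    refine Subtype.ext ?_
    have h1 := congrArg (fun u => (DirectSum.decompose 𝒜 u (j - d s) : Λ)) (congrFun hg s)
    simp only [Finset.sum_apply, Pi.smul_apply, smul_eq_mul, DirectSum.decompose_coe,
      DirectSum.of_eq_same, DirectSum.decompose_sum] at h1
    rw [← h1, DFinsupp.finsetSum_apply, AddSubmonoidClass.coe_finsetSum,
      AddSubmonoidClass.coe_finsetSum]
    refine Finset.sum_congr rfl fun b _ => ?_
    rw [hba b s]
    refine Eq.trans ?_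
      (DirectSum.coe_decompose_mul_add_of_right_mem 𝒜 (i := j - e b) (a b s).2)
    rw [sub_add_sub_cancel]
  simp only [map_sum, map_act]
  rw [hc]
  simp only [hy, map_sum]
  rw [Finset.sum_comm]
  refine Finset.sum_congr rfl fun s _ => ?_
  rw [hcs s, map_sum, LinearMap.sum_apply]
  refine Finset.sum_congr rfl fun b _ => ?_
  rw [← N.mul_act (sub_add_cancel (e b) (d s)) (sub_add_cancel j (e b)) (by ring)]
  exact N.act_congr (sub_add_sub_cancel ..).symm _ _ rfl _

instance [GradedAlgebra 𝒜] [IsNoetherianRing Λ] : (isFG 𝒜).IsSerreClass where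
  exists_zero := ⟨_, isZero_zero _, PEmpty, inferInstance, nofun, nofun, fun j y => ⟨nofun, by
    rw [Finset.univ_eq_empty, Finset.sum_empty]
    exact congrArg (fun g => app g j y) ((isZero_zero (GrMod 𝒜)).eq_of_src (𝟙 _) 0)⟩⟩
  prop_of_mono f _ h := isFG_of_mono f h
  prop_of_epi f _ h := isFG_of_epi f h
  prop_X₂_of_shortExact hS h₁ h₃ := isFG_of_shortExact hS h₁ h₃

/-- The graded module `I(n)` for a left ideal `I` of `Λ` that is generated by homogeneous elements;
its part of degree `j` is `I ∩ 𝒜 (j + n)`. -/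
def ofLeftIdeal (𝒜 : ℤ → Submodule k Λ) [SetLike.GradedMonoid 𝒜] (I : Ideal Λ) (n : ℤ) :
    GrMod 𝒜 where
  X j := ↥(𝒜 (j + n) ⊓ I.restrictScalars k)
  act {i j m} h := LinearMap.mk₂ k
    (fun a x => ⟨(a : Λ) * x, by
      have := SetLike.GradedMul.mul_mem a.2 x.2.1
      rwa [← add_assoc, h] at this, I.mul_mem_left _ x.2.2⟩)
    (fun _ _ _ => Subtype.ext (add_mul _ _ _)) (fun _ _ _ => Subtype.ext (smul_mul_assoc _ _ _))
    (fun _ _ _ => Subtype.ext (mul_add _ _ _)) (fun _ _ _ => Subtype.ext (mul_smul_comm _ _ _))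
  one_act x := Subtype.ext (one_mul _)
  mul_act _ _ _ _ _ _ := Subtype.ext (mul_assoc _ _ _)

lemma isFG_ofLeftIdeal (e : Λ) (he : e ∈ 𝒜 0) (hee : e * e = e) (n : ℤ) :
    isFG 𝒜 (ofLeftIdeal 𝒜 (Ideal.span {e}) n) := by
  refine ⟨PUnit, inferInstance, fun _ => -n, fun _ => ⟨e, by rwa [neg_add_cancel],
    Ideal.subset_span rfl⟩, fun j y => ⟨fun _ => ⟨y.1, by rw [sub_neg_eq_add]; exact y.2.1⟩, ?_⟩⟩
  rw [Fintype.sum_unique]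
  obtain ⟨b, hb⟩ := Ideal.mem_span_singleton'.1 y.2.2
  refine Subtype.ext (?_ : y.1 = y.1 * e)
  rw [← hb, mul_assoc, hee]

/-- The graded module `Λ(n)`. -/
def regular (𝒜 : ℤ → Submodule k Λ) [SetLike.GradedMonoid 𝒜] (n : ℤ) : GrMod 𝒜 :=
  ofLeftIdeal 𝒜 ⊤ n

lemma isFG_regular (n : ℤ) : isFG 𝒜 (regular 𝒜 n) := by
  rw [regular, ← Ideal.span_singleton_one]
  exact isFG_ofLeftIdeal 1 SetLike.GradedOne.one_mem (one_mul 1) n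

/-- Right multiplication `Λ → Λ(n)` by an element of degree `n`. -/
def rightMul {n : ℤ} (a : 𝒜 n) : regular 𝒜 0 ⟶ regular 𝒜 n :=
  ofApp (M := regular 𝒜 0) (N := regular 𝒜 n)
    (fun j =>
      { toFun := fun x => ⟨x.1 * a, by
          have h := SetLike.GradedMul.mul_mem x.2.1 a.2
          exact (congrArg (fun i => x.1 * a.1 ∈ 𝒜 (i + n)) (add_zero j)).mp h, trivial⟩
        map_add' := fun _ _ => Subtype.ext (add_mul _ _ _)
        map_smul' := fun _ _ => Subtype.ext (smul_mul_assoc _ _ _) })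
    fun _ _ _ _ _ _ => Subtype.ext (mul_assoc _ _ _)

end GrMod

section Gradings

/-- A direct sum decomposition from a family of projections. -/
@[reducible]
def decompositionOfProj {k M : Type*} [Field k] [AddCommGroup M] [Module k M]
    (𝓜 : ℤ → Submodule k M) (p : ℤ → M →ₗ[k] M) (hmem : ∀ j x, p j x ∈ 𝓜 j)
    (hfin : ∀ x, {j | p j x ≠ 0}.Finite) (hsum : ∀ x, ∑ j ∈ (hfin x).toFinset, p j x = x)
    (hself : ∀ j, ∀ x ∈ 𝓜 j, p j x = x) (hne : ∀ i j, i ≠ j → ∀ x ∈ 𝓜 i, p j x = 0) :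
    DirectSum.Decomposition 𝓜 where
  decompose' x := ∑ j ∈ (hfin x).toFinset, DirectSum.of (fun j => 𝓜 j) j ⟨p j x, hmem j x⟩
  left_inv x := by
    rw [map_sum]
    simp only [DirectSum.coeAddMonoidHom_of]
    exact hsum x
  right_inv d := by
    have key : ∀ (d : DirectSum ℤ fun j => 𝓜 j) (j : ℤ),
        p j (DirectSum.coeAddMonoidHom 𝓜 d) = d j := by
      intro d j
      induction d using DirectSum.induction_on with
      | zero => simp
      | of i x =>
        rw [DirectSum.coeAddMonoidHom_of]
        by_cases h : i = j
        · subst h; rw [hself i x x.2, DirectSum.of_eq_same]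
        · rw [hne i j h x x.2, DirectSum.of_eq_of_ne _ _ _ (Ne.symm h)]; rfl
      | add x y hx hy => simp [hx, hy]
    refine DFinsupp.ext fun j => Subtype.ext ?_
    rw [DFinsupp.finsetSum_apply, AddSubmonoidClass.coe_finsetSum]
    by_cases hj : j ∈ (hfin (DirectSum.coeAddMonoidHom 𝓜 d)).toFinset
    · rw [Finset.sum_eq_single_of_mem j hj]
      · exact (congrArg Subtype.val (DirectSum.of_eq_same (β := fun j => 𝓜 j) j _)).trans (key d j)
      · intro i _ hi
        exact congrArg Subtype.val (DirectSum.of_eq_of_ne (β := fun j => 𝓜 j) i j _ (Ne.symm hi))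
    · rw [Finset.sum_eq_zero]
      · rw [← key d j]
        simpa [eq_comm] using hj
      · intro i hi
        refine congrArg Subtype.val (DirectSum.of_eq_of_ne (β := fun j => 𝓜 j) i j _ ?_)
        rintro rfl
        exact hj hi

variable {k R : Type*} [Field k] [CommRing R] [Algebra k R]

/-- The projection of a graded vector space onto its part of degree `j`. -/
def grProj {M : Type*} [AddCommGroup M] [Module k M] (𝓜 : ℤ → Submodule k M)
    [DirectSum.Decomposition 𝓜] (j : ℤ) : M →ₗ[k] M :=
  (𝓜 j).subtype ∘ₗ DirectSum.component k ℤ (fun i => 𝓜 i) j ∘ₗ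
    (DirectSum.decomposeLinearEquiv 𝓜).toLinearMap

section
variable {M : Type*} [AddCommGroup M] [Module k M] (𝓜 : ℤ → Submodule k M)
    [DirectSum.Decomposition 𝓜]

lemma grProj_apply (j : ℤ) (x : M) : grProj 𝓜 j x = DirectSum.decompose 𝓜 x j := rfl

lemma grProj_mem (j : ℤ) (x : M) : grProj 𝓜 j x ∈ 𝓜 j := (DirectSum.decompose 𝓜 x j).2

lemma grProj_self (j : ℤ) (x : M) (hx : x ∈ 𝓜 j) : grProj 𝓜 j x = x :=
  DirectSum.decompose_of_mem_same 𝓜 hx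

lemma grProj_ne (i j : ℤ) (h : i ≠ j) (x : M) (hx : x ∈ 𝓜 i) : grProj 𝓜 j x = 0 :=
  DirectSum.decompose_of_mem_ne 𝓜 hx h

lemma grProj_finite (x : M) : {j | grProj 𝓜 j x ≠ 0}.Finite := by
  classical
  refine ((DirectSum.decompose 𝓜 x).support.finite_toSet).subset fun j hj => ?_
  simpa [grProj_apply] using hj

lemma sum_grProj_of_subset (x : M) (F : Finset ℤ) (hF : ∀ j, grProj 𝓜 j x ≠ 0 → j ∈ F) :
    ∑ j ∈ F, grProj 𝓜 j x = x := by
  classical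
  conv_rhs => rw [← DirectSum.sum_support_decompose 𝓜 x]
  refine (Finset.sum_subset (fun j hj => hF j ?_) fun j _ hj => ?_).symm
  · simpa [grProj_apply] using hj
  · simpa [grProj_apply] using hj

end

section Prod
variable {ι : Type*} {N : ι → Type*} [∀ i, AddCommGroup (N i)] [∀ i, Module k (N i)]

/-- The grading of `R ⊕ ⨁ N i` by total degree. -/
def sumGrading (𝓡 : ℤ → Submodule k R) (𝒩 : ∀ i, ℤ → Submodule k (N i)) (j : ℤ) :
    Submodule k (R × ∀ i, N i) :=
  (𝓡 j).prod (Submodule.pi Set.univ fun i => 𝒩 i j)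

variable (𝓡 : ℤ → Submodule k R) (𝒩 : ∀ i, ℤ → Submodule k (N i))

lemma mem_sumGrading (j : ℤ) (x : R × ∀ i, N i) :
    x ∈ sumGrading 𝓡 𝒩 j ↔ x.1 ∈ 𝓡 j ∧ ∀ i, x.2 i ∈ 𝒩 i j := by
  simp [sumGrading, Submodule.mem_prod, Submodule.mem_pi]

instance [Fintype ι] [DirectSum.Decomposition 𝓡] [∀ i, DirectSum.Decomposition (𝒩 i)] :
    DirectSum.Decomposition (sumGrading 𝓡 𝒩) :=
  decompositionOfProj _
    (fun j => (grProj 𝓡 j).prodMap (LinearMap.pi fun i => grProj (𝒩 i) j ∘ₗ LinearMap.proj i))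
    (fun j x => (mem_sumGrading ..).2 ⟨grProj_mem .., fun i => grProj_mem ..⟩)
    (fun x => ((grProj_finite 𝓡 x.1).union
      (Set.finite_iUnion fun i => grProj_finite (𝒩 i) (x.2 i))).subset fun j hj => by
        by_contra h
        simp only [Set.mem_union, Set.mem_ofPred_eq, Set.mem_iUnion, not_or, not_not,
          not_exists] at h
        exact hj (Prod.ext h.1 (funext h.2)))
    (fun x => by
      refine Prod.ext ?_ (funext fun i => ?_)
      · rw [Prod.fst_sum]
        refine sum_grProj_of_subset 𝓡 x.1 _ fun j hj => ?_
        simp only [Set.Finite.mem_toFinset, Set.mem_ofPred_eq]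
        exact fun h => hj (congrArg Prod.fst h)
      · rw [Prod.snd_sum, Finset.sum_apply]
        refine sum_grProj_of_subset (𝒩 i) (x.2 i) _ fun j hj => ?_
        simp only [Set.Finite.mem_toFinset, Set.mem_ofPred_eq]
        exact fun h => hj (congrFun (congrArg Prod.snd h) i))
    (fun j x hx => by
      rw [mem_sumGrading] at hx
      exact Prod.ext (grProj_self _ _ _ hx.1) (funext fun i => grProj_self _ _ _ (hx.2 i)))
    (fun i j h x hx => by
      rw [mem_sumGrading] at hx
      exact Prod.ext (grProj_ne _ _ _ h _ hx.1) (funext fun s => grProj_ne _ _ _ h _ (hx.2 s)))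

variable [∀ i, Module R (N i)]

instance [SetLike.GradedMonoid 𝓡] [∀ i, SetLike.GradedSMul 𝓡 (𝒩 i)] :
    SetLike.GradedSMul 𝓡 (sumGrading 𝓡 𝒩) where
  smul_mem {i j a x} ha hx := by
    rw [mem_sumGrading] at hx ⊢
    exact ⟨SetLike.GradedMul.mul_mem ha hx.1, fun s => SetLike.GradedSMul.smul_mem ha (hx.2 s)⟩

end Prod

section End
variable {M : Type*} [AddCommGroup M] [Module k M] [Module R M] [IsScalarTower k R M]

/-- The `R`-linear endomorphisms of degree `n` of a graded `R`-module. -/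
def endGrading (R : Type*) [CommRing R] [Algebra k R] [Module R M] [IsScalarTower k R M]
    (𝓜 : ℤ → Submodule k M) (n : ℤ) : Submodule k (Module.End R M) where
  carrier := {f | ∀ j, ∀ x ∈ 𝓜 j, f x ∈ 𝓜 (n + j)}
  zero_mem' _ _ _ := by simp
  add_mem' hf hg j x hx := add_mem (hf j x hx) (hg j x hx)
  smul_mem' c _ hf j x hx := Submodule.smul_mem _ c (hf j x hx)

variable (𝓡 : ℤ → Submodule k R) (𝓜 : ℤ → Submodule k M)

instance : SetLike.GradedMonoid (endGrading R 𝓜) where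
  one_mem j x hx := by simpa using hx
  mul_mem {i j f g} hf hg n x hx := by
    rw [add_assoc]
    exact hf _ _ (hg _ _ hx)

lemma grProj_smul {M : Type*} [AddCommGroup M] [Module k M] [Module R M]
    (𝓡 : ℤ → Submodule k R) (𝓜 : ℤ → Submodule k M) [DirectSum.Decomposition 𝓜]
    [SetLike.GradedSMul 𝓡 𝓜] (i q : ℤ) (r : R) (hr : r ∈ 𝓡 i) (y : M) :
    grProj 𝓜 (i + q) (r • y) = r • grProj 𝓜 q y := by
  induction y using DirectSum.Decomposition.inductionOn 𝓜 with
  | zero => simp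
  | @homogeneous j y =>
    have hy : r • (y : M) ∈ 𝓜 (i + j) := SetLike.GradedSMul.smul_mem hr y.2
    by_cases h : j = q
    · subst h; rw [grProj_self _ _ _ hy, grProj_self _ _ _ y.2]
    · rw [grProj_ne _ _ _ (by lia) _ hy, grProj_ne _ _ _ h _ y.2, smul_zero]
  | add x y hx hy => simp only [smul_add, map_add, hx, hy]

variable [GradedAlgebra 𝓡] [DirectSum.Decomposition 𝓜] [SetLike.GradedSMul 𝓡 𝓜]

/-- The degree `n` component of a `k`-linear endomorphism. -/
def linComp (n : ℤ) (f : M →ₗ[k] M) : M →ₗ[k] M :=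
  DirectSum.toModule k ℤ M (fun j => grProj 𝓜 (n + j) ∘ₗ f ∘ₗ (𝓜 j).subtype) ∘ₗ
    (DirectSum.decomposeLinearEquiv 𝓜).toLinearMap

lemma linComp_apply (n : ℤ) (f : M →ₗ[k] M) {j : ℤ} {x : M} (hx : x ∈ 𝓜 j) :
    linComp 𝓜 n f x = grProj 𝓜 (n + j) (f x) := by
  lift x to 𝓜 j using hx
  simp [linComp]

/-- The degree `n` component of an `R`-linear endomorphism. -/
def endComp (n : ℤ) : Module.End R M →ₗ[k] Module.End R M where
  toFun f :=
    { toFun := linComp 𝓜 n (f.restrictScalars k)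
      map_add' := map_add _
      map_smul' := fun r x => by
        induction x using DirectSum.Decomposition.inductionOn 𝓜 with
        | zero => simp
        | @homogeneous j x =>
          induction r using DirectSum.Decomposition.inductionOn 𝓡 with
          | zero => simp
          | @homogeneous i r =>
            have h : (r : R) • (x : M) ∈ 𝓜 (i + j) := SetLike.GradedSMul.smul_mem r.2 x.2
            rw [linComp_apply 𝓜 n _ h, linComp_apply 𝓜 n _ x.2, RingHom.id_apply,
              ← grProj_smul 𝓡 𝓜 i (n + j) r r.2]
            simp only [LinearMap.coe_restrictScalars, map_smul]
            congr 2
            ring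
          | add r s hr hs => simp only [add_smul, map_add, hr, hs, RingHom.id_apply]
        | add x y hx hy => simp only [smul_add, map_add, hx, hy] }
  map_add' f g := by
    ext x
    induction x using DirectSum.Decomposition.inductionOn 𝓜 with
    | zero => simp
    | @homogeneous j x => simp [linComp_apply 𝓜 n _ x.2]
    | add x y hx hy => rw [map_add, hx, hy, map_add]
  map_smul' c f := by
    ext x
    induction x using DirectSum.Decomposition.inductionOn 𝓜 with
    | zero => simp
    | @homogeneous j x => simp [linComp_apply 𝓜 n _ x.2]
    | add x y hx hy => rw [map_add, hx, hy, map_add]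

lemma endComp_apply (n : ℤ) (f : Module.End R M) {j : ℤ} {x : M} (hx : x ∈ 𝓜 j) :
    endComp 𝓡 𝓜 n f x = grProj 𝓜 (n + j) (f x) := linComp_apply 𝓜 n _ hx

lemma endComp_apply_finite (f : Module.End R M) (x : M) : {n | endComp 𝓡 𝓜 n f x ≠ 0}.Finite := by
  induction x using DirectSum.Decomposition.inductionOn 𝓜 with
  | zero => simp
  | @homogeneous j x =>
    simp only [endComp_apply 𝓡 𝓜 _ _ x.2]
    exact (grProj_finite 𝓜 (f x)).preimage (f := fun n => n + j) (add_left_injective j).injOn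
  | add x y hx hy =>
    refine (hx.union hy).subset fun n hn => ?_
    by_contra h
    simp only [Set.mem_union, Set.mem_ofPred_eq, not_or, not_not] at h
    exact hn (by rw [map_add, h.1, h.2, add_zero])

/-- The endomorphism algebra of a finitely generated graded module is the direct sum of its
homogeneous parts. -/
@[reducible]
def endGradedAlgebra [Module.Finite R M] : GradedAlgebra (endGrading R 𝓜) where
  toDecomposition := decompositionOfProj _ (endComp 𝓡 𝓜)
    (fun n f j x hx => by
      rw [endComp_apply 𝓡 𝓜 n f hx]; exact grProj_mem ..)
    (fun f => by
      obtain ⟨s, hs⟩ := Module.Finite.fg_top (R := R) (M := M)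
      refine (s.finite_toSet.biUnion fun x _ => endComp_apply_finite 𝓡 𝓜 f x).subset
        fun n hn => ?_
      by_contra h
      simp only [Set.mem_iUnion, Set.mem_ofPred_eq, not_exists, not_not] at h
      exact hn (LinearMap.ext_on hs fun x hx => h x hx))
    (fun f => by
      ext x
      induction x using DirectSum.Decomposition.inductionOn 𝓜 with
      | zero => simp
      | @homogeneous j x =>
        rw [LinearMap.sum_apply]
        simp only [endComp_apply 𝓡 𝓜 _ _ x.2]
        refine (Finset.sum_map _ (addRightEmbedding j) fun n => grProj 𝓜 n (f x)).symm.trans ?_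
        refine sum_grProj_of_subset 𝓜 _ _ fun n hn => ?_
        simp only [Finset.mem_map, addRightEmbedding_apply, Set.Finite.mem_toFinset,
          Set.mem_ofPred_eq]
        refine ⟨n - j, fun h => hn ?_, sub_add_cancel n j⟩
        have := LinearMap.congr_fun h (x : M)
        rwa [endComp_apply 𝓡 𝓜 _ _ x.2, sub_add_cancel] at this
      | add x y hx hy => rw [map_add, hx, hy, map_add])
    (fun n f hf => by
      ext x
      induction x using DirectSum.Decomposition.inductionOn 𝓜 with
      | zero => simp
      | @homogeneous j x => rw [endComp_apply 𝓡 𝓜 _ _ x.2, grProj_self _ _ _ (hf _ _ x.2)]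
      | add x y hx hy => rw [map_add, hx, hy, map_add])
    (fun m n h f hf => by
      ext x
      induction x using DirectSum.Decomposition.inductionOn 𝓜 with
      | zero => simp
      | @homogeneous j x =>
        rw [endComp_apply 𝓡 𝓜 _ _ x.2, grProj_ne _ _ _ (by lia) _ (hf _ _ x.2)]; rfl
      | add x y hx hy => rw [map_add, hx, hy, map_add])

end End
end Gradings

section Graded

variable {k Λ : Type u} [Field k] [Ring Λ] [Algebra k Λ] [IsNoetherianRing Λ]
  (𝒜 : ℤ → Submodule k Λ) [GradedAlgebra 𝒜]

/-- The graded version of `D^b_f(Λ)`: the full subcategory of the derived category of graded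
left `Λ`-modules on the objects with bounded and finitely generated cohomology. -/
abbrev DbfGr : Type _ := (boundedWith (GrMod.isFG 𝒜)).FullSubcategory

/-- `Λ(n)` as an object of the graded `D^b_f(Λ)`. -/
def regularGr (n : ℤ) : DbfGr 𝒜 :=
  (stalk (GrMod.isFG 𝒜)).obj ⟨GrMod.regular 𝒜 n, GrMod.isFG_regular n⟩

variable {𝒜}

/-- Right multiplication `Λ → Λ(n)` by an element of degree `n`. -/
def rightMulGr {n : ℤ} (a : 𝒜 n) : regularGr 𝒜 0 ⟶ regularGr 𝒜 n :=
  (stalk (GrMod.isFG 𝒜)).map (ObjectProperty.homMk (GrMod.rightMul a))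

/-- `(Λe)(n)` for an idempotent `e` of degree `0`, as an object of the graded `D^b_f(Λ)`. -/
def leftIdealGr (e : Λ) (he : e ∈ 𝒜 0) (hee : e * e = e) (n : ℤ) : DbfGr 𝒜 :=
  (stalk (GrMod.isFG 𝒜)).obj
    ⟨GrMod.ofLeftIdeal 𝒜 (Ideal.span {e}) n, GrMod.isFG_ofLeftIdeal e he hee n⟩

end Graded

section Setting

variable {k R : Type u} [Field k] [CommRing R] [Algebra k R] {l : ℕ} (N : Fin l → Type u)
  [∀ i, AddCommGroup (N i)] [∀ i, Module k (N i)] [∀ i, Module R (N i)]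
  [∀ i, IsScalarTower k R (N i)]

/-- `Λ = End_R(M)` for `M = R ⊕ ⨁ N i`. -/
abbrev EndAlg (R : Type u) [CommRing R] [∀ i, Module R (N i)] : Type u :=
  Module.End R (R × ∀ i, N i)

instance [IsNoetherianRing R] [∀ i, Module.Finite R (N i)] : IsNoetherianRing (EndAlg N R) :=
  IsNoetherianRing.of_finite R _

/-- The projection `e₀` of `M = R ⊕ ⨁ N i` onto the summand `R`. -/
def e₀ (R : Type u) [CommRing R] [∀ i, Module R (N i)] : EndAlg N R :=
  LinearMap.inl R R (∀ i, N i) ∘ₗ LinearMap.fst R R (∀ i, N i)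

lemma e₀_mul_e₀ (R : Type u) [CommRing R] [∀ i, Module R (N i)] : e₀ N R * e₀ N R = e₀ N R := by
  ext <;> simp [e₀]

/-- The grading of `Λ = End_R(M)`: the part of degree `n` consists of the endomorphisms of
degree `n`. -/
abbrev endAlgGrading {N : Fin l → Type u} [∀ i, AddCommGroup (N i)] [∀ i, Module k (N i)]
    [∀ i, Module R (N i)] [∀ i, IsScalarTower k R (N i)] (𝓡 : ℤ → Submodule k R)
    (𝒩 : ∀ i, ℤ → Submodule k (N i)) : ℤ → Submodule k (EndAlg N R) :=
  endGrading R (sumGrading 𝓡 𝒩)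

variable {N} in
lemma e₀_mem (𝓡 : ℤ → Submodule k R) (𝒩 : ∀ i, ℤ → Submodule k (N i)) :
    e₀ N R ∈ endAlgGrading 𝓡 𝒩 0 := fun j x hx => by
  rw [zero_add]
  rw [mem_sumGrading] at hx ⊢
  exact ⟨hx.1, fun i => zero_mem _⟩

/-- The conditions on the ring and the modules in the complete case. -/
structure IsCompleteSetting (m : Ideal R) : Prop where
  isLocalRing : IsLocalRing R
  isAdicComplete : IsAdicComplete m R
  indecomposable : ∀ i, IsIndecomposable R (N i)
  not_iso : ∀ i j, i ≠ j → IsEmpty (N i ≃ₗ[R] N j)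
  not_iso_self : ∀ i, IsEmpty (N i ≃ₗ[R] R)

variable {N} (𝓡 : ℤ → Submodule k R) [GradedAlgebra 𝓡] (𝒩 : ∀ i, ℤ → Submodule k (N i))
  [∀ i, DirectSum.Decomposition (𝒩 i)]

/-- The conditions on the ring and the modules in the graded case: `R` is `ℕ`-graded and `m` is
its unique maximal homogeneous ideal. -/
structure IsGradedSetting (m : Ideal R) : Prop where
  eq_bot_of_neg : ∀ n < 0, 𝓡 n = ⊥
  isHomogeneous : m.IsHomogeneous 𝓡
  le_of_isHomogeneous : ∀ I : Ideal R, I.IsHomogeneous 𝓡 → I ≠ ⊤ → I ≤ m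
  nontrivial : ∀ i, Nontrivial (N i)
  indecomposable : ∀ (i) (A B : Submodule R (N i)), A.IsHomogeneous (𝒩 i) →
    B.IsHomogeneous (𝒩 i) → IsCompl A B → A = ⊥ ∨ B = ⊥
  not_iso : ∀ i j, i ≠ j → ¬ ∃ f : N i ≃ₗ[R] N j, ∀ n, ∀ x ∈ 𝒩 i n, f x ∈ 𝒩 j n
  not_iso_self : ∀ i, ¬ ∃ f : N i ≃ₗ[R] R, ∀ n, ∀ x ∈ 𝒩 i n, f x ∈ 𝓡 n

instance [∀ i, SetLike.GradedSMul 𝓡 (𝒩 i)] [∀ i, Module.Finite R (N i)] :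
    GradedAlgebra (endAlgGrading 𝓡 𝒩) :=
  endGradedAlgebra 𝓡 _

variable [IsNoetherianRing R] [∀ i, Module.Finite R (N i)] [∀ i, SetLike.GradedSMul 𝓡 (𝒩 i)]

/-- The graded version of `D^b_f(Λ)/⟨P₀⟩` for `P₀ = Λe₀`: the Verdier quotient by the smallest
thick subcategory that contains all `P₀(n)`. -/
abbrev DbfGrQuotient : Type _ :=
  VerdierQuotient (.ofObj (leftIdealGr (e₀ N R) (e₀_mem 𝓡 𝒩) (e₀_mul_e₀ N R)))

/-- The quotient functor to the graded version of `D^b_f(Λ)/⟨P₀⟩`. -/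
abbrev toDbfGrQuotient : DbfGr (endAlgGrading 𝓡 𝒩) ⥤ DbfGrQuotient 𝓡 𝒩 :=
  toVerdierQuotient (.ofObj (leftIdealGr (e₀ N R) (e₀_mem 𝓡 𝒩) (e₀_mul_e₀ N R)))

end Setting

end NCResolution
end

/-
Let `𝒯 = ⟨Λe₀⟩`. Coning off a precover of `Y` by shifts of `Λe₀` changes `Y` only up to `𝒯` and
moves the degree in which `Hom(Λe₀, Y)` is concentrated down by one. Once this degree is negative,
the cones no longer affect `Hom(Λ, Y)`, and repeating the step makes `Y` orthogonal to any given
object of `𝒯`; hence `Hom(Λ, Y)` is then also the space of morphisms in the quotient. The step from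
degree `0` to degree `-1` divides `Hom(Λ, Y)` by the morphisms that factor through sums of copies of
`Λe₀`. For `Y = Λ` this gives `Λ/Λe₀Λ`. Since `Hom(Λe₀, Y) = 0` in negative degree, the spaces
obtained are finite dimensional as soon as `Λ/Λe₀Λ` is, and dévissage extends this to all objects,
which `Λ` generates because of the finite global dimension.

That `Λ/Λe₀Λ` is finite dimensional is commutative algebra. For a maximal Cohen-Macaulay module `X`
over the Gorenstein ring `R`, a single element outside `m` annihilates `Ext^j(X, R)` for given
`j > 0`. At a prime `p < m` every finitely generated module has finite projective dimension, so the
localization of `Ext^j(X, K)` at `p` vanishes for all finitely generated `K`, and a multiple `s • 1`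
with `s ∉ p` of the identity of `X` factors through a free module. So the ideal of all `r : R` with
`r • 1 ∈ Λe₀Λ` is contained in no prime strictly below `m`; when `R` is local or this ideal is
homogeneous, it therefore contains a power of `m`.
-/

noncomputable section

namespace NCResolution

section Triangulated

open Pretriangulated Triangulated ZeroObject

section HomFiniteness

variable {k : Type*} [Field k] {D : Type*} [Category* D] [Preadditive D] [Linear k D]

lemma finite_of_ker_le_range {V₁ V₂ V₃ : Type*} [AddCommGroup V₁] [AddCommGroup V₂]
    [AddCommGroup V₃] [Module k V₁] [Module k V₂] [Module k V₃] {f : V₁ →ₗ[k] V₂} {g : V₂ →ₗ[k] V₃}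
    [Module.Finite k V₁] [Module.Finite k V₃] (h : LinearMap.ker g ≤ LinearMap.range f) :
    Module.Finite k V₂ := by
  refine ⟨Submodule.fg_of_fg_map_of_fg_inf_ker g (IsNoetherian.noetherian _) ?_⟩
  rw [top_inf_eq]
  exact (Submodule.fg_top _).1 ((Module.Finite.of_injective (Submodule.inclusion h)
    (Submodule.inclusion_injective h)).fg_top)

lemma finite_hom_of_iso {X X' Y Y' : D} (e : X ≅ X') (e' : Y ≅ Y')
    [Module.Finite k (X ⟶ Y)] : Module.Finite k (X' ⟶ Y') :=
  Module.Finite.equiv (Linear.homCongr k e e')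

variable [HasShift D ℤ]

lemma finite_hom_of_shift [∀ n : ℤ, (shiftFunctor D n).Additive]
    [∀ n : ℤ, (shiftFunctor D n).Linear k] {X Y : D} (a : ℤ)
    (h : Module.Finite k (X ⟶ Y⟦-a⟧)) : Module.Finite k (X⟦a⟧ ⟶ Y) :=
  have : Module.Finite k (X⟦a⟧⟦-a⟧ ⟶ Y⟦-a⟧) :=
    finite_hom_of_iso (X := X) ((shiftFunctorCompIsoId D a (-a) (by simp)).symm.app X)
      (Iso.refl (Y⟦-a⟧))
  Module.Finite.of_injective ((shiftFunctor D (-a)).mapLinearMap k (X := X⟦a⟧) (Y := Y))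
    (shiftFunctor D (-a)).map_injective

variable [HasZeroObject D] [∀ n : ℤ, (shiftFunctor D n).Additive] [Pretriangulated D] (k)

/-- The objects `X` such that all `Hom(Z, X⟦a⟧)` are finite dimensional over `k`: the dévissage
class in the target variable. -/
def finiteHomFrom (Z : D) : ObjectProperty D := fun X => ∀ a : ℤ, Module.Finite k (Z ⟶ X⟦a⟧)

/-- The objects `X` such that all `Hom(X⟦a⟧, Z)` are finite dimensional over `k`: the dévissage
class in the source variable. -/
def finiteHomTo (Z : D) : ObjectProperty D := fun X => ∀ a : ℤ, Module.Finite k (X⟦a⟧ ⟶ Z)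

instance (Z : D) : (finiteHomFrom k Z).IsStableUnderRetracts where
  of_retract {X Y} r h a := by
    have := h a
    refine Module.Finite.of_injective (Linear.rightComp k Z (r.i⟦a⟧')) fun f g hfg => ?_
    have := congrArg (· ≫ r.r⟦a⟧') hfg
    simpa [← Functor.map_comp] using this

instance (Z : D) : (finiteHomTo k Z).IsStableUnderRetracts where
  of_retract {X Y} r h a := by
    have := h a
    refine Module.Finite.of_injective (Linear.leftComp k Z (r.r⟦a⟧')) fun f g hfg => ?_
    have := congrArg (r.i⟦a⟧' ≫ ·) hfg
    simpa [← Functor.map_comp_assoc] using this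

instance (Z : D) : (finiteHomFrom k Z).IsTriangulated where
  exists_zero := ⟨0, isZero_zero _, fun a => by
    have : Subsingleton (Z ⟶ (0 : D)⟦a⟧) :=
      ⟨((shiftFunctor D a).map_isZero (isZero_zero D)).eq_of_tgt⟩
    infer_instance⟩
  isStableUnderShiftBy b := ⟨fun X h a => by
    have := h (b + a)
    exact finite_hom_of_iso (Iso.refl Z) ((shiftFunctorAdd' D b a (b + a) rfl).app X)⟩
  toIsTriangulatedClosed₂ := .mk' fun T hT h₁ h₃ a => by
    have := h₁ a
    have := h₃ a
    let T' := (Triangle.shiftFunctor D a).obj T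
    have hT' : T' ∈ distTriang D := Triangle.shift_distinguished T hT a
    refine finite_of_ker_le_range (V₁ := Z ⟶ T.obj₁⟦a⟧) (V₃ := Z ⟶ T.obj₃⟦a⟧)
      (f := Linear.rightComp k Z T'.mor₁) (g := Linear.rightComp k Z T'.mor₂) fun x hx => ?_
    obtain ⟨y, rfl⟩ := Triangle.coyoneda_exact₂ T' hT' x hx
    exact ⟨y, rfl⟩

instance (Z : D) : (finiteHomTo k Z).IsTriangulated where
  exists_zero := ⟨0, isZero_zero _, fun a => by
    have : Subsingleton ((0 : D)⟦a⟧ ⟶ Z) :=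
      ⟨((shiftFunctor D a).map_isZero (isZero_zero D)).eq_of_src⟩
    infer_instance⟩
  isStableUnderShiftBy b := ⟨fun X h a => by
    have := h (b + a)
    exact finite_hom_of_iso ((shiftFunctorAdd' D b a (b + a) rfl).app X) (Iso.refl Z)⟩
  toIsTriangulatedClosed₂ := .mk' fun T hT h₁ h₃ a => by
    have := h₁ a
    have := h₃ a
    let T' := (Triangle.shiftFunctor D a).obj T
    have hT' : T' ∈ distTriang D := Triangle.shift_distinguished T hT a
    refine finite_of_ker_le_range (V₁ := T.obj₃⟦a⟧ ⟶ Z) (V₃ := T.obj₁⟦a⟧ ⟶ Z)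
      (f := Linear.leftComp k Z T'.mor₂) (g := Linear.leftComp k Z T'.mor₁) fun x hx => ?_
    obtain ⟨y, rfl⟩ := Triangle.yoneda_exact₂ T' hT' x hx
    exact ⟨y, rfl⟩

end HomFiniteness

instance {C D : Type*} [Category* C] [Category* D] (P : ObjectProperty D)
    [P.IsStableUnderRetracts] (F : C ⥤ D) : (P.inverseImage F).IsStableUnderRetracts where
  of_retract r h := P.prop_of_retract (r.map F) h

section Approximation

variable {C D : Type*} [Category* C] [Preadditive C] [Category* D] [Preadditive D] {τ : Type*}

/-- `Y` has a right approximation (precover) by a finite direct sum of objects `E t`. The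
approximation is given by its components, so that no biproducts have to exist. -/
def HasPrecover (E : τ → C) (Y : C) : Prop :=
  ∃ (n : ℕ) (t : Fin n → τ) (x : ∀ i, E (t i) ⟶ Y),
    ∀ t' (f : E t' ⟶ Y), ∃ g : ∀ i, E t' ⟶ E (t i), f = ∑ i, g i ≫ x i

/-- The group of morphisms `X ⟶ Y` that factor through a finite direct sum of objects `E t`,
encoded as the group generated by the morphisms that factor through a single `E t`. -/
def factorsThrough (E : τ → C) (X Y : C) : AddSubgroup (X ⟶ Y) :=
  AddSubgroup.closure {f | ∃ (t : τ) (g : X ⟶ E t) (x : E t ⟶ Y), f = g ≫ x}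

variable {E : τ → C}

lemma comp_mem_factorsThrough {X Y : C} {t : τ} (g : X ⟶ E t) (x : E t ⟶ Y) :
    g ≫ x ∈ factorsThrough E X Y :=
  AddSubgroup.subset_closure ⟨t, g, x, rfl⟩

lemma comp_biproduct_mem_factorsThrough [HasFiniteBiproducts C] {X Y : C} {n : ℕ} {t : Fin n → τ}
    (g : X ⟶ ⨁ fun i => E (t i)) (p : (⨁ fun i => E (t i)) ⟶ Y) :
    g ≫ p ∈ factorsThrough E X Y := by
  rw [← Category.id_comp p, ← biproduct.total, Preadditive.sum_comp, Preadditive.comp_sum]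
  refine sum_mem fun i _ => ?_
  rw [Category.assoc, ← Category.assoc]
  exact comp_mem_factorsThrough _ _

lemma map_mem_factorsThrough (F : C ⥤ D) [F.Additive] {X Y : C} {f : X ⟶ Y}
    (hf : f ∈ factorsThrough E X Y) :
    F.map f ∈ factorsThrough (fun t => F.obj (E t)) (F.obj X) (F.obj Y) := by
  have hle : factorsThrough E X Y ≤
      (factorsThrough (fun t => F.obj (E t)) (F.obj X) (F.obj Y)).comap F.mapAddHom := by
    refine (AddSubgroup.closure_le _).2 ?_
    rintro _ ⟨t, g, x, rfl⟩
    exact AddSubgroup.subset_closure ⟨t, F.map g, F.map x, F.map_comp g x⟩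
  exact hle hf

lemma map_mem_factorsThrough_iff (F : C ⥤ D) [F.Additive] [F.Full] [F.Faithful] {X Y : C}
    (f : X ⟶ Y) : F.map f ∈ factorsThrough (fun t => F.obj (E t)) (F.obj X) (F.obj Y) ↔
      f ∈ factorsThrough E X Y := by
  refine ⟨fun hf => ?_, map_mem_factorsThrough F⟩
  have hle : factorsThrough (fun t => F.obj (E t)) (F.obj X) (F.obj Y) ≤
      (factorsThrough E X Y).map F.mapAddHom := by
    refine (AddSubgroup.closure_le _).2 ?_
    rintro _ ⟨t, g, x, rfl⟩
    obtain ⟨g, rfl⟩ := F.map_surjective g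
    obtain ⟨x, rfl⟩ := F.map_surjective x
    exact ⟨g ≫ x, comp_mem_factorsThrough g x, F.map_comp g x⟩
  obtain ⟨g, hg, hgf⟩ := hle hf
  exact F.map_injective hgf ▸ hg

end Approximation

section Concentrated

variable {T : Type*} [Category* T] [Preadditive T] [HasShift T ℤ] {τ : Type*} (E : τ → T)

/-- The complex of morphisms from each `E t` to `Y` is concentrated in degree `j`. -/
def IsConcentrated (j : ℤ) : ObjectProperty T := fun Y =>
  ∀ n : ℤ, n ≠ j → ∀ t, ∀ f : E t ⟶ Y⟦n⟧, f = 0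

variable {E} {j : ℤ} {Y : T}

lemma IsConcentrated.eq_zero (hY : IsConcentrated E j Y) (hj : j ≠ 0) {t : τ} (f : E t ⟶ Y) :
    f = 0 := by
  rw [← cancel_mono ((shiftFunctorZero T ℤ).inv.app Y), zero_comp]
  exact hY 0 hj.symm t _

lemma IsConcentrated.shift (hY : IsConcentrated E j Y) (b : ℤ) :
    IsConcentrated E (j - b) (Y⟦b⟧) := by
  intro n hn t f
  rw [← cancel_mono ((shiftFunctorAdd T b n).inv.app Y), zero_comp]
  exact hY (b + n) (by lia) t _

variable [∀ n : ℤ, (shiftFunctor T n).Additive]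

lemma IsConcentrated.biproduct [HasFiniteBiproducts T] {n : ℕ} {B : Fin n → T}
    (hB : ∀ i, IsConcentrated E j (B i)) : IsConcentrated E j (⨁ B) := by
  intro m hm t f
  rw [← cancel_mono ((shiftFunctor T m).mapBiproduct B).hom, zero_comp]
  refine biproduct.hom_ext _ _ fun i => ?_
  exact (hB i m hm t _).trans zero_comp.symm

lemma eq_zero_of_shift {C : T} (a b : ℤ) (hab : a + b = 0)
    (h : ∀ f : C ⟶ Y⟦b⟧, f = 0) (f : C⟦a⟧ ⟶ Y) : f = 0 := by
  apply (shiftFunctor T b).map_injective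
  rw [← cancel_epi ((shiftFunctorCompIsoId T a b hab).inv.app C), Functor.map_zero, comp_zero]
  exact h _

variable (E) in
/-- The objects without nonzero morphisms to objects concentrated in very negative degrees. -/
def eventuallyOrthogonal : ObjectProperty T := fun C =>
  ∃ N : ℤ, ∀ j ≤ N, ∀ Y, IsConcentrated E j Y → ∀ f : C ⟶ Y, f = 0

omit [∀ n : ℤ, (shiftFunctor T n).Additive] in
instance : (eventuallyOrthogonal E).IsStableUnderRetracts where
  of_retract r := by
    rintro ⟨N, hN⟩
    refine ⟨N, fun j hj Y hY f => ?_⟩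
    rw [← Category.id_comp f, ← r.retract, Category.assoc, hN j hj Y hY (r.r ≫ f), comp_zero]

variable [HasZeroObject T] [Pretriangulated T]

instance : (eventuallyOrthogonal E).IsTriangulated where
  exists_zero := ⟨0, isZero_zero _, 0, fun _ _ _ _ f => (isZero_zero T).eq_of_src f 0⟩
  isStableUnderShiftBy a := ⟨by
    rintro C ⟨N, hN⟩
    refine ⟨N - a, fun j hj Y hY f => eq_zero_of_shift a (-a) (by simp) (fun g => ?_) f⟩
    exact hN (j - -a) (by lia) _ (hY.shift (-a)) g⟩
  toIsTriangulatedClosed₂ := .mk' (by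
    rintro D hD ⟨N₁, h₁⟩ ⟨N₃, h₃⟩
    refine ⟨min N₁ N₃, fun j hj Y hY f => ?_⟩
    obtain ⟨g, rfl⟩ := Triangle.yoneda_exact₂ D hD f (h₁ j (by lia) Y hY _)
    rw [h₃ j (by lia) Y hY g, comp_zero])

lemma triangEnvelope_ofObj_le_eventuallyOrthogonal :
    (ObjectProperty.ofObj E).triangEnvelope ≤ eventuallyOrthogonal E := by
  refine (ObjectProperty.ofObj E).triangEnvelope_le_iff.2 ?_
  rintro _ ⟨t⟩
  exact ⟨-1, fun j hj Y hY f => hY.eq_zero (by lia) f⟩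

end Concentrated

lemma exists_lift₃_shift {T : Type*} [Category* T] [Preadditive T] [HasZeroObject T]
    [HasShift T ℤ] [∀ n : ℤ, (shiftFunctor T n).Additive] [Pretriangulated T]
    {X Y Z W : T} {f : X ⟶ Y} {g : Y ⟶ Z} {h : Z ⟶ X⟦(1 : ℤ)⟧}
    (hT : Triangle.mk f g h ∈ distTriang T) {n : ℤ} (φ : W ⟶ Z⟦n⟧) (hφ : φ ≫ h⟦n⟧' = 0) :
    ∃ ψ : W ⟶ Y⟦n⟧, φ = ψ ≫ g⟦n⟧' := by
  obtain ⟨(ψ : W ⟶ Y⟦n⟧), hψ : φ = ψ ≫ (n.negOnePow • g⟦n⟧')⟩ :=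
    Triangle.coyoneda_exact₃ _ (Triangle.shift_distinguished _ hT n) φ (by
      change φ ≫ (n.negOnePow • h⟦n⟧' ≫ (shiftFunctorComm T 1 n).hom.app X) = 0
      rw [Linear.comp_units_smul, reassoc_of% hφ, zero_comp, smul_zero])
  exact ⟨n.negOnePow • ψ, by rw [hψ, Linear.comp_units_smul, Linear.units_smul_comp]⟩

section Precover

variable {T : Type*} [Category* T] [Preadditive T] [HasZeroObject T] [HasShift T ℤ]
  [∀ n : ℤ, (shiftFunctor T n).Additive] [Pretriangulated T] {τ : Type*} (E : τ → T)

/-- A morphism to `Y` from a finite direct sum of objects `(E t)⟦-j⟧` through which all morphisms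
from these objects factor; the factorization property is stated after a shift by `j`. -/
structure IsPrecover (j : ℤ) {B Y : T} (p : B ⟶ Y) : Prop where
  exists_iso : ∃ (n : ℕ) (t : Fin n → τ), Nonempty (B ≅ (⨁ fun i => E (t i))⟦-j⟧)
  exists_lift : ∀ t (f : E t ⟶ Y⟦j⟧), ∃ g, f = g ≫ p⟦j⟧'

variable {E} {j : ℤ} {Y : T}

lemma HasPrecover.exists_isPrecover (hY : HasPrecover E (Y⟦j⟧)) :
    ∃ (B : T) (p : B ⟶ Y), IsPrecover E j p := by
  obtain ⟨n, t, x, hx⟩ := hY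
  let e : Y⟦j⟧⟦-j⟧ ≅ Y := (shiftFunctorCompIsoId T j (-j) (by simp)).app Y
  refine ⟨_, (biproduct.desc x)⟦-j⟧' ≫ e.hom, ⟨n, t, ⟨Iso.refl _⟩⟩, fun t' f => ?_⟩
  obtain ⟨g, rfl⟩ := hx t' f
  let η := shiftFunctorCompIsoId T (-j) j (by simp)
  have he : e.hom⟦j⟧' = η.hom.app (Y⟦j⟧) := shift_shiftFunctorCompIsoId_hom_app j (-j) (by simp) Y
  have hη : (biproduct.desc x)⟦-j⟧'⟦j⟧' ≫ η.hom.app (Y⟦j⟧) = η.hom.app _ ≫ biproduct.desc x :=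
    η.hom.naturality (biproduct.desc x)
  refine ⟨biproduct.lift g ≫ η.inv.app _, ?_⟩
  rw [Functor.map_comp, he, Category.assoc, hη, Iso.inv_hom_id_app_assoc, biproduct.lift_desc]

namespace IsPrecover

variable {B : T} {p : B ⟶ Y}

lemma isConcentrated (hp : IsPrecover E j p) {σ : Type*} {G : σ → T}
    (hG : ∀ t, IsConcentrated G 0 (E t)) : IsConcentrated G j B := by
  obtain ⟨n, t, ⟨e⟩⟩ := hp.exists_iso
  have hB := (IsConcentrated.biproduct fun i => hG (t i)).shift (-j)
  rw [show (0 : ℤ) - -j = j by lia] at hB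
  intro m hm s f
  rw [← cancel_mono (e.hom⟦m⟧'), zero_comp]
  exact hB m hm s _

lemma prop (hp : IsPrecover E j p) (U : ObjectProperty T) [U.IsTriangulated]
    [U.IsClosedUnderIsomorphisms] (hU : ∀ t, U (E t)) : U B := by
  obtain ⟨n, t, ⟨e⟩⟩ := hp.exists_iso
  exact U.prop_of_iso e.symm (U.le_shift (-j) _
    (U.prop_of_iso (biproduct.isoProduct _).symm (U.prop_pi _ fun i => hU (t i))))

lemma comp_mem_factorsThrough {p : B ⟶ Y} (hp : IsPrecover E 0 p) {X : T} (g : X ⟶ B) :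
    g ≫ p ∈ factorsThrough E X Y := by
  obtain ⟨n, t, ⟨e⟩⟩ := hp.exists_iso
  let e' := e ≪≫ (shiftFunctor T (-0 : ℤ)).mapIso (Iso.refl _) ≪≫
    (shiftFunctorZero' T (-0 : ℤ) neg_zero).app _
  have := comp_biproduct_mem_factorsThrough (g ≫ e'.hom) (e'.inv ≫ p)
  rwa [Category.assoc, e'.hom_inv_id_assoc] at this

variable {Y' : T} {q : Y ⟶ Y'} {w : Y' ⟶ B⟦(1 : ℤ)⟧}

lemma isConcentrated_cone (hp : IsPrecover E j p) (hE : ∀ t, IsConcentrated E 0 (E t))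
    (hT : Triangle.mk p q w ∈ distTriang T) (hY : IsConcentrated E j Y) :
    IsConcentrated E (j - 1) Y' := by
  intro n hn t f
  obtain ⟨g, rfl⟩ := exists_lift₃_shift hT f ((hp.isConcentrated hE).shift 1 n hn t _)
  rcases eq_or_ne n j with rfl | hnj
  · obtain ⟨g, rfl⟩ := hp.exists_lift t g
    have hpq : p ≫ q = 0 := comp_distTriang_mor_zero₁₂ _ hT
    rw [Category.assoc, ← Functor.map_comp, hpq, Functor.map_zero, comp_zero]
  · rw [hY n hnj t g, zero_comp]

lemma comp_cone_surjective (hp : IsPrecover E j p) (hj : j ≠ 1) {σ : Type*} {G : σ → T}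
    (hG : ∀ t, IsConcentrated G 0 (E t)) (hT : Triangle.mk p q w ∈ distTriang T) (s : σ) :
    Function.Surjective fun f : G s ⟶ Y => f ≫ q := fun f => by
  obtain ⟨g, rfl⟩ := Triangle.coyoneda_exact₃ _ hT f
    (((hp.isConcentrated hG).shift 1).eq_zero (sub_ne_zero.2 hj) _)
  exact ⟨g, rfl⟩

lemma comp_cone_injective (hp : IsPrecover E j p) (hj : j ≠ 0) {σ : Type*} {G : σ → T}
    (hG : ∀ t, IsConcentrated G 0 (E t)) (hT : Triangle.mk p q w ∈ distTriang T) (s : σ) :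
    Function.Injective fun f : G s ⟶ Y => f ≫ q := fun f g hfg => by
  obtain ⟨(h : G s ⟶ B), hh : f - g = h ≫ p⟩ := Triangle.coyoneda_exact₂ _ hT (f - g)
    ((Preadditive.sub_comp ..).trans (sub_eq_zero.2 hfg))
  rw [← sub_eq_zero, hh, (hp.isConcentrated hG).eq_zero hj h, zero_comp]

end IsPrecover

end Precover

section VerdierHom

variable {T : Type*} [Category* T] [Preadditive T] [HasZeroObject T] [HasShift T ℤ]
  [∀ n : ℤ, (shiftFunctor T n).Additive] [Pretriangulated T] {σ τ : Type*}

/-- The relations between two families under which the morphisms out of the objects `G s` in the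
Verdier quotient by the thick subcategory generated by the objects `E t` can be computed by
successively coning off precovers by sums of shifts of the objects `E t`. -/
structure IsConeApproximating (E : τ → T) (G : σ → T) : Prop where
  isConcentrated_self : ∀ t, IsConcentrated E 0 (E t)
  isConcentrated_left : ∀ t, IsConcentrated G 0 (E t)
  isConcentrated_right : ∀ s, IsConcentrated E 0 (G s)
  hasPrecover : ∀ Y, HasPrecover E Y

lemma isZero_toVerdierQuotient_obj [IsTriangulated T] {S : ObjectProperty T} [S.Nonempty] {X : T}
    (hX : S X) : IsZero ((toVerdierQuotient S).obj X) := by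
  let f : X ⟶ 0 := 0
  have hf : S.triangEnvelope.trW f :=
    ObjectProperty.trW.mk' _ (contractible_distinguished X) (S.le_triangEnvelope _ hX)
  have := Localization.inverts (toVerdierQuotient S) S.triangEnvelope.trW f hf
  exact ((toVerdierQuotient S).map_isZero (isZero_zero T)).of_iso
    (asIso ((toVerdierQuotient S).map f))

lemma toVerdierQuotient_map_eq_zero [IsTriangulated T] [Nonempty τ] {E : τ → T} {X Y : T}
    {f : X ⟶ Y} (hf : f ∈ factorsThrough E X Y) :
    (toVerdierQuotient (.ofObj E)).map f = 0 := by
  have hle : factorsThrough E X Y ≤ (toVerdierQuotient (.ofObj E)).mapAddHom.ker := by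
    refine (AddSubgroup.closure_le _).2 ?_
    rintro _ ⟨t, g, x, rfl⟩
    exact (Functor.map_comp ..).trans ((congrArg _
      ((isZero_toVerdierQuotient_obj ⟨t⟩).eq_of_src _ 0)).trans comp_zero)
  exact hle hf

namespace IsConeApproximating

variable {E : τ → T} {G : σ → T} {j : ℤ} {Y : T} [IsTriangulated T] [Nonempty τ]

lemma exists_cone (h : IsConeApproximating E G) (hY : IsConcentrated E j Y) :
    ∃ (B Y' : T) (p : B ⟶ Y) (q : Y ⟶ Y') (w : Y' ⟶ B⟦(1 : ℤ)⟧), IsPrecover E j p ∧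
      Triangle.mk p q w ∈ distTriang T ∧ (ObjectProperty.ofObj E).triangEnvelope.trW q ∧
      IsConcentrated E (j - 1) Y' := by
  obtain ⟨B, p, hp⟩ := (h.hasPrecover (Y⟦j⟧)).exists_isPrecover
  obtain ⟨Y', q, w, hT⟩ := distinguished_cocone_triangle p
  exact ⟨B, Y', p, q, w, hp, hT, ObjectProperty.trW.mk' _ hT
    (hp.prop _ fun t => ObjectProperty.le_triangEnvelope _ _ ⟨t⟩),
    hp.isConcentrated_cone h.isConcentrated_self hT hY⟩

lemma exists_trW_isConcentrated (h : IsConeApproximating E G) (hY : IsConcentrated E j Y) (d : ℕ) :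
    ∃ (Y' : T) (q : Y ⟶ Y'), (ObjectProperty.ofObj E).triangEnvelope.trW q ∧
      IsConcentrated E (j - d) Y' ∧
      (j < 0 → ∀ s, Function.Bijective fun f : G s ⟶ Y => f ≫ q) := by
  induction d with
  | zero =>
    refine ⟨Y, 𝟙 Y, MorphismProperty.id_mem _ Y, by simpa using hY, fun _ s => ?_⟩
    simpa only [Category.comp_id] using! Function.bijective_id
  | succ d ih =>
    obtain ⟨Z, q, hq, hZ, hbij⟩ := ih
    obtain ⟨B, Z', p, q', w, hp, hT, hq', hZ'⟩ := h.exists_cone hZ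
    refine ⟨Z', q ≫ q', MorphismProperty.comp_mem _ _ _ hq hq', ?_, fun hj s => ?_⟩
    · rwa [sub_sub] at hZ'
    · have := And.intro (hp.comp_cone_injective (by lia) h.isConcentrated_left hT s)
        (hp.comp_cone_surjective (by lia) h.isConcentrated_left hT s)
      simpa only [← Category.assoc] using! Function.Bijective.comp this (hbij hj s)

lemma exists_orthogonal (h : IsConeApproximating E G) (hj : j < 0) (hY : IsConcentrated E j Y)
    {C : T} (hC : (ObjectProperty.ofObj E).triangEnvelope C) (s : σ) :
    ∃ (Y' : T) (q : Y ⟶ Y'), (ObjectProperty.ofObj E).triangEnvelope.trW q ∧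
      (∀ g : C ⟶ Y', g = 0) ∧ Function.Bijective fun f : G s ⟶ Y => f ≫ q := by
  obtain ⟨N, hN⟩ := triangEnvelope_ofObj_le_eventuallyOrthogonal C hC
  obtain ⟨Y', q, hq, hY', hbij⟩ := h.exists_trW_isConcentrated hY (j - N).toNat
  exact ⟨Y', q, hq, hN _ (by lia) Y' hY', hbij hj s⟩

lemma map_injective (h : IsConeApproximating E G) (hj : j < 0) (hY : IsConcentrated E j Y) (s : σ) :
    Function.Injective ((toVerdierQuotient (.ofObj E)).map : (G s ⟶ Y) → _) := by
  intro f g hfg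
  obtain ⟨Z, r, hr, hfgr⟩ := (MorphismProperty.map_eq_iff_postcomp _
    (ObjectProperty.ofObj E).triangEnvelope.trW f g).1 hfg
  obtain ⟨C, i, w, hT, hC⟩ := (ObjectProperty.trW_iff' _ r).1 hr
  obtain ⟨(c : G s ⟶ C), hc : f - g = c ≫ i⟩ := Triangle.coyoneda_exact₂ _ hT (f - g)
    ((Preadditive.sub_comp ..).trans (sub_eq_zero.2 hfgr))
  obtain ⟨Y', q, -, hCY', hbij⟩ := h.exists_orthogonal hj hY hC s
  apply hbij.1
  rw [← sub_eq_zero, ← Preadditive.sub_comp, hc, Category.assoc, hCY' (i ≫ q), comp_zero]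

lemma map_surjective_of_neg (h : IsConeApproximating E G) (hj : j < 0)
    (hY : IsConcentrated E j Y) (s : σ) :
    Function.Surjective ((toVerdierQuotient (.ofObj E)).map : (G s ⟶ Y) → _) := by
  intro φ
  let Q := toVerdierQuotient (.ofObj E)
  obtain ⟨α, rfl⟩ := Localization.exists_rightFraction Q
    (ObjectProperty.ofObj E).triangEnvelope.trW φ
  obtain ⟨C, i, w, hT, hC⟩ := (ObjectProperty.trW_iff' _ α.s).1 α.hs
  obtain ⟨Y', q, hq, hCY', hbij⟩ := h.exists_orthogonal hj hY hC s
  obtain ⟨g, hg : α.f ≫ q = α.s ≫ g⟩ := Triangle.yoneda_exact₂ _ hT (α.f ≫ q) (hCY' _)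
  obtain ⟨f, rfl⟩ := hbij.2 g
  have := Localization.inverts Q (ObjectProperty.ofObj E).triangEnvelope.trW q hq
  have := Localization.inverts Q (ObjectProperty.ofObj E).triangEnvelope.trW α.s α.hs
  refine ⟨f, ?_⟩
  rw [← cancel_mono (Q.map q), ← cancel_epi (Q.map α.s),
    MorphismProperty.RightFraction.map_s_comp_map_assoc, ← Functor.map_comp, ← Functor.map_comp,
    ← Functor.map_comp, hg]

theorem map_surjective (h : IsConeApproximating E G) (hY : IsConcentrated E 0 Y) (s : σ) :
    Function.Surjective ((toVerdierQuotient (.ofObj E)).map : (G s ⟶ Y) → _) := by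
  intro φ
  obtain ⟨B, Y', p, q, w, hp, hT, hq, hY'⟩ := h.exists_cone hY
  obtain ⟨g, hg⟩ := h.map_surjective_of_neg (by lia) hY' s (φ ≫ (toVerdierQuotient _).map q)
  obtain ⟨f, rfl⟩ := hp.comp_cone_surjective (by lia) h.isConcentrated_left hT s g
  have := Localization.inverts (toVerdierQuotient (.ofObj E)) _ q hq
  refine ⟨f, ?_⟩
  rw [← cancel_mono ((toVerdierQuotient (.ofObj E)).map q), ← hg, Functor.map_comp]

theorem map_eq_zero_iff (h : IsConeApproximating E G) (hY : IsConcentrated E 0 Y) {s : σ}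
    (f : G s ⟶ Y) :
    (toVerdierQuotient (.ofObj E)).map f = 0 ↔ f ∈ factorsThrough E (G s) Y := by
  refine ⟨fun hf => ?_, fun hf => toVerdierQuotient_map_eq_zero hf⟩
  obtain ⟨B, Y', p, q, w, hp, hT, -, hY'⟩ := h.exists_cone hY
  have hfq : f ≫ q = 0 := h.map_injective (by lia) hY' s <| by
    rw [Functor.map_comp, hf, zero_comp, Functor.map_zero]
  obtain ⟨g, rfl⟩ := Triangle.coyoneda_exact₂ _ hT f hfq
  exact hp.comp_mem_factorsThrough g

variable {k : Type*} [Field k] [Linear k T]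

lemma finite_hom_map (h : IsConeApproximating E G)
    (hfin : ∀ Y, (∀ t (f : E t ⟶ Y), f = 0) → ∀ s, Module.Finite k (G s ⟶ Y))
    (hY : IsConcentrated E j Y) (s : σ) :
    Module.Finite k ((toVerdierQuotient (.ofObj E)).obj (G s) ⟶
      (toVerdierQuotient (.ofObj E)).obj Y) := by
  let Q := toVerdierQuotient (.ofObj E)
  obtain ⟨Y', q, hq, hY', -⟩ := h.exists_trW_isConcentrated hY (j + 1).toNat
  have hj : j - (j + 1).toNat < 0 := by lia
  have := hfin Y' (fun t => hY'.eq_zero hj.ne) s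
  have := Localization.inverts Q (ObjectProperty.ofObj E).triangEnvelope.trW q hq
  have : Module.Finite k (Q.obj (G s) ⟶ Q.obj Y') :=
    Module.Finite.of_surjective (Functor.mapLinearMap k Q) (h.map_surjective_of_neg hj hY' s)
  exact finite_hom_of_iso (Iso.refl _) (asIso (Q.map q)).symm

theorem homFinite_verdierQuotient [∀ n : ℤ, (shiftFunctor T n).Linear k]
    (h : IsConeApproximating E G)
    (hfin : ∀ Y, (∀ t (f : E t ⟶ Y), f = 0) → ∀ s, Module.Finite k (G s ⟶ Y))
    (hgen : (ObjectProperty.ofObj G).IsClassicalTriangulatedGenerator) :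
    HomFinite k (VerdierQuotient (.ofObj E)) := by
  let Q := toVerdierQuotient (.ofObj E)
  have hfrom (s : σ) (Y : T) : finiteHomFrom k (Q.obj (G s)) (Q.obj Y) := by
    refine ObjectProperty.triangEnvelope_le_iff (P := .ofObj G)
      (Q := (finiteHomFrom k (Q.obj (G s))).inverseImage Q) |>.2 ?_ Y (hgen ▸ trivial)
    rintro _ ⟨s'⟩ a
    have := h.finite_hom_map hfin ((h.isConcentrated_right s').shift a) s
    exact finite_hom_of_iso (Y := Q.obj ((G s')⟦a⟧)) (Iso.refl _) ((Q.commShiftIso a).app (G s'))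
  have hto (X Y : T) : finiteHomTo k (Q.obj Y) (Q.obj X) := by
    refine ObjectProperty.triangEnvelope_le_iff (P := .ofObj G)
      (Q := (finiteHomTo k (Q.obj Y)).inverseImage Q) |>.2 ?_ X (hgen ▸ trivial)
    rintro _ ⟨s⟩ a
    exact finite_hom_of_shift a (hfrom s Y (-a))
  intro X Y
  have := Localization.essSurj Q (ObjectProperty.ofObj E).triangEnvelope.trW
  have := hto (Q.objPreimage X) (Q.objPreimage Y) 0
  exact finite_hom_of_iso (X := (Q.obj (Q.objPreimage X))⟦(0 : ℤ)⟧)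
    ((shiftFunctorZero _ ℤ).app _ ≪≫ Q.objObjPreimageIso X) (Q.objObjPreimageIso Y)

end IsConeApproximating

end VerdierHom

section FullSubcategory

variable {C : Type*} [Category* C] [Preadditive C] [HasZeroObject C] [HasShift C ℤ]
  [∀ n : ℤ, (shiftFunctor C n).Additive] [Pretriangulated C] (P : ObjectProperty C)
  [P.IsTriangulated]

lemma exists_distTriang_fullSubcategory {X Y Z : P.FullSubcategory} {f : X.obj ⟶ Y.obj}
    {g : Y.obj ⟶ Z.obj} {h : Z.obj ⟶ X.obj⟦(1 : ℤ)⟧} (hT : Triangle.mk f g h ∈ distTriang C) :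
    ∃ h' : Z ⟶ X⟦(1 : ℤ)⟧, Triangle.mk (P.homMk f) (P.homMk g) h' ∈ distTriang _ := by
  refine ⟨P.homMk (h ≫ (P.ι.commShiftIso (1 : ℤ)).inv.app X), isomorphic_distinguished _ hT _
    (Triangle.isoMk _ _ (Iso.refl _) (Iso.refl _) (Iso.refl _) ?_ ?_ ?_)⟩
  · exact (Category.comp_id f).trans (Category.id_comp f).symm
  · exact (Category.comp_id g).trans (Category.id_comp g).symm
  · have hh : (h ≫ (P.ι.commShiftIso (1 : ℤ)).inv.app X) ≫ (P.ι.commShiftIso (1 : ℤ)).hom.app X =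
        h := (Category.assoc _ _ _).trans
      ((congrArg (h ≫ ·) (Iso.inv_hom_id_app _ X)).trans (Category.comp_id h))
    exact (congrArg₂ (· ≫ ·) hh ((shiftFunctor C (1 : ℤ)).map_id X.obj)).trans
      ((Category.comp_id h).trans (Category.id_comp h).symm)

instance {k : Type*} [Field k] [Linear k C] [∀ n : ℤ, (shiftFunctor C n).Linear k] (n : ℤ) :
    (shiftFunctor P.FullSubcategory n).Linear k where
  map_smul f r := by
    apply P.ι.map_injective
    rw [P.ι.map_smul, ← cancel_mono ((P.ι.commShiftIso n).hom.app _), Linear.smul_comp,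
      P.ι.commShiftIso_hom_naturality, P.ι.commShiftIso_hom_naturality, Functor.map_smul,
      Functor.map_smul, Linear.comp_smul]

end FullSubcategory

section Triangles

variable {C : Type*} [Category* C] [Preadditive C] [HasZeroObject C] [HasShift C ℤ]
  [∀ n : ℤ, (shiftFunctor C n).Additive] [Pretriangulated C] {S X Y Z : C} {f : X ⟶ Y} {g : Y ⟶ Z}
  {h : Z ⟶ X⟦(1 : ℤ)⟧}

lemma comp_mor₂_bijective (hT : Triangle.mk f g h ∈ distTriang C) (hX : ∀ q : S ⟶ X, q = 0)
    (hX' : ∀ q : S ⟶ X⟦(1 : ℤ)⟧, q = 0) :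
    Function.Bijective (fun p : S ⟶ Y => p ≫ g) := by
  refine ⟨(injective_iff_map_eq_zero (Preadditive.rightComp S g)).2 fun p hp => ?_, fun p => ?_⟩
  · obtain ⟨(q : S ⟶ X), hq : p = q ≫ f⟩ := Triangle.coyoneda_exact₂ _ hT p hp
    rw [hq, hX q, zero_comp]
  · obtain ⟨(q : S ⟶ Y), hq : p = q ≫ g⟩ := Triangle.coyoneda_exact₃ _ hT p (hX' _)
    exact ⟨q, hq.symm⟩

lemma comp_mor₁_bijective (hT : Triangle.mk f g h ∈ distTriang C)
    (hZ : ∀ q : S ⟶ Z⟦(-1 : ℤ)⟧, q = 0) (hZ' : ∀ q : S ⟶ Z, q = 0) :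
    Function.Bijective (fun p : S ⟶ X => p ≫ f) := by
  refine ⟨(injective_iff_map_eq_zero (Preadditive.rightComp S f)).2 fun p hp => ?_, fun p => ?_⟩
  · obtain ⟨(q : S ⟶ Z⟦(-1 : ℤ)⟧), hq⟩ :=
      Triangle.coyoneda_exact₂ _ (inv_rot_of_distTriang _ hT) p hp
    exact hq.trans ((congrArg (· ≫ _) (hZ q)).trans zero_comp)
  · obtain ⟨(q : S ⟶ X), hq : p = q ≫ f⟩ := Triangle.coyoneda_exact₂ _ hT p (hZ' _)
    exact ⟨q, hq.symm⟩

end Triangles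

lemma map_bijective_iff_of_isIso_map {C D : Type*} [Category* C] [Category* D] (H : C ⥤ D)
    {S Y Z : C} (g : Y ⟶ Z) [IsIso (H.map g)] (hg : Function.Bijective fun p : S ⟶ Y => p ≫ g) :
    Function.Bijective (H.map : (S ⟶ Y) → _) ↔ Function.Bijective (H.map : (S ⟶ Z) → _) := by
  have hcomm : (H.map : (S ⟶ Z) → _) ∘ (fun p : S ⟶ Y => p ≫ g) =
      (asIso (H.map g)).homToEquiv ∘ H.map := by
    ext p
    simp
  rw [← Equiv.comp_bijective, ← hcomm, Function.Bijective.of_comp_iff _ hg]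

section Derived

variable {A : Type*} [Category* A] [Abelian A]

open DerivedCategory DerivedCategory.TStructure

lemma single_hom_eq_zero_of_isLE {X : A} [Projective X] {Y : DerivedCategory A} {n : ℤ} (hn : n < 0)
    [t.IsLE Y n] (f : (singleFunctor A 0).obj X ⟶ Y) : f = 0 := by
  obtain ⟨K, _, ⟨e⟩⟩ := exists_iso_Q_obj_of_isLE Y n
  rw [← cancel_mono e.hom, ← cancel_epi ((singleFunctorIsoCompQ A 0).inv.app X), zero_comp,
    comp_zero]
  exact from_singleFunctor_obj_eq_zero_of_projective _ n hn

lemma single_hom_shift_eq_zero {X Y : A} [Projective X] {a : ℤ} (ha : a ≠ 0)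
    (f : (singleFunctor A 0).obj X ⟶ ((singleFunctor A 0).obj Y)⟦a⟧) : f = 0 := by
  rcases lt_or_gt_of_ne ha with h | h
  · have := t.isGE_shift ((singleFunctor A 0).obj Y) 0 a (-a)
    exact t.zero f 0 (-a)
  · have := t.isLE_shift ((singleFunctor A 0).obj Y) 0 a (-a)
    exact single_hom_eq_zero_of_isLE (n := -a) (by lia) f

section Truncation

variable {X Y Z : DerivedCategory A} {f : X ⟶ Y} {g : Y ⟶ Z} {h : Z ⟶ X⟦(1 : ℤ)⟧}

lemma mono_homologyMap_mor₁_of_isGE (hT : Triangle.mk f g h ∈ distTriang _) {n n' : ℤ}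
    [t.IsGE Z n'] (hn : n ≤ n') : Mono ((homologyFunctor A n).map f) :=
  (HomologySequence.mono_homologyMap_mor₁_iff _ hT (n - 1) n).2
    ((isZero_of_isGE Z n' (n - 1) (by lia)).eq_of_src _ _)

lemma epi_homologyMap_mor₂_of_isLE (hT : Triangle.mk f g h ∈ distTriang _) {n n' : ℤ}
    [t.IsLE X n'] (hn : n' ≤ n) : Epi ((homologyFunctor A n).map g) :=
  (HomologySequence.epi_homologyMap_mor₂_iff _ hT n (n + 1)).2
    ((isZero_of_isLE X n' (n + 1) (by lia)).eq_of_tgt _ _)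

lemma isIso_homologyMap_mor₁_of_isGE (hT : Triangle.mk f g h ∈ distTriang _) {n n' : ℤ}
    [t.IsGE Z n'] (hn : n < n') : IsIso ((homologyFunctor A n).map f) := by
  have := mono_homologyMap_mor₁_of_isGE hT hn.le
  have : Epi ((homologyFunctor A n).map f) := (HomologySequence.epi_homologyMap_mor₁_iff _ hT n).2
    ((isZero_of_isGE Z n' n hn).eq_of_tgt _ _)
  exact isIso_of_mono_of_epi ((homologyFunctor A n).map f)

lemma isIso_homologyMap_mor₂_of_isLE (hT : Triangle.mk f g h ∈ distTriang _) {n n' : ℤ}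
    [t.IsLE X n'] (hn : n' < n) : IsIso ((homologyFunctor A n).map g) := by
  have := epi_homologyMap_mor₂_of_isLE hT hn.le
  have : Mono ((homologyFunctor A n).map g) :=
    (HomologySequence.mono_homologyMap_mor₂_iff _ hT n).2 ((isZero_of_isLE X n' n hn).eq_of_src _ _)
  exact isIso_of_mono_of_epi ((homologyFunctor A n).map g)

lemma isGE_mor₁_of_isGE (hT : Triangle.mk f g h ∈ distTriang _) {a b : ℤ} [t.IsGE Y a]
    [t.IsGE Z b] (hab : a ≤ b + 1) : t.IsGE X a := by
  have := t.isGE_shift Z b (-1) (b + 1)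
  have : t.IsGE (Z⟦(-1 : ℤ)⟧) a := t.isGE_of_ge _ a (b + 1)
  exact t.isGE₂ _ (inv_rot_of_distTriang _ hT) a this ‹_›

lemma isLE_mor₂_of_isLE (hT : Triangle.mk f g h ∈ distTriang _) {a b : ℤ} [t.IsLE Y b]
    [t.IsLE X a] (hab : a - 1 ≤ b) : t.IsLE Z b := by
  have := t.isLE_shift X a 1 (a - 1)
  have : t.IsLE (X⟦(1 : ℤ)⟧) b := t.isLE_of_le _ (a - 1) b
  exact t.isLE₂ _ (rot_of_distTriang _ hT) b ‹_› this

end Truncation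

lemma homologyFunctor_map_bijective (X : A) [Projective X] (Y : DerivedCategory A) :
    Function.Bijective
      ((homologyFunctor A 0).map : ((singleFunctor A 0).obj X ⟶ Y) → _) := by
  obtain ⟨B, Z, hB, hZ, _, a, _, hT⟩ := t.exists_triangle Y (-1) 0 (by lia)
  obtain ⟨B', C, hB', hC, b, _, _, hT'⟩ := t.exists_triangle Z 0 1 (by lia)
  rw [t.le_iff_isLE] at hB hB'
  rw [t.ge_iff_isGE] at hZ hC
  have := t.isLE_shift B (-1) 1 (-2)
  have := t.isGE_shift C 1 (-1) 2
  have := isIso_homologyMap_mor₂_of_isLE hT (show (-1 : ℤ) < 0 by lia)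
  have := isIso_homologyMap_mor₁_of_isGE hT' (show (0 : ℤ) < 1 by lia)
  have := isGE_mor₁_of_isGE hT' (a := 0) (b := 1) (by lia)
  rw [map_bijective_iff_of_isIso_map _ a (comp_mor₂_bijective hT
      (single_hom_eq_zero_of_isLE (n := -1) (by lia))
      (single_hom_eq_zero_of_isLE (n := -2) (by lia))),
    ← map_bijective_iff_of_isIso_map _ b (comp_mor₁_bijective hT'
      (fun q => t.zero q 0 2) (fun q => t.zero q 0 1))]
  obtain ⟨X', ⟨e⟩⟩ := exists_iso_singleFunctor_obj_of_isGE_of_isLE B' 0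
  rw [map_bijective_iff_of_isIso_map _ e.hom e.homToEquiv.bijective,
    ← Function.Bijective.of_comp_iff _ ((Functor.FullyFaithful.ofFullyFaithful
      (singleFunctor A 0)).map_bijective X X')]
  have hid := singleFunctorCompHomologyFunctorIso A 0
  have := Functor.Full.of_iso hid.symm
  have := Functor.Faithful.of_iso hid.symm
  exact (Functor.FullyFaithful.ofFullyFaithful
    (singleFunctor A 0 ⋙ homologyFunctor A 0)).map_bijective X X'

variable {k : Type*} [Field k] [Linear k A]

instance (n : ℤ) : (HomologicalComplex.homologyFunctor A (ComplexShape.up ℤ) n).Linear k where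
  map_smul f r := ShortComplex.homologyMap_smul
    ((HomologicalComplex.shortComplexFunctor A (ComplexShape.up ℤ) n).map f) r

instance (n : ℤ) : (homologyFunctor A n).Linear k :=
  let _ : Localization.Lifting Q (HomologicalComplex.quasiIso A (ComplexShape.up ℤ))
    (HomologicalComplex.homologyFunctor A (ComplexShape.up ℤ) n) (homologyFunctor A n) :=
    ⟨homologyFunctorFactors A n⟩
  (Localization.functor_linear_iff Q (HomologicalComplex.quasiIso A (ComplexShape.up ℤ)) k
    (HomologicalComplex.homologyFunctor A (ComplexShape.up ℤ) n) _).1 inferInstance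

variable (k) in
/-- Morphisms from a projective object `X`, placed in degree `0`, to a complex `Y` are the
morphisms from `X` to the cohomology of `Y` in degree `0`. -/
def singleHomEquiv (X : A) [Projective X] (Y : DerivedCategory A) :
    ((singleFunctor A 0).obj X ⟶ Y) ≃ₗ[k] (X ⟶ (homologyFunctor A 0).obj Y) :=
  (LinearEquiv.ofBijective ((homologyFunctor A 0).mapLinearMap k)
    (homologyFunctor_map_bijective X Y)).trans
      (Linear.homCongr k ((singleFunctorCompHomologyFunctorIso A 0).app X) (Iso.refl _))

lemma singleHomEquiv_apply {X : A} [Projective X] {Y : DerivedCategory A}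
    (f : (singleFunctor A 0).obj X ⟶ Y) : singleHomEquiv k X Y f =
      (singleFunctorCompHomologyFunctorIso A 0).inv.app X ≫ (homologyFunctor A 0).map f :=
  (Linear.homCongr_apply k _ _ _).trans (Category.comp_id _)

lemma singleHomEquiv_map_comp {X X' : A} [Projective X] [Projective X'] {Y : DerivedCategory A}
    (g : X ⟶ X') (f : (singleFunctor A 0).obj X' ⟶ Y) :
    singleHomEquiv k X Y ((singleFunctor A 0).map g ≫ f) = g ≫ singleHomEquiv k X' Y f := by
  rw [singleHomEquiv_apply, singleHomEquiv_apply, Functor.map_comp]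
  exact ((singleFunctorCompHomologyFunctorIso A 0).inv.naturality_assoc g _).symm

end Derived

section BoundedWith

variable {A : Type*} [Category* A] [Abelian A] (P : ObjectProperty A) [P.IsSerreClass]

open DerivedCategory DerivedCategory.TStructure

lemma boundedWith_of_truncation {X Y Z : DerivedCategory A} {f : X ⟶ Y} {g : Y ⟶ Z}
    {h : Z ⟶ X⟦(1 : ℤ)⟧} (hT : Triangle.mk f g h ∈ distTriang _) {n : ℤ}
    [hX : t.IsLE X n] [hZ : t.IsGE Z (n + 1)] (hY : boundedWith P Y) :
    boundedWith P X ∧ boundedWith P Z := by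
  obtain ⟨hXb, hZb⟩ := ObjectProperty.mem_of_hasInductedTStructure t.bounded t _ hT n (n + 1) rfl
    hX hY.1 hZ
  refine ⟨⟨hXb, fun j => ?_⟩, ⟨hZb, fun j => ?_⟩⟩
  · by_cases hj : j ≤ n
    · have := mono_homologyMap_mor₁_of_isGE hT (show j ≤ n + 1 by lia)
      exact P.prop_of_mono ((homologyFunctor A j).map f) (hY.2 j)
    · exact P.prop_of_isZero (isZero_of_isLE X n j (by lia))
  · by_cases hj : n + 1 ≤ j
    · have := epi_homologyMap_mor₂_of_isLE hT (show n ≤ j by lia)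
      exact P.prop_of_epi ((homologyFunctor A j).map g) (hY.2 j)
    · exact P.prop_of_isZero (isZero_of_isGE Z (n + 1) j (by lia))

instance : (boundedWith P).IsClosedUnderIsomorphisms := by
  unfold boundedWith; infer_instance

instance : (stalk P).Full := by unfold stalk; infer_instance

instance : (stalk P).Faithful := by unfold stalk; infer_instance

instance : (stalk P).Additive where
  map_add {X Y f g} := by
    apply (boundedWith P).ι.map_injective
    exact (P.ι ⋙ singleFunctor A 0).map_add (f := f) (g := g)

variable {P} {k : Type*} [Field k] [Linear k A]

instance : (stalk P).Linear k where
  map_smul {X Y} f r := by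
    apply (boundedWith P).ι.map_injective
    exact CategoryTheory.Functor.map_smul (P.ι ⋙ singleFunctor A 0) r f

variable (k) in
/-- `singleHomEquiv` for the objects of `boundedWith P`. -/
def stalkHomEquiv (X : P.FullSubcategory) [Projective X.obj] (Y : (boundedWith P).FullSubcategory) :
    ((stalk P).obj X ⟶ Y) ≃ₗ[k] (X.obj ⟶ (homologyFunctor A 0).obj Y.obj) :=
  InducedCategory.homLinearEquiv.trans (singleHomEquiv k X.obj Y.obj)

lemma stalkHomEquiv_map_comp {X X' : P.FullSubcategory} [Projective X.obj] [Projective X'.obj]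
    {Y : (boundedWith P).FullSubcategory} (g : X ⟶ X') (f : (stalk P).obj X' ⟶ Y) :
    stalkHomEquiv k X Y ((stalk P).map g ≫ f) = g.hom ≫ stalkHomEquiv k X' Y f :=
  singleHomEquiv_map_comp g.hom f.hom

lemma isConcentrated_stalk {τ : Type*} {E : τ → P.FullSubcategory}
    (hE : ∀ t, Projective (E t).obj) (X : P.FullSubcategory) :
    IsConcentrated (fun t => (stalk P).obj (E t)) 0 ((stalk P).obj X) := by
  intro n hn t f
  have := hE t
  apply (boundedWith P).ι.map_injective
  rw [← cancel_mono (((boundedWith P).ι.commShiftIso n).hom.app _), Functor.map_zero, zero_comp]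
  exact single_hom_shift_eq_zero (X := (E t).obj) (Y := X.obj) hn _

lemma exists_iso_shift_stalk {Y : (boundedWith P).FullSubcategory} {n : ℤ} [t.IsGE Y.obj n]
    [t.IsLE Y.obj n] : ∃ X : P.FullSubcategory, Nonempty (Y ≅ ((stalk P).obj X)⟦-n⟧) := by
  obtain ⟨X, ⟨e⟩⟩ := exists_iso_singleFunctor_obj_of_isGE_of_isLE Y.obj n
  have hX : P X := P.prop_of_iso ((singleFunctorCompHomologyFunctorIso A n).app X)
    (((boundedWith P).prop_of_iso e Y.2).2 n)
  have e' : Y.obj ≅ ((singleFunctor A 0).obj X)⟦-n⟧ :=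
    e ≪≫ (((singleFunctors A).shiftIso (-n) n 0 (by lia)).app X).symm
  exact ⟨⟨X, hX⟩, ⟨(boundedWith P).ι.preimageIso
    (e' ≪≫ (((boundedWith P).ι.commShiftIso (-n)).app ((stalk P).obj ⟨X, hX⟩)).symm)⟩⟩

variable (W : ObjectProperty (boundedWith P).FullSubcategory) [W.IsTriangulated]
  [W.IsClosedUnderIsomorphisms]

lemma prop_of_isGE_of_isLE (hW : ∀ X, W ((stalk P).obj X)) (a : ℤ) (n : ℕ)
    (Y : (boundedWith P).FullSubcategory) [hYa : t.IsGE Y.obj a] [hYn : t.IsLE Y.obj (a + n)] :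
    W Y := by
  induction n generalizing Y with
  | zero =>
    rw [Nat.cast_zero, add_zero] at hYn
    obtain ⟨X, ⟨e⟩⟩ := exists_iso_shift_stalk (Y := Y) (n := a)
    exact W.prop_of_iso e.symm (W.le_shift (-a) _ (hW X))
  | succ n ih =>
    obtain ⟨B, C, hB, hC, f, g, h, hT⟩ := t.exists_triangle Y.obj (a + n) (a + n + 1) rfl
    rw [t.le_iff_isLE] at hB
    rw [t.ge_iff_isGE] at hC
    obtain ⟨hBP, hCP⟩ := boundedWith_of_truncation P hT (n := a + n) Y.2
    obtain ⟨h', hT'⟩ := exists_distTriang_fullSubcategory (boundedWith P)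
      (X := ⟨B, hBP⟩) (Z := ⟨C, hCP⟩) hT
    refine W.ext_of_isTriangulatedClosed₂ _ hT' ?_ ?_
    · have : t.IsGE B a := isGE_mor₁_of_isGE hT (b := a + n + 1) (by lia)
      exact ih ⟨B, hBP⟩
    · rw [Nat.cast_succ, ← add_assoc] at hYn
      have : t.IsLE C (a + n + 1) := isLE_mor₂_of_isLE hT (a := a + n) (by lia)
      obtain ⟨X, ⟨e⟩⟩ := exists_iso_shift_stalk (Y := ⟨C, hCP⟩) (n := a + n + 1)
      exact W.prop_of_iso e.symm (W.le_shift _ _ (hW X))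

lemma prop_of_stalk (hW : ∀ X, W ((stalk P).obj X)) (Y : (boundedWith P).FullSubcategory) :
    W Y := by
  obtain ⟨⟨a, ha⟩, ⟨b, hb⟩⟩ := Y.2.1
  have : t.IsLE Y.obj (a + (b - a).toNat) := t.isLE_of_le _ b _ (by lia)
  exact prop_of_isGE_of_isLE W hW a (b - a).toNat Y

end BoundedWith

lemma projective_biproduct {C : Type*} [Category* C] [Preadditive C] {ι : Type*} {g : ι → C}
    [HasBiproduct g] (h : ∀ i, Projective (g i)) : Projective (⨁ g) where
  factors f e _ :=
    ⟨biproduct.desc fun i => Projective.factorThru (biproduct.ι g i ≫ f) e, by ext; simp⟩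

lemma epi_biproduct_desc {C : Type*} [Category* C] [Preadditive C] {ι : Type*} {g : ι → C}
    [HasBiproduct g] {X : C} {x : ∀ i, g i ⟶ X}
    (h : ∀ (Z : C) (f : X ⟶ Z), (∀ i, x i ≫ f = 0) → f = 0) : Epi (biproduct.desc x) :=
  Preadditive.epi_of_cancel_zero _ fun {Z} f hf =>
    h Z f fun i => by rw [← biproduct.ι_desc x i, Category.assoc, hf, comp_zero]

section QuotientSetting

variable {A : Type*} [Category* A] [Abelian A] {P : ObjectProperty A} [P.IsSerreClass]

attribute [local instance] Abelian.hasFiniteBiproducts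

instance : P.IsClosedUnderBinaryProducts where
  limitsOfShape_le := by
    rintro X ⟨p⟩
    have e := IsLimit.conePointUniqueUpToIso (prodIsProd _ _)
      ((IsLimit.postcomposeHomEquiv (diagramIsoPair p.diag) _).2 p.isLimit)
    exact P.prop_of_iso ((biprod.isoProd _ _) ≪≫ e) (P.prop_X₂_of_shortExact
      (ShortComplex.Splitting.ofHasBinaryBiproduct _ _).shortExact
      (p.prop_diag_obj (.mk .left)) (p.prop_diag_obj (.mk .right)))

instance : P.IsClosedUnderFiniteProducts := .mk'

lemma prop_biproduct {n : ℕ} (F : Fin n → P.FullSubcategory) : P (⨁ fun i => (F i).obj) :=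
  P.prop_of_iso (biproduct.isoProduct _).symm (P.prop_pi _ fun i => (F i).2)

section Generation

variable (W : ObjectProperty (boundedWith P).FullSubcategory) [W.IsTriangulated]

lemma prop_stalk_of_hasProjectiveDimensionLT [W.IsStableUnderRetracts]
    (hW : ∀ X : P.FullSubcategory, ∃ (F : P.FullSubcategory) (p : F ⟶ X), Projective F.obj ∧
      Epi p.hom ∧ W ((stalk P).obj F)) (n : ℕ) (X : P.FullSubcategory)
    [HasProjectiveDimensionLT X.obj (n + 1)] : W ((stalk P).obj X) := by
  induction n generalizing X with
  | zero =>
    obtain ⟨F, p, _, hp, hWF⟩ := hW X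
    have : Projective X.obj := projective_iff_hasProjectiveDimensionLT_one.2 ‹_›
    let s : X ⟶ F := P.homMk (Projective.factorThru (𝟙 X.obj) p.hom)
    have hs : s ≫ p = 𝟙 X := by
      ext
      exact Projective.factorThru_comp (𝟙 X.obj) p.hom
    exact W.prop_of_retract (Retract.map ⟨s, p, hs⟩ (stalk P)) hWF
  | succ n ih =>
    obtain ⟨F, p, hF, hp, hWF⟩ := hW X
    have hS : (ShortComplex.mk _ p.hom (kernel.condition p.hom)).ShortExact :=
      { exact := ShortComplex.exact_of_f_is_kernel _ (kernelIsKernel p.hom) }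
    let K : P.FullSubcategory := ⟨kernel p.hom, P.prop_of_mono (kernel.ι p.hom) F.2⟩
    have : HasProjectiveDimensionLT K.obj (n + 1) := hS.hasProjectiveDimensionLT_X₁ (n + 1)
      (hasProjectiveDimensionLT_of_ge F.obj 1 (n + 1) (by lia)) ‹_›
    obtain ⟨h', hT'⟩ := exists_distTriang_fullSubcategory (boundedWith P)
      (X := (stalk P).obj K) (Y := (stalk P).obj F) (Z := (stalk P).obj X)
      hS.singleTriangle_distinguished
    exact W.ext_of_isTriangulatedClosed₃ _ hT' (ih K) hWF

lemma prop_stalk_biproduct [W.IsClosedUnderIsomorphisms] {n : ℕ} (F : Fin n → P.FullSubcategory)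
    (hF : ∀ i, W ((stalk P).obj (F i))) : W ((stalk P).obj ⟨_, prop_biproduct F⟩) := by
  have e : (⨁ fun i => (stalk P).obj (F i)) ≅ (stalk P).obj ⟨_, prop_biproduct F⟩ :=
    (boundedWith P).ι.preimageIso ((boundedWith P).ι.mapBiproduct _ ≪≫
      ((DerivedCategory.singleFunctor A 0).mapBiproduct fun i => (F i).obj).symm)
  exact W.prop_of_iso e (W.prop_of_iso (biproduct.isoProduct _).symm (W.prop_pi _ hF))

end Generation

variable {τ σ : Type*} (k : Type*) [Field k] [Linear k A]

/-- Families `E` and `G` of projective objects in a Serre class `P` such that the objects `G`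
compute the Verdier quotient of the bounded derived category by the objects `E`. For modules over
`Λ`, the families consist of `Λe` and of `Λ`, or of their degree twists. -/
structure IsQuotientSetting (E : τ → P.FullSubcategory) (G : σ → P.FullSubcategory) : Prop where
  projective_left : ∀ t, Projective (E t).obj
  projective_right : ∀ s, Projective (G s).obj
  exists_epi : ∀ X, P X → ∃ (n : ℕ) (s : Fin n → σ) (x : ∀ i, (G (s i)).obj ⟶ X),
    Epi (biproduct.desc x)
  hasPrecover : ∀ X, P X → HasPrecover (fun t => (E t).obj) X
  finite_hom : ∀ X, P X → (∀ t (f : (E t).obj ⟶ X), f = 0) →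
    ∀ s, Module.Finite k ((G s).obj ⟶ X)
  finite_projectiveDimension : ∀ X, P X → ∃ n, HasProjectiveDimensionLT X n

namespace IsQuotientSetting

variable {k} {E : τ → P.FullSubcategory} {G : σ → P.FullSubcategory}

lemma hasPrecover_stalk (h : IsQuotientSetting k E G) (Y : (boundedWith P).FullSubcategory) :
    HasPrecover (fun t => (stalk P).obj (E t)) Y := by
  have := h.projective_left
  obtain ⟨n, t, x, hx⟩ := h.hasPrecover _ (Y.2.2 0)
  refine ⟨n, t, fun i => (stalkHomEquiv k (E (t i)) Y).symm (x i), fun t' f => ?_⟩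
  obtain ⟨g, hg⟩ := hx t' (stalkHomEquiv k (E t') Y f)
  refine ⟨fun i => (stalk P).map (P.homMk (g i)), (stalkHomEquiv k (E t') Y).injective ?_⟩
  simp [hg, stalkHomEquiv_map_comp]

lemma isConeApproximating (h : IsQuotientSetting k E G) :
    IsConeApproximating (fun t => (stalk P).obj (E t)) (fun s => (stalk P).obj (G s)) where
  isConcentrated_self t := isConcentrated_stalk h.projective_left (E t)
  isConcentrated_left t := isConcentrated_stalk h.projective_right (E t)
  isConcentrated_right s := isConcentrated_stalk h.projective_left (G s)
  hasPrecover := h.hasPrecover_stalk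

lemma finite_hom_stalk (h : IsQuotientSetting k E G) (Y : (boundedWith P).FullSubcategory)
    (hY : ∀ t (f : (stalk P).obj (E t) ⟶ Y), f = 0) (s : σ) :
    Module.Finite k ((stalk P).obj (G s) ⟶ Y) := by
  have := h.projective_left
  have := h.projective_right
  have := h.finite_hom _ (Y.2.2 0) (fun t f =>
    (stalkHomEquiv k (E t) Y).symm.map_eq_zero_iff.1 (hY t _)) s
  exact Module.Finite.equiv (stalkHomEquiv k (G s) Y).symm

lemma isClassicalTriangulatedGenerator [Nonempty σ] (h : IsQuotientSetting k E G) :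
    (ObjectProperty.ofObj fun s => (stalk P).obj (G s)).IsClassicalTriangulatedGenerator := by
  refine eq_top_iff.2 fun Y _ => prop_of_stalk _ (fun X => ?_) Y
  obtain ⟨n, hn⟩ := h.finite_projectiveDimension X.obj X.2
  have := hasProjectiveDimensionLT_of_ge X.obj n (n + 1) (by lia)
  refine prop_stalk_of_hasProjectiveDimensionLT _ (fun X => ?_) n X
  obtain ⟨m, s, x, hx⟩ := h.exists_epi X.obj X.2
  exact ⟨⟨_, prop_biproduct _⟩, P.homMk (biproduct.desc x),
    projective_biproduct fun i => h.projective_right (s i), hx,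
    prop_stalk_biproduct _ (fun i => G (s i)) fun i => ObjectProperty.le_triangEnvelope _ _ ⟨s i⟩⟩

variable [Nonempty τ]

theorem homFinite [Nonempty σ] (h : IsQuotientSetting k E G) :
    HomFinite k (VerdierQuotient (.ofObj fun t => (stalk P).obj (E t))) :=
  h.isConeApproximating.homFinite_verdierQuotient h.finite_hom_stalk
    h.isClassicalTriangulatedGenerator

theorem map_surjective (h : IsQuotientSetting k E G) (s s' : σ) :
    Function.Surjective fun f : G s ⟶ G s' =>
      (toVerdierQuotient (.ofObj fun t => (stalk P).obj (E t))).map ((stalk P).map f) :=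
  (h.isConeApproximating.map_surjective
    (isConcentrated_stalk h.projective_left (G s')) s).comp (stalk P).map_surjective

theorem map_eq_zero_iff (h : IsQuotientSetting k E G) {s s' : σ} (f : G s ⟶ G s') :
    (toVerdierQuotient (.ofObj fun t => (stalk P).obj (E t))).map ((stalk P).map f) = 0 ↔
      f ∈ factorsThrough E (G s) (G s') :=
  (h.isConeApproximating.map_eq_zero_iff (isConcentrated_stalk h.projective_left (G s')) _).trans
    (map_mem_factorsThrough_iff (stalk P) f)

end IsQuotientSetting

end QuotientSetting

section TwoSided

variable {Λ : Type u} [Ring Λ] {e : Λ}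

lemma twoSided_induction {p : Λ → Prop} (zero : p 0) (add : ∀ x y, p x → p y → p (x + y))
    (mul : ∀ b c, p (b * e * c)) {a : Λ} (ha : a ∈ twoSided e) : p a := by
  suffices h : ∀ b c, p (b * a * c) by simpa using h 1 1
  replace ha := TwoSidedIdeal.mem_asIdeal.1 ha
  induction ha using TwoSidedIdeal.span_induction with
  | mem x hx => obtain rfl := hx; exact mul
  | zero => simpa using zero
  | add x y _ _ hx hy => exact fun b c => by rw [mul_add, add_mul]; exact add _ _ (hx b c) (hy b c)
  | neg x _ hx => exact fun b c => by simpa using hx (-b) c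
  | left_absorb a x _ hx => exact fun b c => by simpa [mul_assoc] using hx (b * a) c
  | right_absorb a x _ hx => exact fun b c => by simpa [mul_assoc] using hx b (a * c)

lemma mem_twoSided_self : e ∈ twoSided e :=
  TwoSidedIdeal.mem_asIdeal.2 (TwoSidedIdeal.subset_span rfl)

lemma mul_mem_twoSided (b c : Λ) : b * e * c ∈ twoSided e :=
  Ideal.mul_mem_right _ _ (Ideal.mul_mem_left _ _ mem_twoSided_self)

lemma smul_eq_zero_of_mem_twoSided {X : Type*} [AddCommGroup X] [Module Λ X]
    (h : ∀ x : X, e • x = 0) {a : Λ} (ha : a ∈ twoSided e) (x : X) : a • x = 0 := by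
  refine twoSided_induction (p := fun a => a • x = 0) (zero_smul _ _) (fun a b ha hb => ?_)
    (fun b c => ?_) ha
  · rw [add_smul, ha, hb, add_zero]
  · rw [mul_smul, mul_smul, h, smul_zero]

end TwoSided

end Triangulated

lemma exists_fin_subset_span_range {Λ X : Type*} [Ring Λ] [AddCommGroup X] [Module Λ X]
    [IsNoetherian Λ X] (S : Set X) :
    ∃ (n : ℕ) (x : Fin n → S), S ⊆ Submodule.span Λ (Set.range fun i => (x i : X)) := by
  obtain ⟨t, htS, ht⟩ := (Submodule.fg_span_iff_fg_span_finset_subset (R := Λ) S).1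
    (IsNoetherian.noetherian _)
  have hrange : Set.range (fun i => (Set.inclusion htS (t.equivFin.symm i) : X)) = t :=
    (t.equivFin.symm.surjective.range_comp fun i : t => (i : X)).trans Subtype.range_coe
  exact ⟨t.card, fun i => Set.inclusion htS (t.equivFin.symm i),
    fun y hy => by rw [hrange, ← ht]; exact Submodule.subset_span hy⟩

section Modules

variable {k Λ : Type u} [Field k] [Ring Λ] [Algebra k Λ] {e : Λ}

lemma mul_eq_of_mem_span (he : e * e = e) {z : Λ} (hz : z ∈ Ideal.span {e}) : z * e = z := by
  obtain ⟨b, rfl⟩ := Ideal.mem_span_singleton'.1 hz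
  rw [mul_assoc, he]

lemma projective_span_singleton (he : e * e = e) :
    Module.Projective Λ (Ideal.span {e} : Ideal Λ) :=
  .of_split (Ideal.span {e}).subtype
    ((LinearMap.toSpanSingleton Λ Λ e).codRestrict _ fun x =>
      Ideal.mul_mem_left _ x (Ideal.mem_span_singleton_self e))
    (by ext z; exact mul_eq_of_mem_span he z.2)

section LeftIdealHom

variable {X Y : Type*} [AddCommGroup X] [Module Λ X] [AddCommGroup Y] [Module Λ Y]

variable (e) in
/-- The map `z ↦ zx` on the left ideal `Λe`. -/
def leftIdealHom (x : X) : (Ideal.span {e} : Ideal Λ) →ₗ[Λ] X :=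
  LinearMap.toSpanSingleton Λ X x ∘ₗ (Ideal.span {e}).subtype

variable (e) in
/-- The generator `e` of the left ideal `Λe`. -/
def leftIdealGen : (Ideal.span {e} : Ideal Λ) := ⟨e, Ideal.mem_span_singleton_self e⟩

lemma leftIdealHom_gen (x : X) : leftIdealHom e x (leftIdealGen e) = e • x := rfl

lemma leftIdealHom_sum {ι : Type*} (s : Finset ι) (x : ι → X) :
    leftIdealHom e (∑ i ∈ s, x i) = ∑ i ∈ s, leftIdealHom e (x i) := by
  ext z
  rw [LinearMap.sum_apply]
  exact Finset.smul_sum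

lemma comp_leftIdealHom (f : X →ₗ[Λ] Y) (x : X) :
    f ∘ₗ leftIdealHom e x = leftIdealHom e (f x) :=
  LinearMap.ext fun z => map_smul f (z : Λ) x

lemma leftIdealHom_apply_gen (he : e * e = e) (f : (Ideal.span {e} : Ideal Λ) →ₗ[Λ] X) :
    leftIdealHom e (f (leftIdealGen e)) = f :=
  LinearMap.ext fun z => (map_smul f (z : Λ) _).symm.trans
    (congrArg f (Subtype.ext (mul_eq_of_mem_span he z.2)))

lemma smul_apply_gen (he : e * e = e) (f : (Ideal.span {e} : Ideal Λ) →ₗ[Λ] X) :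
    e • f (leftIdealGen e) = f (leftIdealGen e) :=
  (map_smul f e _).symm.trans (congrArg f (Subtype.ext he))

lemma exists_precover_leftIdeal (he : e * e = e) (X : Type*) [AddCommGroup X] [Module Λ X]
    [IsNoetherian Λ X] : ∃ (n : ℕ) (x : Fin n → (Ideal.span {e} : Ideal Λ) →ₗ[Λ] X),
      ∀ f : (Ideal.span {e} : Ideal Λ) →ₗ[Λ] X,
        ∃ g : Fin n → (Ideal.span {e} : Ideal Λ) →ₗ[Λ] (Ideal.span {e} : Ideal Λ),
          f = ∑ i, x i ∘ₗ g i := by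
  obtain ⟨n, x, hx⟩ := exists_fin_subset_span_range (Λ := Λ) {x : X | e • x = x}
  refine ⟨n, fun i => leftIdealHom e (x i : X), fun f => ?_⟩
  obtain ⟨a, ha⟩ := (Submodule.mem_span_range_iff_exists_fun Λ).1 (hx (smul_apply_gen he f))
  refine ⟨fun i => leftIdealHom e (a i • leftIdealGen e), ?_⟩
  simp only [comp_leftIdealHom, map_smul, leftIdealHom_gen]
  calc f = leftIdealHom e (∑ i, a i • (x i : X)) := by rw [ha, leftIdealHom_apply_gen he]
    _ = ∑ i, leftIdealHom e (a i • e • (x i : X)) := by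
      rw [leftIdealHom_sum]
      exact Finset.sum_congr rfl fun i _ => by rw [(x i).2]

lemma apply_mem_twoSided (he : e * e = e) (f : (Ideal.span {e} : Ideal Λ) →ₗ[Λ] Λ)
    (z : (Ideal.span {e} : Ideal Λ)) : f z ∈ twoSided e := by
  rw [← leftIdealHom_apply_gen he f, ← smul_apply_gen he f]
  change (z : Λ) * (e * _) ∈ _
  rw [← mul_assoc]
  exact mul_mem_twoSided _ _

end LeftIdealHom

lemma finite_of_smul_eq_zero [Module.Finite k (Λ ⧸ twoSided e)] {X : Type*} [AddCommGroup X]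
    [Module Λ X] [Module k X] [IsScalarTower k Λ X] [Module.Finite Λ X]
    (hX : ∀ x : X, e • x = 0) : Module.Finite k X := by
  have htorsion : Module.IsTorsionBySet Λ X (twoSided e : Set Λ) :=
    fun x a => smul_eq_zero_of_mem_twoSided hX a.2 x
  let := htorsion.module
  have : IsScalarTower Λ (Λ ⧸ twoSided e) X := htorsion.isScalarTower
  have : IsScalarTower k (Λ ⧸ twoSided e) X := htorsion.isScalarTower
  have : Module.Finite (Λ ⧸ twoSided e) X := .of_restrictScalars_finite Λ _ _
  exact .trans (Λ ⧸ twoSided e) X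

open scoped ModuleCat in
lemma finite_hom_of_smul_eq_zero [Module.Finite k (Λ ⧸ twoSided e)] (X : ModuleCat.{u} Λ)
    [Module.Finite Λ X] (hX : ∀ x : X, e • x = 0) :
    Module.Finite k (ModuleCat.of Λ Λ ⟶ X) := by
  have : Module.Finite k X := finite_of_smul_eq_zero hX
  let evalOne : (ModuleCat.of Λ Λ ⟶ X) →ₗ[k] X :=
    { toFun f := f.hom (1 : Λ)
      map_add' _ _ := rfl
      map_smul' _ _ := rfl }
  exact Module.Finite.of_injective evalOne fun f g h =>
    ModuleCat.hom_ext (LinearMap.ext_ring h)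

variable (Λ) in
/-- The left module `Λ`, as a finitely generated module. -/
abbrev regularFG : (ModuleCat.isFG.{u} Λ).FullSubcategory :=
  ⟨.of Λ Λ, (inferInstance : Module.Finite Λ Λ)⟩

/-- The left module `Λe`, as a finitely generated module. -/
abbrev leftIdealFG (e : Λ) : (ModuleCat.isFG.{u} Λ).FullSubcategory :=
  ⟨.of Λ (Ideal.span {e} : Ideal Λ), (inferInstance : Module.Finite Λ (Ideal.span {e}))⟩

variable (k Λ) in
/-- Elements of `Λ` as endomorphisms of the left module `Λ`, by right multiplication. -/
def rightMulEquiv : Λ ≃ₗ[k] (regularFG Λ ⟶ regularFG Λ) where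
  toFun a := ObjectProperty.homMk (ModuleCat.ofHom (LinearMap.toSpanSingleton Λ Λ a))
  invFun f := f.hom.hom (1 : Λ)
  map_add' a b := ObjectProperty.hom_ext _ (ModuleCat.hom_ext
    (LinearMap.ext_ring (mul_add (1 : Λ) a b)))
  map_smul' r a := ObjectProperty.hom_ext _ (ModuleCat.hom_ext (LinearMap.ext_ring (by
    change (1 : Λ) * r • a = algebraMap k Λ r • ((1 : Λ) * a)
    rw [one_mul, one_mul, algebraMap_smul])))
  left_inv a := one_mul a
  right_inv f := ObjectProperty.hom_ext _ (ModuleCat.hom_ext (LinearMap.ext_ring (one_mul _)))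

lemma rightMulEquiv_mul (a b : Λ) :
    rightMulEquiv k Λ (a * b) = rightMulEquiv k Λ a ≫ rightMulEquiv k Λ b :=
  (rightMulEquiv k Λ).symm.injective (mul_assoc (1 : Λ) a b).symm

lemma rightMulEquiv_one : rightMulEquiv k Λ 1 = 𝟙 _ :=
  (rightMulEquiv k Λ).symm.injective (one_mul (1 : Λ))

lemma symm_mem_twoSided_of_mem_factorsThrough (he : e * e = e)
    {f : regularFG Λ ⟶ regularFG Λ}
    (hf : f ∈ factorsThrough (fun _ : Unit => leftIdealFG e) (regularFG Λ) (regularFG Λ)) :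
    (rightMulEquiv k Λ).symm f ∈ twoSided e := by
  induction hf using AddSubgroup.closure_induction with
  | mem f hf =>
    obtain ⟨-, g, x, rfl⟩ := hf
    exact apply_mem_twoSided he x.hom.hom _
  | zero => exact zero_mem (twoSided e)
  | add f g _ _ hf hg => exact add_mem hf hg
  | neg f _ hf => exact neg_mem hf

lemma rightMulEquiv_mem_factorsThrough {a : Λ} (ha : a ∈ twoSided e) : rightMulEquiv k Λ a ∈
    factorsThrough (fun _ : Unit => leftIdealFG e) (regularFG Λ) (regularFG Λ) := by
  refine twoSided_induction (p := fun a => rightMulEquiv k Λ a ∈ factorsThrough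
    (fun _ : Unit => leftIdealFG e) (regularFG Λ) (regularFG Λ)) ?_ ?_ ?_ ha
  · rw [map_zero]
    exact zero_mem _
  · intro a b ha hb
    rw [map_add]
    exact add_mem ha hb
  · intro b c
    have hbc : rightMulEquiv k Λ (b * e * c) =
        ObjectProperty.homMk (Y := leftIdealFG e) (ModuleCat.ofHom
          (LinearMap.toSpanSingleton Λ _ (b • leftIdealGen e))) ≫
        ObjectProperty.homMk (ModuleCat.ofHom (leftIdealHom e c)) :=
      (rightMulEquiv k Λ).symm.injective (mul_assoc (1 : Λ) (b * e) c).symm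
    rw [hbc]
    exact comp_mem_factorsThrough _ (t := ()) _

variable [IsNoetherianRing Λ]

variable (k) in
lemma isQuotientSetting_module [Module.Finite k (Λ ⧸ twoSided e)] (he : e * e = e)
    (hΛ : HasFiniteGlobalDimension Λ) :
    IsQuotientSetting k (fun _ : Unit => leftIdealFG e) (fun _ : Unit => regularFG Λ) where
  projective_left _ := (IsProjective.iff_projective _).1 (projective_span_singleton he)
  projective_right _ := (IsProjective.iff_projective _).1 (inferInstance : Module.Projective Λ Λ)
  exists_epi X (hX : Module.Finite Λ X) := by
    obtain ⟨n, x, hx⟩ := Module.Finite.exists_fin (R := Λ) (M := X)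
    refine ⟨n, fun _ => (), fun i => ModuleCat.ofHom (LinearMap.toSpanSingleton Λ X (x i)),
      epi_biproduct_desc fun Z g hg => ModuleCat.hom_ext (LinearMap.ext_on hx ?_)⟩
    rintro _ ⟨i, rfl⟩
    have hgx : g.hom ((1 : Λ) • x i) = 0 := congrArg (fun f => f.hom (1 : Λ)) (hg i)
    rwa [one_smul] at hgx
  hasPrecover X (hX : Module.Finite Λ X) := by
    obtain ⟨n, x, hx⟩ := exists_precover_leftIdeal he X
    refine ⟨n, fun _ => (), fun i => ModuleCat.ofHom (x i), fun _ f => ?_⟩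
    obtain ⟨g, hg⟩ := hx f.hom
    refine ⟨fun i => ModuleCat.ofHom (g i), ModuleCat.hom_ext ?_⟩
    exact hg.trans
      (ModuleCat.hom_sum (fun i => ModuleCat.ofHom (g i) ≫ ModuleCat.ofHom (x i)) _).symm
  finite_hom X (hX : Module.Finite Λ X) h _ := finite_hom_of_smul_eq_zero (e := e) X fun x =>
    congrArg (fun f => f.hom (leftIdealGen e)) (h () (ModuleCat.ofHom (leftIdealHom e x)))
  finite_projectiveDimension X _ := hΛ.imp' (· + 1) fun d h => h X

lemma map_rightMul_eq_zero_iff [Module.Finite k (Λ ⧸ twoSided e)] (he : e * e = e)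
    (hΛ : HasFiniteGlobalDimension Λ) (a : Λ) :
    (toDbfQuotient e).map (rightMul a) = 0 ↔ a ∈ twoSided e := by
  refine ((isQuotientSetting_module k he hΛ).map_eq_zero_iff (s := ()) (s' := ())
    (rightMulEquiv k Λ a)).trans ⟨fun h => ?_, rightMulEquiv_mem_factorsThrough⟩
  rw [← (rightMulEquiv k Λ).symm_apply_apply a]
  exact symm_mem_twoSided_of_mem_factorsThrough he h

variable (k) in
/-- Right multiplication as an algebra map to the opposite endomorphism algebra of `Λ` in the
Verdier quotient by `Λe`. -/
def rightMulAlgHom (e : Λ) : Λ →ₐ[k] (End ((toDbfQuotient e).obj (regularObj Λ)))ᵐᵒᵖ :=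
  .ofLinearMap
    ((MulOpposite.opLinearEquiv k).toLinearMap ∘ₗ
      (stalk (ModuleCat.isFG.{u} Λ) ⋙ toDbfQuotient e).mapLinearMap k ∘ₗ
        (rightMulEquiv k Λ).toLinearMap)
    (congrArg MulOpposite.op ((congrArg (stalk _ ⋙ toDbfQuotient e).map rightMulEquiv_one).trans
      (CategoryTheory.Functor.map_id _ _)))
    (fun a b => congrArg MulOpposite.op ((congrArg (stalk _ ⋙ toDbfQuotient e).map
      (rightMulEquiv_mul a b)).trans (CategoryTheory.Functor.map_comp _ _ _)))

theorem homFinite_dbfQuotient [Module.Finite k (Λ ⧸ twoSided e)] (he : e * e = e)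
    (hΛ : HasFiniteGlobalDimension Λ) : HomFinite k (DbfQuotient e) :=
  (isQuotientSetting_module k he hΛ).homFinite

theorem exists_algEquiv_end [Module.Finite k (Λ ⧸ twoSided e)] (he : e * e = e)
    (hΛ : HasFiniteGlobalDimension Λ) :
    ∃ φ : (Λ ⧸ twoSided e) ≃ₐ[k] (End ((toDbfQuotient e).obj (regularObj Λ)))ᵐᵒᵖ,
      ∀ a : Λ, φ (Ideal.Quotient.mk _ a) = .op ((toDbfQuotient e).map (rightMul a)) := by
  have hker (a : Λ) : rightMulAlgHom k e a = 0 ↔ a ∈ twoSided e :=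
    (MulOpposite.op_eq_zero_iff _).trans (map_rightMul_eq_zero_iff (k := k) he hΛ a)
  refine ⟨.ofBijective (Ideal.Quotient.liftₐ (twoSided e) (rightMulAlgHom k e)
    fun a ha => (hker a).2 ha) ⟨(injective_iff_map_eq_zero _).2 fun x hx => ?_, fun f => ?_⟩,
    fun a => rfl⟩
  · obtain ⟨a, rfl⟩ := Ideal.Quotient.mk_surjective x
    exact Ideal.Quotient.eq_zero_iff_mem.2 ((hker a).1 hx)
  · obtain ⟨g, hg⟩ := (isQuotientSetting_module k he hΛ).map_surjective () () f.unop
    obtain ⟨a, rfl⟩ := (rightMulEquiv k Λ).surjective g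
    exact ⟨Ideal.Quotient.mk _ a, MulOpposite.unop_injective hg⟩

end Modules

namespace GrMod

variable {k Λ : Type u} [Field k] [Ring Λ] [Algebra k Λ]
  {𝒜 : ℤ → Submodule k Λ} [GradedAlgebra 𝒜]

section Elements

/-- The map `I(n) → X` that sends `z` to `zy`. -/
def ofElem (I : Ideal Λ) {n j₀ : ℤ} (hn : n + j₀ = 0) {X : GrMod 𝒜} (y : X.X j₀) :
    ofLeftIdeal 𝒜 I n ⟶ X :=
  ofApp (M := ofLeftIdeal 𝒜 I n)
    (fun j =>
      { toFun := fun z => X.act (i := j + n) (by lia) ⟨z.1, z.2.1⟩ y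
        map_add' := fun z z' => by
          rw [← LinearMap.add_apply, ← map_add]
          rfl
        map_smul' := fun r z => by
          rw [RingHom.id_apply, ← LinearMap.smul_apply, ← map_smul]
          rfl })
    fun i j m h a z => by
      dsimp only [LinearMap.coe_mk, AddHom.coe_mk]
      rw [← X.mul_act (i := i) (j := j + n) (l := j₀) (m := j) (n := m) (by lia) h (by lia)]
      refine X.act_congr ?_ _ _ ?_ y
      · lia
      · rfl

lemma ofElem_app (I : Ideal Λ) {n j₀ : ℤ} (hn : n + j₀ = 0) {X : GrMod 𝒜} (y : X.X j₀) (j : ℤ)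
    (z : (ofLeftIdeal 𝒜 I n).X j) :
    app (ofElem I hn y) j z = X.act (i := j + n) (by lia) ⟨z.1, z.2.1⟩ y := rfl

lemma ofElem_comp (I : Ideal Λ) {n j₀ : ℤ} (hn : n + j₀ = 0) {X Y : GrMod 𝒜} (y : X.X j₀)
    (f : X ⟶ Y) : ofElem I hn y ≫ f = ofElem I hn (app f j₀ y) :=
  hom_ext fun j z => by rw [comp_app, ofElem_app, ofElem_app, map_act]

lemma ofElem_sum (I : Ideal Λ) {n j₀ : ℤ} (hn : n + j₀ = 0) {X : GrMod 𝒜} {ι : Type*}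
    (s : Finset ι) (y : ι → X.X j₀) :
    ofElem I hn (∑ i ∈ s, y i) = ∑ i ∈ s, ofElem I hn (y i) :=
  map_sum (AddMonoidHom.mk' (fun y : X.X j₀ => ofElem I hn y) fun y y' =>
    hom_ext fun j z => map_add (X.act (i := j + n) (n := j) (by lia) ⟨z.1, z.2.1⟩) y y') y s

variable {I : Ideal Λ} {e : Λ} (he : e ∈ 𝒜 0) (heI : e ∈ I)

/-- The generator `e` of `I = Λe`, as an element of `I(n)`. -/
def gen {n j₀ : ℤ} (hn : n + j₀ = 0) : (ofLeftIdeal 𝒜 I n).X j₀ :=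
  ⟨e, by rw [add_comm, hn]; exact he, heI⟩

lemma ofElem_app_gen (hI : ∀ z ∈ I, z * e = z) {n j₀ : ℤ} (hn : n + j₀ = 0)
    {X : GrMod 𝒜} (f : ofLeftIdeal 𝒜 I n ⟶ X) :
    ofElem I hn (app f j₀ (gen he heI hn)) = f :=
  hom_ext fun j z => by
    rw [ofElem_app, ← map_act]
    exact congrArg _ (Subtype.ext (hI _ z.2.2))

lemma app_ofElem_gen {n j₀ : ℤ} (hn : n + j₀ = 0) {X : GrMod 𝒜} (y : X.X j₀) :
    app (ofElem I hn y) j₀ (gen he heI hn) = X.act (zero_add j₀) ⟨e, he⟩ y := by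
  rw [ofElem_app]
  refine X.act_congr ?_ _ _ ?_ y
  · lia
  · rfl

lemma act_app_gen (hI : ∀ z ∈ I, z * e = z) {n j₀ : ℤ} (hn : n + j₀ = 0)
    {X : GrMod 𝒜} (f : ofLeftIdeal 𝒜 I n ⟶ X) :
    X.act (zero_add j₀) ⟨e, he⟩ (app f j₀ (gen he heI hn)) = app f j₀ (gen he heI hn) := by
  rw [← map_act]
  exact congrArg _ (Subtype.ext (hI e heI))

lemma hom_ext_gen (hI : ∀ z ∈ I, z * e = z) {n j₀ : ℤ} (hn : n + j₀ = 0)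
    {X : GrMod 𝒜} {f g : ofLeftIdeal 𝒜 I n ⟶ X}
    (h : app f j₀ (gen he heI hn) = app g j₀ (gen he heI hn)) : f = g := by
  rw [← ofElem_app_gen he heI hI hn f, h, ofElem_app_gen he heI hI hn g]

lemma projective_ofLeftIdeal (he : e ∈ 𝒜 0) (heI : e ∈ I) (hI : ∀ z ∈ I, z * e = z)
    (n : ℤ) : Projective (ofLeftIdeal 𝒜 I n) where
  factors {X Y} f p _ := by
    have hn := add_neg_cancel n
    obtain ⟨y, hy⟩ := surjective_of_epi p (-n) (app f (-n) (gen he heI hn))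
    refine ⟨ofElem I hn y, hom_ext_gen he heI hI hn ?_⟩
    rw [comp_app, app_ofElem_gen, map_act, hy, act_app_gen he heI hI]

end Elements

lemma projective_regular (n : ℤ) : Projective (regular 𝒜 n) :=
  projective_ofLeftIdeal SetLike.GradedOne.one_mem Submodule.mem_top (fun _ _ => mul_one _) n

section Total

/-- The underlying module of a graded module. -/
def Total (X : GrMod 𝒜) : Type u := DirectSum ℤ X.X

instance (X : GrMod 𝒜) : AddCommGroup X.Total := inferInstanceAs (AddCommGroup (DirectSum ℤ X.X))

instance (X : GrMod 𝒜) : Module k X.Total := inferInstanceAs (Module k (DirectSum ℤ X.X))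

/-- The inclusion of the part of degree `j`. -/
def of (X : GrMod 𝒜) (j : ℤ) : X.X j →ₗ[k] X.Total := DirectSum.lof k ℤ X.X j

/-- The projection to the part of degree `j`. -/
def comp (X : GrMod 𝒜) (j : ℤ) : X.Total →ₗ[k] X.X j := DirectSum.component k ℤ X.X j

lemma comp_of_self (X : GrMod 𝒜) (j : ℤ) (x : X.X j) : X.comp j (X.of j x) = x :=
  DirectSum.component.lof_self k j x

lemma comp_of_ne (X : GrMod 𝒜) {i j : ℤ} (h : i ≠ j) (x : X.X i) : X.comp j (X.of i x) = 0 :=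
  DirectSum.of_eq_of_ne _ _ _ h.symm

@[elab_as_elim]
lemma total_induction {X : GrMod 𝒜} {p : X.Total → Prop} (zero : p 0)
    (homogeneous : ∀ j x, p (X.of j x)) (add : ∀ x y, p x → p y → p (x + y)) (x : X.Total) : p x :=
  DirectSum.induction_on x zero homogeneous add

lemma total_ext {X : GrMod 𝒜} {x y : X.Total} (h : ∀ j, X.comp j x = X.comp j y) : x = y :=
  DFinsupp.ext h

lemma exists_eq_sum (X : GrMod 𝒜) (x : X.Total) :
    ∃ s : Finset ℤ, x = ∑ j ∈ s, X.of j (X.comp j x) := by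
  classical
  exact ⟨DFinsupp.support x, (DirectSum.sum_support_of x).symm⟩

/-- The linear map from the underlying module with given homogeneous parts. -/
def desc (X : GrMod 𝒜) {V : Type*} [AddCommGroup V] [Module k V] (f : ∀ j, X.X j →ₗ[k] V) :
    X.Total →ₗ[k] V :=
  DirectSum.toModule k ℤ V f

lemma desc_of (X : GrMod 𝒜) {V : Type*} [AddCommGroup V] [Module k V] (f : ∀ j, X.X j →ₗ[k] V)
    (j : ℤ) (x : X.X j) : X.desc f (X.of j x) = f j x :=
  DirectSum.toModule_lof k j x

lemma linearMap_ext {X : GrMod 𝒜} {V : Type*} [AddCommGroup V] [Module k V]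
    {f g : X.Total →ₗ[k] V} (h : ∀ j x, f (X.of j x) = g (X.of j x)) : f = g :=
  DirectSum.linearMap_ext k fun j => LinearMap.ext (h j)

/-- The action of a homogeneous element. -/
def homogeneousAct (X : GrMod 𝒜) (i : ℤ) : 𝒜 i →ₗ[k] X.Total →ₗ[k] X.Total where
  toFun a := X.desc fun j => X.of (i + j) ∘ₗ X.act rfl a
  map_add' a b := linearMap_ext fun j x => by simp [desc_of]
  map_smul' r a := linearMap_ext fun j x => by simp [desc_of]

lemma homogeneousAct_of (X : GrMod 𝒜) (i j : ℤ) (a : 𝒜 i) (x : X.X j) :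
    X.homogeneousAct i a (X.of j x) = X.of (i + j) (X.act rfl a x) :=
  X.desc_of _ j x

/-- The action of the algebra, as a linear map. -/
def totalAct (X : GrMod 𝒜) : Λ →ₗ[k] X.Total →ₗ[k] X.Total :=
  DirectSum.toModule k ℤ _ X.homogeneousAct ∘ₗ (DirectSum.decomposeLinearEquiv 𝒜).toLinearMap

lemma totalAct_of (X : GrMod 𝒜) {i j n : ℤ} (h : i + j = n) (a : 𝒜 i) (x : X.X j) :
    X.totalAct a (X.of j x) = X.of n (X.act h a x) := by
  subst h
  simp [totalAct, homogeneousAct_of]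

instance (X : GrMod 𝒜) : Module Λ X.Total where
  smul a x := X.totalAct a x
  one_smul x := by
    change X.totalAct 1 x = x
    induction x using total_induction with
    | zero => exact map_zero _
    | homogeneous j x =>
      exact (X.totalAct_of (zero_add j) ⟨1, SetLike.GradedOne.one_mem⟩ x).trans
        (congrArg _ (X.one_act x))
    | add x y hx hy => rw [map_add, hx, hy]
  mul_smul a b x := by
    change X.totalAct (a * b) x = X.totalAct a (X.totalAct b x)
    induction x using total_induction with
    | zero => simp only [map_zero]
    | add x y hx hy => simp only [map_add, hx, hy]
    | homogeneous l x =>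
    induction a using DirectSum.Decomposition.inductionOn 𝒜 with
    | zero => simp only [zero_mul, map_zero, LinearMap.zero_apply]
    | add a a' ha ha' => simp only [add_mul, map_add, LinearMap.add_apply, ha, ha']
    | @homogeneous i a =>
    induction b using DirectSum.Decomposition.inductionOn 𝒜 with
    | zero => simp only [mul_zero, map_zero, LinearMap.zero_apply]
    | add b b' hb hb' => simp only [mul_add, map_add, LinearMap.add_apply, hb, hb']
    | @homogeneous j b =>
      rw [X.totalAct_of (rfl : j + l = j + l), X.totalAct_of (rfl : i + (j + l) = i + (j + l)),
        ← X.mul_act _ _ (by lia)]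
      exact X.totalAct_of (by lia) ⟨(a : Λ) * b, SetLike.GradedMul.mul_mem a.2 b.2⟩ x
  smul_zero a := map_zero _
  smul_add a := map_add _
  add_smul a b x := LinearMap.congr_fun (map_add X.totalAct a b) x
  zero_smul x := LinearMap.congr_fun (map_zero X.totalAct) x

lemma smul_of (X : GrMod 𝒜) {i j n : ℤ} (h : i + j = n) (a : 𝒜 i) (x : X.X j) :
    (a : Λ) • X.of j x = X.of n (X.act h a x) := X.totalAct_of h a x

instance (X : GrMod 𝒜) : IsScalarTower k Λ X.Total :=
  .of_algebraMap_smul fun r x => by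
    rw [Algebra.algebraMap_eq_smul_one]
    exact (LinearMap.congr_fun (map_smul X.totalAct r 1) x).trans (congrArg (r • ·) (one_smul Λ x))

lemma comp_smul_of (X : GrMod 𝒜) {i j n : ℤ} (h : i + j = n) (a : Λ) (x : X.X j) :
    X.comp n (a • X.of j x) = X.act h (DirectSum.decompose 𝒜 a i) x := by
  induction a using DirectSum.Decomposition.inductionOn 𝒜 with
  | zero => simp
  | @homogeneous i' a =>
    rw [X.smul_of rfl]
    by_cases hi : i' = i
    · subst hi h
      rw [comp_of_self, DirectSum.decompose_coe, DirectSum.of_eq_same]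
    · rw [comp_of_ne _ (by lia), DirectSum.decompose_coe, DirectSum.of_eq_of_ne _ _ _ (Ne.symm hi),
        map_zero, LinearMap.zero_apply]
  | add a a' ha ha' =>
    rw [add_smul, map_add, ha, ha', DirectSum.decompose_add, DirectSum.add_apply, map_add,
      LinearMap.add_apply]

lemma comp_smul (X : GrMod 𝒜) {i j n : ℤ} (h : i + j = n) (a : 𝒜 i) (x : X.Total) :
    X.comp n ((a : Λ) • x) = X.act h a (X.comp j x) := by
  induction x using total_induction with
  | zero => simp only [smul_zero, map_zero]
  | homogeneous l x =>
    by_cases hl : l = j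
    · subst hl
      rw [X.smul_of h, comp_of_self, comp_of_self]
    · rw [X.smul_of rfl, comp_of_ne _ (by lia), comp_of_ne _ hl, map_zero]
  | add x y hx hy => simp only [smul_add, map_add, hx, hy]

/-- The `Λ`-linear map from the underlying module with given homogeneous parts. -/
def descLinear (X : GrMod 𝒜) {V : Type*} [AddCommGroup V] [Module k V] [Module Λ V]
    (f : ∀ j, X.X j →ₗ[k] V)
    (hf : ∀ (i j n : ℤ) (h : i + j = n) (a : 𝒜 i) (x : X.X j),
      f n (X.act h a x) = (a : Λ) • f j x) : X.Total →ₗ[Λ] V where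
  toFun := X.desc f
  map_add' := map_add _
  map_smul' a x := by
    rw [RingHom.id_apply]
    induction x using total_induction with
    | zero => simp only [smul_zero, map_zero]
    | add x y hx hy => simp only [smul_add, map_add, hx, hy]
    | homogeneous j x =>
    induction a using DirectSum.Decomposition.inductionOn 𝒜 with
    | zero => simp only [zero_smul, map_zero]
    | add a a' ha ha' => simp only [add_smul, map_add, ha, ha']
    | @homogeneous i a => rw [X.smul_of rfl, desc_of, desc_of, hf]

/-- The linear map between underlying modules. -/
def totalMap {X Y : GrMod 𝒜} (f : X ⟶ Y) : X.Total →ₗ[Λ] Y.Total :=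
  X.descLinear (fun j => Y.of j ∘ₗ app f j) fun _ _ _ h a x => by
    rw [LinearMap.comp_apply, LinearMap.comp_apply, map_act, Y.smul_of h]

lemma totalMap_of {X Y : GrMod 𝒜} (f : X ⟶ Y) (j : ℤ) (x : X.X j) :
    totalMap f (X.of j x) = Y.of j (app f j x) :=
  X.desc_of _ j x

lemma comp_totalMap {X Y : GrMod 𝒜} (f : X ⟶ Y) (j : ℤ) (x : X.Total) :
    Y.comp j (totalMap f x) = app f j (X.comp j x) := by
  induction x using total_induction with
  | zero => simp only [map_zero]
  | homogeneous l x =>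
    rw [totalMap_of]
    by_cases h : l = j
    · subst h
      rw [comp_of_self, comp_of_self]
    · rw [comp_of_ne _ h, comp_of_ne _ h, map_zero]
  | add x y hx hy => simp only [map_add, hx, hy]

lemma totalMap_surjective {X Y : GrMod 𝒜} (f : X ⟶ Y) [Epi f] :
    Function.Surjective (totalMap f) := fun y => by
  induction y using total_induction with
  | zero => exact ⟨0, map_zero _⟩
  | homogeneous j y =>
    obtain ⟨x, rfl⟩ := surjective_of_epi f j y
    exact ⟨X.of j x, totalMap_of f j x⟩
  | add y y' hy hy' =>
    obtain ⟨x, rfl⟩ := hy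
    obtain ⟨x', rfl⟩ := hy'
    exact ⟨x + x', map_add _ _ _⟩

lemma totalMap_id (X : GrMod 𝒜) : totalMap (𝟙 X) = LinearMap.id :=
  LinearMap.ext fun x => total_ext fun j => comp_totalMap (𝟙 X) j x

lemma totalMap_comp {X Y Z : GrMod 𝒜} (f : X ⟶ Y) (g : Y ⟶ Z) :
    totalMap (f ≫ g) = totalMap g ∘ₗ totalMap f :=
  LinearMap.ext fun x => total_ext fun j => by
    rw [LinearMap.comp_apply, comp_totalMap, comp_totalMap, comp_totalMap, comp_app]

lemma totalMap_add {X Y : GrMod 𝒜} (f g : X ⟶ Y) :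
    totalMap (f + g) = totalMap f + totalMap g :=
  LinearMap.ext fun x => total_ext fun j => by
    rw [LinearMap.add_apply, map_add, comp_totalMap, comp_totalMap, comp_totalMap]
    rfl

variable (𝒜) in
/-- The functor that forgets the grading. -/
def totalFunctor : GrMod 𝒜 ⥤ ModuleCat.{u} Λ where
  obj X := ModuleCat.of Λ X.Total
  map f := ModuleCat.ofHom (totalMap f)
  map_id X := by rw [totalMap_id]; rfl
  map_comp f g := by rw [totalMap_comp]; rfl

instance : (totalFunctor 𝒜).Additive where
  map_add {_ _ f g} := congrArg ModuleCat.ofHom (totalMap_add f g)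

end Total

/-- The element `1` of degree `-n` in `Λ(n)`. -/
abbrev genOne {n j : ℤ} (h : n + j = 0) : (regular 𝒜 n).X j :=
  gen SetLike.GradedOne.one_mem Submodule.mem_top h

lemma regular_hom_ext {n j : ℤ} (h : n + j = 0) {X : GrMod 𝒜} {f g : regular 𝒜 n ⟶ X}
    (hfg : app f j (genOne h) = app g j (genOne h)) : f = g :=
  hom_ext_gen SetLike.GradedOne.one_mem Submodule.mem_top (fun _ _ => mul_one _) h hfg

section Generators

lemma finite_total {X : GrMod 𝒜} (hX : isFG 𝒜 X) : Module.Finite Λ X.Total := by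
  obtain ⟨ι, _, d, x, h⟩ := hX
  refine .of_fg_top (Submodule.fg_def.2
    ⟨Set.range fun s => X.of (d s) (x s), Set.finite_range _, eq_top_iff.2 fun y _ => ?_⟩)
  induction y using total_induction with
  | zero => exact zero_mem _
  | homogeneous j y =>
    obtain ⟨a, rfl⟩ := h j y
    rw [map_sum]
    refine Submodule.sum_mem _ fun s _ => ?_
    rw [← X.smul_of]
    exact Submodule.smul_mem _ _ (Submodule.subset_span ⟨s, rfl⟩)
  | add y z hy hz => exact add_mem (hy trivial) (hz trivial)

lemma exists_epi_regular {X : GrMod 𝒜} (hX : isFG 𝒜 X) [HasFiniteBiproducts (GrMod 𝒜)] :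
    ∃ (n : ℕ) (d : Fin n → ℤ) (x : ∀ i, regular 𝒜 (d i) ⟶ X), Epi (biproduct.desc x) := by
  obtain ⟨ι, _, d, x, h⟩ := hX
  let φ := (Fintype.equivFin ι).symm
  refine ⟨Fintype.card ι, fun i => -d (φ i),
    fun i => ofElem _ (neg_add_cancel (d (φ i))) (x (φ i)),
    epi_biproduct_desc fun Z g hg => hom_ext fun j y => ?_⟩
  have hgx (s : ι) : app g _ (x s) = 0 := by
    obtain ⟨i, rfl⟩ := φ.surjective s
    have hx := app_ofElem_gen SetLike.GradedOne.one_mem Submodule.mem_top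
      (neg_add_cancel (d (φ i))) (x (φ i))
    rw [← X.one_act (x (φ i)), ← hx, ← comp_app]
    exact congrArg (fun q : regular 𝒜 (-d (φ i)) ⟶ Z =>
      app q (d (φ i)) (genOne (neg_add_cancel _))) (hg i)
  obtain ⟨a, rfl⟩ := h j y
  rw [map_sum]
  exact Finset.sum_eq_zero fun s _ => by rw [map_act, hgx, map_zero]

lemma exists_fin_generators_of_act_eq [IsNoetherianRing Λ] {X : GrMod 𝒜} (hX : isFG 𝒜 X) {e : Λ}
    (he : e ∈ 𝒜 0) :
    ∃ (n : ℕ) (d : Fin n → ℤ) (x : ∀ s, X.X (d s)),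
      (∀ s, X.act (zero_add _) ⟨e, he⟩ (x s) = x s) ∧
      ∀ (j : ℤ) (y : X.X j), X.act (zero_add _) ⟨e, he⟩ y = y →
        ∃ a : ∀ s, 𝒜 (j - d s), y = ∑ s, X.act (sub_add_cancel j (d s)) (a s) (x s) := by
  have := finite_total hX
  obtain ⟨n, v, hv⟩ := exists_fin_subset_span_range (Λ := Λ)
    {v : X.Total | ∃ (j : ℤ) (y : X.X j), X.act (zero_add _) ⟨e, he⟩ y = y ∧ X.of j y = v}
  choose d x hex hx using fun i => (v i).2
  refine ⟨n, d, x, hex, fun j y hy => ?_⟩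
  obtain ⟨c, hc⟩ := (Submodule.mem_span_range_iff_exists_fun Λ).1 (hv ⟨j, y, hy, rfl⟩)
  refine ⟨fun i => DirectSum.decompose 𝒜 (c i) (j - d i), ?_⟩
  rw [← X.comp_of_self j y, ← hc, map_sum]
  exact Finset.sum_congr rfl fun i _ => by rw [← hx, X.comp_smul_of]

lemma finite_hom_regular {e : Λ} [Module.Finite k (Λ ⧸ twoSided e)] {X : GrMod 𝒜}
    (hX : isFG 𝒜 X) (he : e ∈ 𝒜 0)
    (h0 : ∀ (j : ℤ) (y : X.X j), X.act (zero_add _) ⟨e, he⟩ y = 0) (s : ℤ) :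
    Module.Finite k (regular 𝒜 s ⟶ X) := by
  have hs := add_neg_cancel s
  have := finite_total hX
  have : Module.Finite k X.Total := by
    refine finite_of_smul_eq_zero fun x : X.Total => (?_ : e • x = 0)
    induction x using total_induction with
    | zero => exact smul_zero _
    | homogeneous j y => exact (X.smul_of (zero_add j) ⟨e, he⟩ y).trans (by rw [h0, map_zero])
    | add x y hx hy => rw [smul_add, hx, hy, add_zero]
  let evalOne : (regular 𝒜 s ⟶ X) →ₗ[k] X.X (-s) :=
    { toFun f := app f (-s) (genOne hs)
      map_add' _ _ := rfl
      map_smul' _ _ := rfl }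
  have hof : Function.Injective (X.of (-s)) :=
    Function.LeftInverse.injective (X.comp_of_self (-s))
  exact Module.Finite.of_injective (X.of (-s) ∘ₗ evalOne)
    (hof.comp fun f g hfg => regular_hom_ext hs hfg)

end Generators

section ProjectiveDimension

lemma projective_total_regular (n : ℤ) : Module.Projective Λ (regular 𝒜 n).Total := by
  let val : (regular 𝒜 n).Total →ₗ[Λ] Λ :=
    (regular 𝒜 n).descLinear (fun j => Submodule.subtype _) fun _ _ _ _ _ _ => rfl
  let γ := (regular 𝒜 n).of (-n) (genOne (add_neg_cancel n))
  refine .of_split val (LinearMap.toSpanSingleton Λ _ γ) (LinearMap.ext fun x => ?_)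
  change val x • γ = x
  induction x using total_induction with
  | zero => rw [map_zero, zero_smul]
  | homogeneous j x =>
    have hval : val ((regular 𝒜 n).of j x) = x.1 := desc_of _ _ j x
    rw [hval]
    exact (smul_of _ (i := j + n) (n := j) (by lia) ⟨x.1, x.2.1⟩ _).trans
      (congrArg _ (Subtype.ext (mul_one x.1)))
  | add x y hx hy => rw [map_add, add_smul, hx, hy]

/-- The part of degree `0` of a linear map between underlying modules. -/
def degreeZeroPart {X Y : GrMod 𝒜} (f : X.Total →ₗ[Λ] Y.Total) : X ⟶ Y :=
  ofApp (fun j => Y.comp j ∘ₗ f.restrictScalars k ∘ₗ X.of j) fun i j n h a x => by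
    simp only [LinearMap.comp_apply, LinearMap.restrictScalars_apply]
    rw [← X.smul_of, map_smul, Y.comp_smul h]

lemma projective_of_projective_total {X F : GrMod 𝒜} (p : F ⟶ X) [Epi p] [Projective F]
    [Module.Projective Λ X.Total] : Projective X := by
  obtain ⟨s, hs⟩ := Module.projective_lifting_property (totalMap p) LinearMap.id
    (totalMap_surjective p)
  have hsp : degreeZeroPart s ≫ p = 𝟙 X := hom_ext fun j x => by
    change app p j (F.comp j (s (X.of j x))) = x
    rw [← comp_totalMap, ← LinearMap.comp_apply, hs, LinearMap.id_apply, comp_of_self]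
  exact Retract.projective (Y := F) ⟨degreeZeroPart s, p, hsp⟩

lemma shortExact_total {X F : GrMod 𝒜} (p : F ⟶ X) [Epi p] :
    (ShortComplex.mk ((totalFunctor 𝒜).map (kerι p)) ((totalFunctor 𝒜).map p)
      (by rw [← Functor.map_comp, kerι_comp, Functor.map_zero])).ShortExact := by
  refine .mk' ((ShortComplex.moduleCat_exact_iff _).2 fun (x : F.Total) (hx : totalMap p x = 0) =>
    ?_) ((ModuleCat.mono_iff_injective _).2 ?_)
    ((ModuleCat.epi_iff_surjective _).2 (totalMap_surjective p))
  · obtain ⟨s, hs⟩ := F.exists_eq_sum x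
    have hcomp (j : ℤ) : app p j (F.comp j x) = 0 := by rw [← comp_totalMap, hx, map_zero]
    refine ⟨∑ j ∈ s, (ker p).of j (⟨F.comp j x, hcomp j⟩ : LinearMap.ker (app p j)), ?_⟩
    refine (map_sum (totalMap (kerι p)) _ _).trans (Eq.trans ?_ hs.symm)
    exact Finset.sum_congr rfl fun j _ => totalMap_of (kerι p) j _
  · refine (injective_iff_map_eq_zero (totalMap (kerι p))).2 fun x hx => total_ext fun j => ?_
    rw [map_zero]
    exact Subtype.ext ((comp_totalMap (kerι p) j x).symm.trans (by rw [hx, map_zero]; rfl))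

attribute [local instance] Abelian.hasFiniteBiproducts

lemma projective_total_biproduct_regular {n : ℕ} (d : Fin n → ℤ) :
    Projective ((totalFunctor 𝒜).obj (⨁ fun i => regular 𝒜 (d i))) :=
  .of_iso ((totalFunctor 𝒜).mapBiproduct fun i => regular 𝒜 (d i)).symm
    (projective_biproduct fun i =>
      (IsProjective.iff_projective _).1 (projective_total_regular (d i)))

variable [IsNoetherianRing Λ]

lemma hasProjectiveDimensionLT_of_total (n : ℕ) {X : GrMod 𝒜} (hX : isFG 𝒜 X)
    (h : HasProjectiveDimensionLT ((totalFunctor 𝒜).obj X) (n + 1)) :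
    HasProjectiveDimensionLT X (n + 1) := by
  induction n generalizing X with
  | zero =>
    obtain ⟨n, d, x, hx⟩ := exists_epi_regular hX
    have := projective_biproduct fun i => projective_regular (𝒜 := 𝒜) (d i)
    have : Module.Projective Λ X.Total := (IsProjective.iff_projective _).2
      (projective_iff_hasProjectiveDimensionLT_one.2 h)
    exact projective_iff_hasProjectiveDimensionLT_one.1
      (projective_of_projective_total (biproduct.desc x))
  | succ n ih =>
    obtain ⟨m, d, x, hx⟩ := exists_epi_regular hX
    have := projective_biproduct fun i => projective_regular (𝒜 := 𝒜) (d i)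
    have := projective_total_biproduct_regular (𝒜 := 𝒜) d
    have hFG : isFG 𝒜 (⨁ fun i => regular 𝒜 (d i)) :=
      prop_biproduct fun i => (⟨regular 𝒜 (d i), isFG_regular (d i)⟩ : (isFG 𝒜).FullSubcategory)
    let p := biproduct.desc x
    have : Mono (kerι p) := Fork.IsLimit.mono (kerIsLimit p)
    have hS : (ShortComplex.mk (kerι p) p (kerι_comp p)).ShortExact :=
      { exact := ShortComplex.exact_of_f_is_kernel _ (kerIsLimit p) }
    have hK := ih (isFG_of_mono (kerι p) hFG)
      ((shortExact_total p).hasProjectiveDimensionLT_X₁ (n + 1)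
        (hasProjectiveDimensionLT_of_ge _ 1 (n + 1) (by lia)) h)
    exact hS.hasProjectiveDimensionLT_X₃ (n + 1) hK
      (hasProjectiveDimensionLT_of_ge _ 1 (n + 2) (by lia))

end ProjectiveDimension

section Quotient

/-- `Λ(n)` as a finitely generated graded module. -/
abbrev regularFG (𝒜 : ℤ → Submodule k Λ) [GradedAlgebra 𝒜] (n : ℤ) : (isFG 𝒜).FullSubcategory :=
  ⟨regular 𝒜 n, isFG_regular n⟩

variable {e : Λ} (he : e ∈ 𝒜 0) (hee : e * e = e)

/-- `(Λe)(n)` as a finitely generated graded module. -/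
abbrev leftIdealFG (n : ℤ) : (isFG 𝒜).FullSubcategory :=
  ⟨ofLeftIdeal 𝒜 (Ideal.span {e}) n, isFG_ofLeftIdeal e he hee n⟩

variable (𝒜) in
/-- Elements of degree `n` as maps `Λ → Λ(n)`, by right multiplication. -/
def rightMulEquiv (n : ℤ) : 𝒜 n ≃+ (regularFG 𝒜 0 ⟶ regularFG 𝒜 n) where
  toFun a := ObjectProperty.homMk (rightMul a)
  invFun f := ⟨(app f.hom 0 (genOne (add_zero 0))).1,
    (congrArg (_ ∈ 𝒜 ·) (zero_add n)).mp (app f.hom 0 (genOne (add_zero 0))).2.1⟩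
  left_inv _ := Subtype.ext (one_mul _)
  right_inv _ := ObjectProperty.hom_ext _
    (regular_hom_ext (add_zero 0) (Subtype.ext (one_mul _)))
  map_add' a b := ObjectProperty.hom_ext _
    (regular_hom_ext (add_zero 0) (Subtype.ext (mul_add 1 (a : Λ) b)))

lemma rightMulEquiv_symm_injective {n : ℤ} {f g : regularFG 𝒜 0 ⟶ regularFG 𝒜 n}
    (h : ((rightMulEquiv 𝒜 n).symm f : Λ) = (rightMulEquiv 𝒜 n).symm g) : f = g :=
  (rightMulEquiv 𝒜 n).symm.injective (Subtype.ext h)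

lemma app_mem_twoSided (he : e ∈ 𝒜 0) (hee : e * e = e) {t n : ℤ}
    (f : ofLeftIdeal 𝒜 (Ideal.span {e}) t ⟶ regular 𝒜 n) (j : ℤ)
    (z : (ofLeftIdeal 𝒜 (Ideal.span {e}) t).X j) : (app f j z).1 ∈ twoSided e := by
  have heI := Ideal.mem_span_singleton_self e
  have hI := fun z => mul_eq_of_mem_span hee (z := z)
  have hfz : (app f j z).1 = z.1 * (app f (-t) (gen he heI (add_neg_cancel t))).1 :=
    congrArg (fun q : ofLeftIdeal 𝒜 (Ideal.span {e}) t ⟶ regular 𝒜 n => (app q j z).1)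
      (ofElem_app_gen he heI hI (add_neg_cancel t) f).symm
  rw [hfz, ← hI z.1 z.2.2]
  exact mul_mem_twoSided _ _

lemma symm_mem_twoSided_of_mem_factorsThrough {n : ℤ} {f : regularFG 𝒜 0 ⟶ regularFG 𝒜 n}
    (hf : f ∈ factorsThrough (leftIdealFG he hee) (regularFG 𝒜 0) (regularFG 𝒜 n)) :
    ((rightMulEquiv 𝒜 n).symm f : Λ) ∈ twoSided e := by
  induction hf using AddSubgroup.closure_induction with
  | mem f hf =>
    obtain ⟨t, g, x, rfl⟩ := hf
    exact app_mem_twoSided he hee x.hom _ _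
  | zero => exact zero_mem (twoSided e)
  | add f g _ _ hf hg => exact add_mem hf hg
  | neg f _ hf => exact neg_mem hf

lemma rightMulEquiv_mul_mem_factorsThrough {i j n : ℤ} (h : i + j = n) (b : 𝒜 i) (c : 𝒜 j)
    (hbec : (b : Λ) * e * c ∈ 𝒜 n) : rightMulEquiv 𝒜 n ⟨b * e * c, hbec⟩ ∈
      factorsThrough (leftIdealFG he hee) (regularFG 𝒜 0) (regularFG 𝒜 n) := by
  have hbe : (b : Λ) * e ∈ 𝒜 (0 + i) :=
    (congrArg (_ ∈ 𝒜 ·) (by lia)).mp (SetLike.mul_mem_graded b.2 he)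
  have hc : (c : Λ) ∈ 𝒜 (-i + n) := (congrArg (_ ∈ 𝒜 ·) (by lia)).mp c.2
  have heI := Ideal.mem_span_singleton_self e
  have hcomp : rightMulEquiv 𝒜 n ⟨b * e * c, hbec⟩ =
      ObjectProperty.homMk (Y := leftIdealFG he hee i) (ofElem ⊤ (add_zero 0)
        (X := ofLeftIdeal 𝒜 (Ideal.span {e}) i) ⟨b * e, hbe, Ideal.mul_mem_left _ _ heI⟩) ≫
      ObjectProperty.homMk (ofElem (Ideal.span {e}) (add_neg_cancel i)
        (X := regular 𝒜 n) ⟨(c : Λ), hc, trivial⟩) :=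
    rightMulEquiv_symm_injective (mul_assoc 1 ((b : Λ) * e) c).symm
  rw [hcomp]
  exact comp_mem_factorsThrough _ _

lemma rightMulEquiv_decompose_mem_factorsThrough (n : ℤ) {a : Λ} (ha : a ∈ twoSided e) :
    rightMulEquiv 𝒜 n (DirectSum.decompose 𝒜 a n) ∈
      factorsThrough (leftIdealFG he hee) (regularFG 𝒜 0) (regularFG 𝒜 n) := by
  let K : AddSubgroup Λ :=
    (factorsThrough (leftIdealFG he hee) (regularFG 𝒜 0) (regularFG 𝒜 n)).comap
      ((rightMulEquiv 𝒜 n).toAddMonoidHom.comp ((DFinsupp.evalAddMonoidHom n).comp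
        (DirectSum.decomposeAddEquiv 𝒜).toAddMonoidHom))
  suffices hK : ∀ b c : Λ, b * e * c ∈ K from
    twoSided_induction (p := (· ∈ K)) (zero_mem K) (fun _ _ => add_mem) hK ha
  intro b c
  induction b using DirectSum.Decomposition.inductionOn 𝒜 with
  | zero => simp only [zero_mul, zero_mem]
  | add b b' hb hb' => simpa only [add_mul] using add_mem hb hb'
  | @homogeneous i b =>
  induction c using DirectSum.Decomposition.inductionOn 𝒜 with
  | zero => simp only [mul_zero, zero_mem]
  | add c c' hc hc' => simpa only [mul_add] using add_mem hc hc'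
  | @homogeneous j c =>
  have hbec : (b : Λ) * e * c ∈ 𝒜 (i + j) :=
    SetLike.mul_mem_graded ((congrArg (_ ∈ 𝒜 ·) (add_zero i)).mp (SetLike.mul_mem_graded b.2 he))
      c.2
  change rightMulEquiv 𝒜 n (DirectSum.decompose 𝒜 ((b : Λ) * e * c) n) ∈
    factorsThrough (leftIdealFG he hee) (regularFG 𝒜 0) (regularFG 𝒜 n)
  by_cases h : i + j = n
  · subst h
    have hself : DirectSum.decompose 𝒜 ((b : Λ) * e * c) (i + j) = ⟨_, hbec⟩ :=
      Subtype.ext (DirectSum.decompose_of_mem_same 𝒜 hbec)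
    rw [hself]
    exact rightMulEquiv_mul_mem_factorsThrough he hee rfl b c hbec
  · have hzero : DirectSum.decompose 𝒜 ((b : Λ) * e * c) n = 0 :=
      Subtype.ext (DirectSum.decompose_of_mem_ne 𝒜 hbec h)
    rw [hzero, map_zero]
    exact zero_mem _

lemma rightMulEquiv_mem_factorsThrough_iff {n : ℤ} (a : 𝒜 n) :
    rightMulEquiv 𝒜 n a ∈
        factorsThrough (leftIdealFG he hee) (regularFG 𝒜 0) (regularFG 𝒜 n) ↔
      (a : Λ) ∈ twoSided e := by
  refine ⟨fun h => ?_, fun h => ?_⟩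
  · rw [← (rightMulEquiv 𝒜 n).symm_apply_apply a]
    exact symm_mem_twoSided_of_mem_factorsThrough he hee h
  · have := rightMulEquiv_decompose_mem_factorsThrough he hee n h
    rwa [DirectSum.decompose_coe, DirectSum.of_eq_same] at this

variable [IsNoetherianRing Λ]

attribute [local instance] Abelian.hasFiniteBiproducts

lemma hasPrecover_leftIdeal {X : GrMod 𝒜} (hX : isFG 𝒜 X) :
    HasPrecover (fun n => (leftIdealFG he hee n).obj) X := by
  obtain ⟨n, d, x, hex, hx⟩ := exists_fin_generators_of_act_eq hX he
  refine ⟨n, fun i => -d i, fun i => ofElem _ (neg_add_cancel (d i)) (x i), fun t f => ?_⟩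
  have heI := Ideal.mem_span_singleton_self e
  have hI := fun z => mul_eq_of_mem_span hee (z := z)
  have ht := add_neg_cancel t
  obtain ⟨a, ha⟩ := hx (-t) (app f (-t) (gen he heI ht)) (act_app_gen he heI hI _ f)
  have hae (i) : (a i : Λ) * e ∈ 𝒜 (-t + -d i) :=
    (congrArg (_ ∈ 𝒜 ·) (by lia)).mp (SetLike.mul_mem_graded (a i).2 he)
  refine ⟨fun i => ofElem _ ht (X := ofLeftIdeal 𝒜 (Ideal.span {e}) (-d i))
    ⟨a i * e, hae i, Ideal.mul_mem_left _ _ heI⟩, ?_⟩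
  rw [← ofElem_app_gen he heI hI ht f, ha, ofElem_sum]
  refine Finset.sum_congr rfl fun i _ => ?_
  refine Eq.trans (congrArg _ ?_) (ofElem_comp _ _ _ _).symm
  refine Eq.trans ?_ (ofElem_app _ _ _ _ _).symm
  conv_lhs => rw [← hex i, ← X.mul_act (zero_add _) (sub_add_cancel (-t) (d i)) (by lia)]
  refine X.act_congr ?_ _ _ ?_ (x i)
  · lia
  · rfl

lemma isQuotientSetting [Module.Finite k (Λ ⧸ twoSided e)] (hΛ : HasFiniteGlobalDimension Λ) :
    IsQuotientSetting k (leftIdealFG he hee) (regularFG 𝒜) where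
  projective_left n := projective_ofLeftIdeal he (Ideal.mem_span_singleton_self e)
    (fun _ => mul_eq_of_mem_span hee) n
  projective_right := projective_regular
  exists_epi _ hX := exists_epi_regular hX
  hasPrecover _ hX := hasPrecover_leftIdeal he hee hX
  finite_hom _ hX h s := finite_hom_regular hX he (fun j y =>
    (app_ofElem_gen he (Ideal.mem_span_singleton_self e) (neg_add_cancel j) y).symm.trans
      (congrArg (fun f => app f j _) (h (-j) (ofElem _ (neg_add_cancel j) y)))) s
  finite_projectiveDimension _ hX := hΛ.imp' (· + 1) fun d hd =>
    hasProjectiveDimensionLT_of_total d hX (hd _)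

end Quotient

end GrMod

section GradedQuotient

variable {k Λ : Type u} [Field k] [Ring Λ] [Algebra k Λ] [IsNoetherianRing Λ]
  {𝒜 : ℤ → Submodule k Λ} [GradedAlgebra 𝒜] {e : Λ} [Module.Finite k (Λ ⧸ twoSided e)]
  (he : e ∈ 𝒜 0) (hee : e * e = e) (hΛ : HasFiniteGlobalDimension Λ)

include hΛ

theorem homFinite_gradedQuotient :
    HomFinite k (VerdierQuotient (.ofObj (leftIdealGr e he hee))) :=
  (GrMod.isQuotientSetting he hee hΛ).homFinite

theorem map_rightMulGr_surjective (n : ℤ) : Function.Surjective fun a : 𝒜 n =>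
    (toVerdierQuotient (.ofObj (leftIdealGr e he hee))).map (rightMulGr a) :=
  ((GrMod.isQuotientSetting he hee hΛ).map_surjective 0 n).comp
    (GrMod.rightMulEquiv 𝒜 n).surjective

theorem map_rightMulGr_eq_zero_iff {n : ℤ} (a : 𝒜 n) :
    (toVerdierQuotient (.ofObj (leftIdealGr e he hee))).map (rightMulGr a) = 0 ↔
      (a : Λ) ∈ twoSided e :=
  ((GrMod.isQuotientSetting he hee hΛ).map_eq_zero_iff (s := 0) (s' := n)
    (GrMod.rightMulEquiv 𝒜 n a)).trans (GrMod.rightMulEquiv_mem_factorsThrough_iff he hee a)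

end GradedQuotient

section RegularLocalRing

open IsLocalRing

variable {A : Type u} [CommRing A]

lemma isLocalRing_quotient_span_singleton [IsLocalRing A] {x : A} (hx : x ∈ maximalIdeal A) :
    IsLocalRing (A ⧸ Ideal.span {x}) := by
  have hne : Ideal.span {x} ≠ ⊤ :=
    ne_top_of_le_ne_top (maximalIdeal.isMaximal A).ne_top ((Ideal.span_singleton_le_iff_mem _).2 hx)
  have : Nontrivial (A ⧸ Ideal.span {x}) := Ideal.Quotient.nontrivial_iff.2 hne
  exact .of_surjective' (Ideal.Quotient.mk _) Ideal.Quotient.mk_surjective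

/- Nakayama: an element outside `m ^ 2` has a unit coefficient with respect to any generators of
`m`, so it can replace one of them. -/
lemma exists_finset_span_insert_eq_maximalIdeal [IsLocalRing A] [IsNoetherianRing A] {x : A}
    (hx : x ∈ maximalIdeal A) (hx2 : x ∉ maximalIdeal A ^ 2) :
    ∃ t : Finset A, t.card + 1 = (maximalIdeal A).spanFinrank ∧
      maximalIdeal A = Ideal.span (insert x (t : Set A)) := by
  classical
  obtain ⟨s, hs, hspan⟩ := Submodule.FG.exists_span_finset_card_eq_spanFinrank
    (IsNoetherian.noetherian (maximalIdeal A))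
  have hsm : ∀ z ∈ s, z ∈ maximalIdeal A := fun z hz => hspan ▸ Submodule.subset_span hz
  obtain ⟨f, -, hf⟩ := Submodule.mem_span_finset.1 (hspan ▸ hx : x ∈ Submodule.span A (s : Set A))
  obtain ⟨z, hz, hfz⟩ : ∃ z ∈ s, IsUnit (f z) := by
    by_contra! h
    refine hx2 (hf ▸ sum_mem fun z hz => ?_)
    rw [pow_two]
    exact Ideal.mul_mem_mul ((mem_maximalIdeal _).2 (h z hz)) (hsm z hz)
  refine ⟨s.erase z, by rw [Finset.card_erase_add_one hz, hs], le_antisymm ?_ ?_⟩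
  · have hfz_mem : f z * z ∈ Ideal.span (insert x (s.erase z : Set A)) := by
      rw [eq_sub_of_add_eq ((Finset.add_sum_erase s (fun a => f a * a) hz).trans hf)]
      exact sub_mem (Ideal.subset_span (Set.mem_insert _ _)) (sum_mem fun a ha =>
        Ideal.mul_mem_left _ _ (Ideal.subset_span (Set.mem_insert_of_mem _ ha)))
    rw [← hspan]
    refine Submodule.span_le.2 fun y hy => ?_
    rcases eq_or_ne y z with rfl | hyz
    · exact (Ideal.unit_mul_mem_iff_mem _ hfz).1 hfz_mem
    · exact Ideal.subset_span (Set.mem_insert_of_mem _ (Finset.mem_erase.2 ⟨hyz, hy⟩))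
  · exact Ideal.span_le.2 (Set.insert_subset hx fun y hy => hsm y (Finset.mem_of_mem_erase hy))

lemma spanFinrank_maximalIdeal_quotient_lt [IsLocalRing A] [IsNoetherianRing A] {x : A}
    (hx : x ∈ maximalIdeal A) (hx2 : x ∉ maximalIdeal A ^ 2) [IsLocalRing (A ⧸ Ideal.span {x})] :
    (maximalIdeal (A ⧸ Ideal.span {x})).spanFinrank < (maximalIdeal A).spanFinrank := by
  obtain ⟨t, ht, hspan⟩ := exists_finset_span_insert_eq_maximalIdeal hx hx2
  let π := Ideal.Quotient.mk (Ideal.span {x})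
  have hπx : π x = 0 := Ideal.Quotient.eq_zero_iff_mem.2 (Ideal.mem_span_singleton_self x)
  have hmax : maximalIdeal (A ⧸ Ideal.span {x}) = Ideal.span (π '' t) := by
    rw [← map_maximalIdeal_of_surjective π Ideal.Quotient.mk_surjective, hspan, Ideal.map_span,
      Set.image_insert_eq, hπx, Ideal.span_insert_zero]
  rw [hmax, ← ht, Nat.lt_succ_iff]
  calc (Ideal.span (π '' t)).spanFinrank
      ≤ (π '' t).ncard := Submodule.spanFinrank_span_le_ncard_of_finite (t.finite_toSet.image π)
    _ ≤ (t : Set A).ncard := Set.ncard_image_le t.finite_toSet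
    _ = t.card := Set.ncard_coe_finset t

lemma isRegularLocalRing_quotient [IsRegularLocalRing A] {x : A}
    (hx : x ∈ maximalIdeal A) (hx2 : x ∉ maximalIdeal A ^ 2) {c : ℕ}
    (hc : ringKrullDim A = (c + 1 : ℕ)) :
    IsRegularLocalRing (A ⧸ Ideal.span {x}) ∧ ringKrullDim (A ⧸ Ideal.span {x}) = c := by
  have := isLocalRing_quotient_span_singleton hx
  have hrank : (maximalIdeal A).spanFinrank = c + 1 := by
    have := IsRegularLocalRing.spanFinrank_maximalIdeal (R := A)
    rw [hc] at this
    exact_mod_cast this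
  have hle : ((maximalIdeal (A ⧸ Ideal.span {x})).spanFinrank : WithBot ℕ∞) ≤ c := by
    have := spanFinrank_maximalIdeal_quotient_lt hx hx2
    exact_mod_cast (by lia : (maximalIdeal (A ⧸ Ideal.span {x})).spanFinrank ≤ c)
  have hge : (c : WithBot ℕ∞) ≤ ringKrullDim (A ⧸ Ideal.span {x}) := by
    have h := ringKrullDim_le_ringKrullDim_quotSMulTop_succ hx
    rw [hc, ← Submodule.ideal_span_singleton_smul, smul_eq_mul, Ideal.mul_top] at h
    push_cast at h
    exact ENat.WithBot.add_le_add_one_right_iff.1 h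
  exact ⟨.of_spanFinrank_maximalIdeal_le _ (hle.trans hge),
    le_antisymm ((ringKrullDim_le_spanFinrank_maximalIdeal _).trans hle) hge⟩

lemma isField_of_ringKrullDim_eq_zero [IsRegularLocalRing A] (h : ringKrullDim A = 0) :
    IsField A := by
  rw [isField_iff_maximalIdeal_eq]
  refine (Submodule.spanFinrank_eq_zero_iff_eq_bot (IsNoetherian.noetherian _)).1 ?_
  have := IsRegularLocalRing.spanFinrank_maximalIdeal (R := A)
  rw [h] at this
  exact_mod_cast this

lemma exists_mem_maximalIdeal_notMem_sq_notMem_minimalPrimes [IsLocalRing A] [IsNoetherianRing A]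
    (hdim : ringKrullDim A ≠ 0) :
    ∃ x ∈ maximalIdeal A, x ∉ maximalIdeal A ^ 2 ∧ ∀ q ∈ minimalPrimes A, x ∉ q := by
  by_contra! h
  have hsub : (maximalIdeal A : Set A) ⊆
      ⋃ I ∈ insert (maximalIdeal A ^ 2) (minimalPrimes A), (I : Set A) := fun x hx => by
    by_cases hx2 : x ∈ maximalIdeal A ^ 2
    · exact Set.mem_biUnion (Set.mem_insert _ _) hx2
    · obtain ⟨q, hq, hxq⟩ := h x hx hx2
      exact Set.mem_biUnion (Set.mem_insert_of_mem _ hq) hxq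
  obtain ⟨I, hI, hle⟩ := (Ideal.subset_union_prime_finite
    ((minimalPrimes.finite_of_isNoetherianRing A).insert _) (maximalIdeal A ^ 2)
    (maximalIdeal A ^ 2) fun I hI hne _ => (hI.resolve_left hne).1.1).1 hsub
  rcases hI with rfl | hI
  · exact (maximalIdeal_sq_lt_of_ringKrullDim_ne_zero hdim).not_ge hle
  · have hmin : maximalIdeal A ∈ minimalPrimes A := by
      rwa [(maximalIdeal.isMaximal A).eq_of_le hI.1.1.ne_top hle]
    refine hdim ?_
    rw [← maximalIdeal_height_eq_ringKrullDim, Ideal.height_eq_zero_iff.2 hmin]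
    rfl

lemma isDomain_of_isPrime_span_singleton [IsLocalRing A] [IsNoetherianRing A] {x : A}
    [(Ideal.span {x}).IsPrime] (hx : x ∈ maximalIdeal A) (hmin : ∀ q ∈ minimalPrimes A, x ∉ q) :
    IsDomain A := by
  obtain ⟨q, hq, hqx⟩ := Ideal.exists_minimalPrimes_le (bot_le : ⊥ ≤ Ideal.span {x})
  have hqp := hq.1.1
  have hq0 : q = ⊥ := by
    refine Submodule.eq_bot_of_le_smul_of_le_jacobson_bot (maximalIdeal A) q
      (IsNoetherian.noetherian _) (fun y hy => ?_) (maximalIdeal_le_jacobson _)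
    obtain ⟨z, rfl⟩ := Ideal.mem_span_singleton'.1 (hqx hy)
    rw [mul_comm]
    exact Submodule.smul_mem_smul hx ((hqp.mem_or_mem hy).resolve_right (hmin q hq))
  rw [hq0] at hqp
  exact IsDomain.of_bot_isPrime A

lemma isDomain_of_isRegularLocalRing [IsRegularLocalRing A] : IsDomain A := by
  obtain ⟨c, hc⟩ : ∃ c : ℕ, ringKrullDim A = c :=
    ⟨_, (IsRegularLocalRing.spanFinrank_maximalIdeal (R := A)).symm⟩
  induction c generalizing A with
  | zero => exact (isField_of_ringKrullDim_eq_zero hc).isDomain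
  | succ c ih =>
    obtain ⟨x, hx, hx2, hmin⟩ := exists_mem_maximalIdeal_notMem_sq_notMem_minimalPrimes (A := A)
      (by rw [hc]; exact_mod_cast Nat.succ_ne_zero c)
    obtain ⟨_, hdim⟩ := isRegularLocalRing_quotient hx hx2 hc
    have := (Ideal.Quotient.isDomain_iff_prime (Ideal.span {x})).1 (ih hdim)
    exact isDomain_of_isPrime_span_singleton hx hmin

end RegularLocalRing

section ChangeOfRings

variable {A : Type u} [CommRing A]

/-- Reduction of a free module modulo `x`. -/
def quotSMulTopFinsuppEquiv (x : A) (ι : Type u) :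
    QuotSMulTop x (ι →₀ A) ≃ₗ[A] (ι →₀ A ⧸ Ideal.span {x}) := by
  classical
  exact QuotSMulTop.equivQuotTensor x (ι →₀ A) ≪≫ₗ TensorProduct.finsuppScalarRight A A _ ι

section

variable {x : A} (hreg : IsSMulRegular A x) {M : Type u} [AddCommGroup M] [Module A M]
  [Module (A ⧸ Ideal.span {x}) M] [IsScalarTower A (A ⧸ Ideal.span {x}) M]

include hreg

lemma hasProjectiveDimensionLE_finsupp_quotient (ι : Type u) :
    HasProjectiveDimensionLE (ModuleCat.of A (ι →₀ A ⧸ Ideal.span {x})) 1 := by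
  have hF : HasProjectiveDimensionLT (ModuleCat.of A (ι →₀ A)) 1 :=
    projective_iff_hasProjectiveDimensionLT_one.1 ((IsProjective.iff_projective _).1 inferInstance)
  have hQ : HasProjectiveDimensionLE (ModuleCat.of A (QuotSMulTop x (ι →₀ A))) 1 :=
    (IsSMulRegular.finsupp hreg).smulShortComplex_shortExact (M := ModuleCat.of A (ι →₀ A))
      |>.hasProjectiveDimensionLT_X₃ 1 hF
        (hasProjectiveDimensionLT_of_ge (ModuleCat.of A (ι →₀ A)) 1 2 (by lia))
  exact hasProjectiveDimensionLT_of_iso (quotSMulTopFinsuppEquiv x ι).toModuleIso 2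

lemma hasProjectiveDimensionLE_one_of_projective_quotient
    [Module.Projective (A ⧸ Ideal.span {x}) M] :
    HasProjectiveDimensionLE (ModuleCat.of A M) 1 := by
  obtain ⟨s, hs⟩ := Module.projective_def'.1 ‹Module.Projective (A ⧸ Ideal.span {x}) M›
  let π : (M →₀ A ⧸ Ideal.span {x}) →ₗ[A ⧸ Ideal.span {x}] M := Finsupp.linearCombination _ id
  have := hasProjectiveDimensionLE_finsupp_quotient hreg M
  exact Retract.hasProjectiveDimensionLT
    { i := ModuleCat.ofHom (s.restrictScalars A)
      r := ModuleCat.ofHom (π.restrictScalars A)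
      retract := ModuleCat.hom_ext (LinearMap.ext fun m => LinearMap.congr_fun hs m) } 2

lemma hasProjectiveDimensionLE_succ_of_quotient (n : ℕ)
    (hM : HasProjectiveDimensionLE (ModuleCat.of (A ⧸ Ideal.span {x}) M) n) :
    HasProjectiveDimensionLE (ModuleCat.of A M) (n + 1) := by
  induction n generalizing M with
  | zero =>
    have : Module.Projective (A ⧸ Ideal.span {x}) M := (IsProjective.iff_projective _).2
      (projective_iff_hasProjectiveDimensionLT_one.2 hM)
    exact hasProjectiveDimensionLE_one_of_projective_quotient hreg
  | succ n ih =>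
    let π : (M →₀ A ⧸ Ideal.span {x}) →ₗ[A ⧸ Ideal.span {x}] M := Finsupp.linearCombination _ id
    have hπ : Function.Surjective π := Finsupp.linearCombination_id_surjective _ M
    have : Projective (ModuleCat.of (A ⧸ Ideal.span {x}) (M →₀ A ⧸ Ideal.span {x})) :=
      (IsProjective.iff_projective _).1 inferInstance
    have hK := ih (((LinearMap.shortExact_shortComplexKer hπ).hasProjectiveDimensionLT_X₃_iff n
      this).1 hM)
    have hF := hasProjectiveDimensionLE_finsupp_quotient hreg M
    exact (LinearMap.shortExact_shortComplexKer (f := π.restrictScalars A) hπ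
      ).hasProjectiveDimensionLT_X₃ (n + 2) hK (hasProjectiveDimensionLT_of_ge _ 2 _ (by lia))

end

lemma hasProjectiveDimensionLE_of_quotSMulTop [IsLocalRing A] [IsNoetherianRing A] {x : A}
    (hx : x ∈ IsLocalRing.maximalIdeal A) (hreg : IsSMulRegular A x) (K : ModuleCat.{u} A)
    [Module.Finite A K] (hregK : IsSMulRegular K x) (c : ℕ)
    (hK : HasProjectiveDimensionLE (ModuleCat.of (A ⧸ Ideal.span {x}) (QuotSMulTop x K)) c) :
    HasProjectiveDimensionLE K c := by
  have h := hasProjectiveDimensionLE_succ_of_quotient hreg c hK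
  rw [← projectiveDimension_le_iff,
    ModuleCat.projectiveDimension_quotSMulTop_eq_succ_of_isSMulRegular K x hregK hx] at h
  push_cast at h
  exact (projectiveDimension_le_iff _ _).1 (ENat.WithBot.add_le_add_one_right_iff.1 h)

theorem hasProjectiveDimensionLE_of_isRegularLocalRing [IsRegularLocalRing A] {c : ℕ}
    (hc : ringKrullDim A = c) (M : Type u) [AddCommGroup M] [Module A M] [Module.Finite A M] :
    HasProjectiveDimensionLE (ModuleCat.of A M) c := by
  induction c generalizing A M with
  | zero =>
    let := (isField_of_ringKrullDim_eq_zero hc).toField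
    exact projective_iff_hasProjectiveDimensionLT_one.1
      ((IsProjective.iff_projective _).1 (Module.Projective.of_free (R := A) (P := M)))
  | succ c ih =>
    have := isDomain_of_isRegularLocalRing (A := A)
    obtain ⟨x, hx, hx2⟩ := Set.exists_of_ssubset
      (IsLocalRing.maximalIdeal_sq_lt_of_ringKrullDim_ne_zero (R := A)
        (by rw [hc]; exact_mod_cast Nat.succ_ne_zero c))
    have hreg : IsSMulRegular A x := fun _ _ => mul_left_cancel₀ fun h => hx2 (h ▸ zero_mem _)
    obtain ⟨_, hdim⟩ := isRegularLocalRing_quotient hx hx2 hc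
    obtain ⟨r, f, hf⟩ := Module.Finite.exists_fin' A M
    have hF : Projective (ModuleCat.of A (Fin r → A)) :=
      (IsProjective.iff_projective _).1 inferInstance
    have hregK : IsSMulRegular (ModuleCat.of A (LinearMap.ker f)) x := fun _ _ h =>
      Subtype.ext (funext fun i => hreg (congrFun (congrArg Subtype.val h) i))
    have : Module.Finite (A ⧸ Ideal.span {x}) (QuotSMulTop x (LinearMap.ker f)) :=
      .of_restrictScalars_finite A _ _
    exact ((LinearMap.shortExact_shortComplexKer hf).hasProjectiveDimensionLT_X₃_iff c hF).2
      (hasProjectiveDimensionLE_of_quotSMulTop hx hreg _ hregK c (ih hdim _))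

end ChangeOfRings

section ExtTorsion

open Abelian

variable {R : Type u} [CommRing R]

/-- A single element of `S` annihilates `Ext^n(X, Y)`. For finite modules over a noetherian ring
this says that the localization of `Ext^n(X, Y)` at `S` vanishes. -/
def ExtTorsion (S : Submonoid R) (X Y : ModuleCat.{u} R) (n : ℕ) : Prop :=
  ∃ s ∈ S, ∀ α : Ext X Y n, s • α = 0

namespace ExtTorsion

variable {S T : Submonoid R} {X X' Y Y' : ModuleCat.{u} R} {n : ℕ}

lemma mono (hST : S ≤ T) (h : ExtTorsion S X Y n) : ExtTorsion T X Y n :=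
  let ⟨s, hs, h⟩ := h
  ⟨s, hST hs, h⟩

lemma of_subsingleton [Subsingleton (Ext X Y n)] : ExtTorsion S X Y n :=
  ⟨1, one_mem _, fun _ => Subsingleton.elim _ _⟩

lemma of_annihilator {r : R} (hr : r ∈ S) (h : ∀ x : X, r • x = 0) : ExtTorsion S X Y n := by
  refine ⟨r, hr, fun α => ?_⟩
  have h0 : r • 𝟙 X = 0 := ModuleCat.hom_ext (LinearMap.ext h)
  rw [← Ext.mk₀_id_comp α, ← Ext.smul_comp, ← Ext.mk₀_smul, h0, Ext.mk₀_zero, Ext.zero_comp]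

lemma of_iso (e : X ≅ X') (h : ExtTorsion S X' Y n) : ExtTorsion S X Y n := by
  obtain ⟨s, hs, h⟩ := h
  refine ⟨s, hs, fun α => ?_⟩
  rw [← Ext.mk₀_id_comp α, ← e.hom_inv_id, ← Ext.mk₀_comp_mk₀_assoc, ← Ext.comp_smul, h,
    Ext.comp_zero]

lemma covariant_X₃ {T : ShortComplex (ModuleCat.{u} R)} (hT : T.ShortExact)
    (h₂ : ExtTorsion S X T.X₂ n) (h₁ : ExtTorsion S X T.X₁ (n + 1)) : ExtTorsion S X T.X₃ n := by
  obtain ⟨s, hs, h₂⟩ := h₂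
  obtain ⟨t, ht, h₁⟩ := h₁
  refine ⟨s * t, mul_mem hs ht, fun α => ?_⟩
  obtain ⟨β, hβ⟩ := Ext.covariant_sequence_exact₃ X hT (t • α) rfl
    (by rw [Ext.smul_comp, h₁])
  rw [mul_smul, ← hβ, ← Ext.smul_comp, h₂, Ext.zero_comp]

lemma contravariant_X₂ {T : ShortComplex (ModuleCat.{u} R)} (hT : T.ShortExact)
    (h₁ : ExtTorsion S T.X₁ Y n) (h₃ : ExtTorsion S T.X₃ Y n) : ExtTorsion S T.X₂ Y n := by
  obtain ⟨s, hs, h₁⟩ := h₁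
  obtain ⟨t, ht, h₃⟩ := h₃
  refine ⟨t * s, mul_mem ht hs, fun α => ?_⟩
  obtain ⟨β, hβ⟩ := Ext.contravariant_sequence_exact₂ hT Y (s • α)
    (by rw [Ext.comp_smul, h₁])
  rw [mul_smul, ← hβ, ← Ext.comp_smul, h₃, Ext.comp_zero]

lemma contravariant_X₁ {T : ShortComplex (ModuleCat.{u} R)} (hT : T.ShortExact)
    (h₂ : ExtTorsion S T.X₂ Y n) (h₃ : ExtTorsion S T.X₃ Y (n + 1)) : ExtTorsion S T.X₁ Y n := by
  obtain ⟨s, hs, h₂⟩ := h₂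
  obtain ⟨t, ht, h₃⟩ := h₃
  refine ⟨s * t, mul_mem hs ht, fun α => ?_⟩
  obtain ⟨β, hβ⟩ := Ext.contravariant_sequence_exact₁ hT Y (t • α) (add_comm 1 n)
    (by rw [Ext.comp_smul, h₃])
  rw [mul_smul, ← hβ, ← Ext.comp_smul, h₂, Ext.comp_zero]

lemma of_factor (f : Y ⟶ Y') (g : Y' ⟶ Y) {r : R} (hr : r ∈ S) (hfg : f ≫ g = r • 𝟙 Y)
    (h : ExtTorsion S X Y' n) : ExtTorsion S X Y n := by
  obtain ⟨s, hs, h⟩ := h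
  refine ⟨s * r, mul_mem hs hr, fun α => ?_⟩
  rw [mul_smul, Ext.smul_eq_comp_mk₀ α r, ← hfg, ← Ext.mk₀_comp_mk₀,
    ← Ext.comp_assoc_of_second_deg_zero, ← Ext.smul_comp, h, Ext.zero_comp]

lemma pi {Y : Type u} [AddCommGroup Y] [Module R Y]
    (h : ExtTorsion S X (ModuleCat.of R Y) n) (r : ℕ) :
    ExtTorsion S X (ModuleCat.of R (Fin r → Y)) n := by
  classical
  obtain ⟨s, hs, h⟩ := h
  refine ⟨s, hs, fun α => ?_⟩
  have hsum : 𝟙 (ModuleCat.of R (Fin r → Y)) = ∑ i : Fin r,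
      ModuleCat.ofHom (LinearMap.proj (R := R) (φ := fun _ : Fin r => Y) i) ≫
        ModuleCat.ofHom (LinearMap.single R (fun _ : Fin r => Y) i) := by
    ext v
    simp [ModuleCat.hom_sum]
  rw [← Ext.comp_mk₀_id α, hsum, Ext.mk₀_sum, Ext.comp_sum, Finset.smul_sum]
  refine Finset.sum_eq_zero fun i _ => ?_
  rw [← Ext.mk₀_comp_mk₀, ← Ext.comp_assoc_of_second_deg_zero, ← Ext.smul_comp, h,
    Ext.zero_comp]

end ExtTorsion

variable {S : Submonoid R} [IsNoetherianRing R]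

lemma exists_factor_of_projective_localizedModule (K : ModuleCat.{u} R)
    [Module.Finite R K] (hK : Projective (K.localizedModule S)) :
    ∃ s ∈ S, ∃ (r : ℕ) (f : K →ₗ[R] (Fin r → R)) (g : (Fin r → R) →ₗ[R] K),
      g ∘ₗ f = s • LinearMap.id := by
  have : Module.FinitePresentation R K := Module.finitePresentation_of_finite R K
  obtain ⟨r, g, hg⟩ := Module.Finite.exists_fin' R K
  let ι := K.localizedModuleMkLinearMap S
  let κ := LocalizedModule.mkLinearMap S (Fin r → R)
  let γ := IsLocalizedModule.mapExtendScalars S κ ι (Localization S) g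
  have hγ : Function.Surjective γ := IsLocalizedModule.map_surjective S κ ι g hg
  have hγκ (x : Fin r → R) : γ (κ x) = ι (g x) := IsLocalizedModule.map_apply S κ ι g x
  have : Module.Projective (Localization S) (K.localizedModule S) :=
    (IsProjective.iff_projective _).2 hK
  obtain ⟨σ, hσ⟩ := Module.projective_lifting_property γ LinearMap.id hγ
  obtain ⟨f, s, hf⟩ := Module.FinitePresentation.exists_lift_of_isLocalizedModule S κ
    (σ.restrictScalars R ∘ₗ ι)
  have hgf : ι ∘ₗ (g ∘ₗ f) = ι ∘ₗ ((s : R) • LinearMap.id) := LinearMap.ext fun x =>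
    calc ι (g (f x)) = γ (κ (f x)) := (hγκ _).symm
      _ = γ ((s : R) • σ (ι x)) := congrArg γ (LinearMap.congr_fun hf x)
      _ = (s : R) • γ (σ (ι x)) := LinearMap.map_smul_of_tower γ (s : R) _
      _ = (s : R) • ι x := congrArg _ (LinearMap.congr_fun hσ (ι x))
      _ = ι ((s : R) • x) := (map_smul ι _ _).symm
  obtain ⟨t, ht⟩ := Module.Finite.exists_smul_of_comp_eq_of_isLocalizedModule S ι _ _ hgf
  exact ⟨t * s, mul_mem t.2 s.2, r, f, (t : R) • g, by
    rw [LinearMap.smul_comp, mul_smul]; exact ht⟩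

lemma extTorsion_of_hasProjectiveDimensionLE_localizedModule {X : ModuleCat.{u} R}
    (h : ∀ j, ExtTorsion S X (ModuleCat.of R R) (j + 1)) (K : ModuleCat.{u} R) [Module.Finite R K]
    {c : ℕ} (hK : HasProjectiveDimensionLE (K.localizedModule S) c) (j : ℕ) :
    ExtTorsion S X K (j + 1) := by
  induction c generalizing K j with
  | zero =>
    obtain ⟨s, hs, r, f, g, hfg⟩ := exists_factor_of_projective_localizedModule K
      (projective_iff_hasProjectiveDimensionLT_one.2 hK)
    exact ((h j).pi r).of_factor (ModuleCat.ofHom f) (ModuleCat.ofHom g) hs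
      (ModuleCat.hom_ext hfg)
  | succ c ih =>
    obtain ⟨r, f, hf⟩ := Module.Finite.exists_fin' R K
    have hT := LinearMap.shortExact_shortComplexKer hf
    have hF : Projective (ModuleCat.of R (Fin r → R)) :=
      (IsProjective.iff_projective _).1 inferInstance
    have hker := ((hT.map_of_exact (ModuleCat.localizedModuleFunctor S)
      ).hasProjectiveDimensionLT_X₃_iff c
        ((ModuleCat.localizedModuleFunctor.{u} S).projective_obj_of_projective hF)).1 hK
    exact .covariant_X₃ hT ((h j).pi r) (ih (ModuleCat.of R (LinearMap.ker f)) hker (j + 1))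

lemma exists_factor_of_extTorsion (X : ModuleCat.{u} R) [Module.Finite R X]
    (h : ∀ j, ExtTorsion S X (ModuleCat.of R R) (j + 1))
    (hS : ∀ (K : ModuleCat.{u} R) [Module.Finite R K],
      ∃ c, HasProjectiveDimensionLE (K.localizedModule S) c) :
    ∃ s ∈ S, ∃ (r : ℕ) (f : X →ₗ[R] (Fin r → R)) (g : (Fin r → R) →ₗ[R] X),
      g ∘ₗ f = s • LinearMap.id := by
  obtain ⟨r, g, hg⟩ := Module.Finite.exists_fin' R X
  have hT := LinearMap.shortExact_shortComplexKer hg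
  obtain ⟨c, hc⟩ := hS (ModuleCat.of R (LinearMap.ker g))
  obtain ⟨s, hs, hExt⟩ := extTorsion_of_hasProjectiveDimensionLE_localizedModule h _ hc 0
  obtain ⟨β, hβ⟩ := Ext.covariant_sequence_exact₃ X hT (s • Ext.mk₀ (𝟙 X)) rfl
    (by rw [Ext.smul_comp]; exact hExt _)
  obtain ⟨f, rfl⟩ := (Ext.mk₀_bijective _ _).2 β
  rw [Ext.mk₀_comp_mk₀, ← Ext.mk₀_smul] at hβ
  exact ⟨s, hs, r, f.hom, g, congrArg ModuleCat.Hom.hom ((Ext.mk₀_bijective _ _).1 hβ)⟩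

end ExtTorsion

section Depth

open Abelian Module Pointwise

variable {R : Type u} [CommRing R] {m : Ideal R}

lemma smul_top_ne_top_of_quotSMulTop {M : Type u} [AddCommGroup M] [Module R M] {x : R}
    (hx : x ∈ m) (hM : m • (⊤ : Submodule R M) ≠ ⊤) :
    m • (⊤ : Submodule R (QuotSMulTop x M)) ≠ ⊤ := by
  contrapose! hM
  have hle : x • (⊤ : Submodule R M) ≤ m • ⊤ := by
    rw [← Submodule.ideal_span_singleton_smul]
    exact Submodule.smul_mono_left ((Ideal.span_singleton_le_iff_mem _).2 hx)
  have h := congrArg (Submodule.comap (Submodule.mkQ (x • (⊤ : Submodule R M)))) hM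
  rwa [← Submodule.range_mkQ, ← Submodule.map_top, ← Submodule.map_smul'',
    Submodule.comap_map_mkQ, Submodule.comap_map_mkQ, sup_eq_right.2 hle, sup_top_eq] at h

variable [m.IsMaximal] [IsNoetherianRing R]

variable (m) in
lemma exists_injective_or_exists_isSMulRegular (M : Type u) [AddCommGroup M] [Module R M]
    [Module.Finite R M] :
    (∃ f : R ⧸ m →ₗ[R] M, Function.Injective f) ∨ ∃ x ∈ m, IsSMulRegular M x := by
  by_contra! h
  have hsub : (m : Set R) ⊆ ⋃ p ∈ associatedPrimes R M, (p : Set R) := by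
    rw [biUnion_associatedPrimes_eq_compl_regular]
    exact fun x hx => h.2 x hx
  obtain ⟨p, hp, hle⟩ := (m.subset_union_prime_finite (f := id) (associatedPrimes.finite R M) 0 0
    fun _ h _ _ => h.isPrime).1 hsub
  obtain rfl := (inferInstance : m.IsMaximal).eq_of_le hp.isPrime.ne_top hle
  obtain ⟨-, f, hf⟩ := (isAssociatedPrime_iff_exists_injective_linearMap ..).1 hp
  exact h.1 f hf

/- Dividing out a nonzerodivisor raises the projective dimension by at most one and lowers the
dimension of the support; this stops when `m` is an associated prime. -/
lemma exists_injective_residue_of_supportDim_lt {n c : ℕ} (M : Type u) [AddCommGroup M]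
    [Module R M] [Module.Finite R M] (hM : m • (⊤ : Submodule R M) ≠ ⊤) (hdim : supportDim R M < n)
    (hc : HasProjectiveDimensionLE (ModuleCat.of R M) c) :
    ∃ (L : Type u) (_ : AddCommGroup L) (_ : Module R L) (_ : Module.Finite R L)
      (f : R ⧸ m →ₗ[R] L),
      Function.Injective f ∧ HasProjectiveDimensionLT (ModuleCat.of R L) (c + n) := by
  induction n generalizing M c with
  | zero =>
    have := (supportDim_eq_bot_iff_subsingleton R M).1 ((WithBot.lt_zero_iff_eq_bot _).1 hdim)
    exact (hM (Subsingleton.elim _ _)).elim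
  | succ n ih =>
    obtain ⟨f, hf⟩ | ⟨x, hx, hreg⟩ := exists_injective_or_exists_isSMulRegular m M
    · exact ⟨M, _, _, ‹_›, f, hf, hasProjectiveDimensionLT_of_ge _ (c + 1) _ (by lia)⟩
    have hdimQ : supportDim R (QuotSMulTop x M) < n := ENat.WithBot.add_one_le_natCast_iff.1
      ((supportDim_quotSMulTop_succ_le_of_notMem_minimalPrimes
        fun _ => hreg.notMem_of_mem_minimalPrimes).trans (ENat.WithBot.lt_add_one_iff.1 hdim))
    have hpd : HasProjectiveDimensionLE (ModuleCat.of R (QuotSMulTop x M)) (c + 1) :=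
      (IsSMulRegular.smulShortComplex_shortExact (M := ModuleCat.of R M) hreg
        ).hasProjectiveDimensionLT_X₃ (c + 1) hc
        (hasProjectiveDimensionLT_of_ge (ModuleCat.of R M) (c + 1) _ (by lia))
    have hL := ih (QuotSMulTop x M) (smul_top_ne_top_of_quotSMulTop hx hM) hdimQ hpd
    rwa [add_assoc, add_comm 1 n] at hL

variable (m) in
lemma exists_injective_residue {d : ℕ} (hd : ringKrullDim R = d) :
    ∃ (L : Type u) (_ : AddCommGroup L) (_ : Module R L) (_ : Module.Finite R L)
      (f : R ⧸ m →ₗ[R] L),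
      Function.Injective f ∧ HasProjectiveDimensionLE (ModuleCat.of R L) d := by
  have hdim : supportDim R R < (d + 1 : ℕ) := by
    rw [supportDim_self_eq_ringKrullDim, hd]
    exact_mod_cast Nat.lt_succ_self d
  have hR : HasProjectiveDimensionLE (ModuleCat.of R R) 0 :=
    projective_iff_hasProjectiveDimensionLT_one.1 ((IsProjective.iff_projective _).1 inferInstance)
  simpa only [zero_add] using exists_injective_residue_of_supportDim_lt (m := m) R
    (by simpa using (inferInstance : m.IsMaximal).ne_top) hdim hR

namespace ExtTorsion

variable {Y : ModuleCat.{u} R} {n : ℕ}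

lemma of_devissage {S : Submonoid R}
    (h : ∀ p : PrimeSpectrum R, ExtTorsion S (ModuleCat.of R (R ⧸ p.1)) Y n)
    (X : Type u) [AddCommGroup X] [Module R X] [hX : Module.Finite R X] :
    ExtTorsion S (ModuleCat.of R X) Y n := by
  induction hX using IsNoetherianRing.induction_on_isQuotientEquivQuotientPrime R with
  | subsingleton X => exact of_annihilator (one_mem _) fun x => Subsingleton.elim (α := X) _ _
  | quotient X p e => exact (h p).of_iso e.toModuleIso
  | exact X₁ X₂ X₃ f g hf hg hfg h₁ h₃ =>
    exact contravariant_X₂ (ModuleCat.shortComplex_shortExact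
      (ModuleCat.shortComplexOfCompEqZero f g hfg.linearMap_comp_eq_zero) hfg hf hg) h₁ h₃

lemma of_quotSMulTop {X : ModuleCat.{u} R} [Module.Finite R X] [Module.Finite R Y] {x : R}
    (hx : x ∈ m) (hreg : IsSMulRegular X x)
    (h : ExtTorsion m.primeCompl (ModuleCat.of R (QuotSMulTop x X)) Y (n + 1)) :
    ExtTorsion m.primeCompl X Y n := by
  obtain ⟨r, hr, h⟩ := h
  obtain ⟨a, c, hc, ha⟩ := (inferInstance : m.IsMaximal).exists_inv hr
  have hle : (⊤ : Submodule R (Ext X Y n)) ≤ m • ⊤ := fun α _ => by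
    obtain ⟨β, hβ⟩ : ∃ β : Ext X Y n, (Ext.mk₀ (x • 𝟙 X)).comp β (zero_add n) = r • α :=
      Ext.contravariant_sequence_exact₁ hreg.smulShortComplex_shortExact Y
        (r • α) (add_comm 1 n) ((Ext.comp_smul _ _ _ _).trans (h _))
    rw [Ext.mk₀_smul, Ext.smul_comp, Ext.mk₀_id_comp] at hβ
    have hα : α = c • α + x • a • β := by
      rw [smul_comm x a, hβ, ← mul_smul, ← add_smul, add_comm, ha, one_smul]
    rw [hα]
    exact add_mem (Submodule.smul_mem_smul hc trivial) (Submodule.smul_mem_smul hx trivial)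
  obtain ⟨t, ht, ht'⟩ := Submodule.exists_sub_one_mem_and_smul_eq_zero_of_fg_of_le_smul m _
    Module.Finite.fg_top hle
  refine ⟨t, fun htm => ?_, fun α => ht' α trivial⟩
  refine (Ideal.ne_top_iff_one m).1 (inferInstance : m.IsMaximal).ne_top ?_
  simpa using sub_mem htm ht

lemma of_residue_of_succ [Module.Finite R Y]
    (hres : ExtTorsion m.primeCompl (ModuleCat.of R (R ⧸ m)) Y n)
    (hsucc : ∀ (X : Type u) [AddCommGroup X] [Module R X] [Module.Finite R X],
      ExtTorsion m.primeCompl (ModuleCat.of R X) Y (n + 1))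
    (X : Type u) [AddCommGroup X] [Module R X] [Module.Finite R X] :
    ExtTorsion m.primeCompl (ModuleCat.of R X) Y n := by
  refine of_devissage (fun p => ?_) X
  by_cases hpm : p.1 ≤ m
  · rcases hpm.eq_or_lt with h | h
    · exact h ▸ hres
    · obtain ⟨x, hxm, hxp⟩ := Set.exists_of_ssubset h
      have hreg : IsSMulRegular (R ⧸ p.1) x := fun v w hvw => by
        have := p.2
        simp only [Algebra.smul_def] at hvw
        exact mul_left_cancel₀ (mt Ideal.Quotient.eq_zero_iff_mem.1 hxp) hvw
      exact of_quotSMulTop (X := ModuleCat.of R (R ⧸ p.1)) hxm hreg (hsucc _)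
  · obtain ⟨r, hrp, hrm⟩ := Set.not_subset.1 hpm
    refine of_annihilator (r := r) hrm fun x => ?_
    rw [Algebra.smul_def, Ideal.Quotient.algebraMap_eq, Ideal.Quotient.eq_zero_iff_mem.2 hrp,
      zero_mul]

lemma of_ringKrullDim_lt [Module.Finite R Y] {d b : ℕ} (hd : ringKrullDim R = d)
    (hb : HasInjectiveDimensionLE Y b) (hn : d < n) (X : Type u) [AddCommGroup X] [Module R X]
    [Module.Finite R X] : ExtTorsion m.primeCompl (ModuleCat.of R X) Y n := by
  obtain ⟨L, _, _, _, f, hf, hL⟩ := exists_injective_residue m hd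
  obtain ⟨j, hj⟩ : ∃ j, b < n + j := ⟨b + 1, by lia⟩
  induction j generalizing n X with
  | zero =>
    have := HasInjectiveDimensionLT.subsingleton Y (b + 1) n (by lia) (ModuleCat.of R X)
    exact of_subsingleton
  | succ j ih =>
    have hsucc (X : Type u) [AddCommGroup X] [Module R X] [Module.Finite R X] :
        ExtTorsion m.primeCompl (ModuleCat.of R X) Y (n + 1) := ih (by lia) X (by lia)
    have hT := ModuleCat.shortComplex_shortExact (ModuleCat.shortComplexOfCompEqZero f f.range.mkQ
      f.exact_map_mkQ_range.linearMap_comp_eq_zero) f.exact_map_mkQ_range hf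
      (Submodule.mkQ_surjective _)
    have := HasProjectiveDimensionLT.subsingleton (ModuleCat.of R L) (d + 1) n hn Y
    have hres : ExtTorsion m.primeCompl (ModuleCat.of R (R ⧸ m)) Y n :=
      contravariant_X₁ hT of_subsingleton (hsucc _)
    exact of_residue_of_succ hres hsucc X

lemma of_isWeaklyRegular [Module.Finite R Y]
    (h : ∀ i, n < i → ∀ (X : Type u) [AddCommGroup X] [Module R X] [Module.Finite R X],
      ExtTorsion m.primeCompl (ModuleCat.of R X) Y i) {rs : List R} (hm : ∀ r ∈ rs, r ∈ m)
    (X : Type u) [AddCommGroup X] [Module R X] [Module.Finite R X]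
    (hX : RingTheory.Sequence.IsWeaklyRegular X rs) {i : ℕ} (hi : n < i + rs.length) :
    ExtTorsion m.primeCompl (ModuleCat.of R X) Y i := by
  induction rs generalizing X i with
  | nil => exact h i hi X
  | cons x rs ih =>
    rw [RingTheory.Sequence.isWeaklyRegular_cons_iff] at hX
    rw [List.length_cons] at hi
    rw [List.forall_mem_cons] at hm
    exact of_quotSMulTop (X := ModuleCat.of R X) hm.1 hX.1 (ih hm.2 _ hX.2 (by lia))

lemma of_isMaximalCohenMacaulay [Module.Finite R Y] {b : ℕ} (hb : HasInjectiveDimensionLE Y b)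
    (X : Type u) [AddCommGroup X] [Module R X] [Module.Finite R X]
    (hX : IsMaximalCohenMacaulay m X) (j : ℕ) :
    ExtTorsion m.primeCompl (ModuleCat.of R X) Y (j + 1) := by
  obtain ⟨rs, hrs, hreg, hlen⟩ := hX
  exact of_isWeaklyRegular (fun _ hi => of_ringKrullDim_lt hlen.symm hb hi) hrs X hreg.1 (by lia)

end ExtTorsion

end Depth

section IsolatedSingularity

variable {R : Type u} [CommRing R]

lemma exists_hasProjectiveDimensionLE_localizedModule (p : Ideal R) [p.IsPrime]
    [IsRegularLocalRing (Localization.AtPrime p)] (K : ModuleCat.{u} R) [Module.Finite R K] :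
    ∃ c, HasProjectiveDimensionLE (K.localizedModule p.primeCompl) c := by
  have : Module.Finite (Localization.AtPrime p) (K.localizedModule p.primeCompl) :=
    Module.Finite.of_isLocalizedModule p.primeCompl (K.localizedModuleMkLinearMap p.primeCompl)
  exact ⟨_, hasProjectiveDimensionLE_of_isRegularLocalRing
    (IsRegularLocalRing.spanFinrank_maximalIdeal (R := Localization.AtPrime p)).symm
    (K.localizedModule p.primeCompl)⟩

lemma exists_factor_of_isMaximalCohenMacaulay [IsNoetherianRing R] {m : Ideal R} [m.IsMaximal]
    (hGor : IsGorenstein R) (hsing : IsIsolatedSingularity m) (X : Type u) [AddCommGroup X]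
    [Module R X] [Module.Finite R X] (hX : IsMaximalCohenMacaulay m X) (p : Ideal R) [p.IsPrime]
    (hpm : p < m) :
    ∃ s ∉ p, ∃ (r : ℕ) (f : X →ₗ[R] (Fin r → R)) (g : (Fin r → R) →ₗ[R] X),
      g ∘ₗ f = s • LinearMap.id := by
  obtain ⟨-, b, hb⟩ := hGor
  have := hsing p hpm.ne
  exact exists_factor_of_extTorsion (S := p.primeCompl) (ModuleCat.of R X)
    (fun j => (ExtTorsion.of_isMaximalCohenMacaulay hb X hX j).mono
      (Set.compl_subset_compl.2 hpm.le))
    fun K _ => exists_hasProjectiveDimensionLE_localizedModule p K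

end IsolatedSingularity

section FiniteDimensional

variable {k R : Type u} [Field k] [CommRing R] [Algebra k R]

section

variable {m : Ideal R} [Module.Finite k (R ⧸ m)]

lemma finite_of_le_annihilator (X : Type u) [AddCommGroup X] [Module k X] [Module R X]
    [IsScalarTower k R X] [Module.Finite R X] (hX : m ≤ Module.annihilator R X) :
    Module.Finite k X := by
  have htorsion : Module.IsTorsionBySet R X (m : Set R) :=
    fun x a => Module.mem_annihilator.1 (hX a.2) x
  let := htorsion.module
  have : IsScalarTower R (R ⧸ m) X := htorsion.isScalarTower
  have : IsScalarTower k (R ⧸ m) X := htorsion.isScalarTower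
  have : Module.Finite (R ⧸ m) X := .of_restrictScalars_finite R _ _
  exact .trans (R ⧸ m) X

lemma finite_of_pow_le_annihilator [IsNoetherianRing R] {s : ℕ} (X : Type u) [AddCommGroup X]
    [Module k X] [Module R X] [IsScalarTower k R X] [Module.Finite R X]
    (hX : m ^ s ≤ Module.annihilator R X) : Module.Finite k X := by
  induction s generalizing X with
  | zero =>
    rw [pow_zero, Ideal.one_eq_top, top_le_iff, Module.annihilator_eq_top_iff] at hX
    infer_instance
  | succ s ih =>
    let Y : Submodule R X := m ^ s • ⊤
    have hY : m ≤ Module.annihilator R Y := by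
      rw [← Submodule.annihilator_top, Submodule.le_annihilator_iff, pow_succ', mul_smul] at hX
      exact Submodule.le_annihilator_iff.2 hX
    have hquot : m ^ s ≤ Module.annihilator R (X ⧸ Y) := fun r hr => by
      refine Module.mem_annihilator.2 fun x => ?_
      obtain ⟨x, rfl⟩ := Y.mkQ_surjective x
      exact (Submodule.Quotient.mk_eq_zero _).2 (Submodule.smul_mem_smul hr trivial)
    have : Module.Finite k Y := finite_of_le_annihilator Y hY
    have : Module.Finite k (X ⧸ Y) := ih (X ⧸ Y) hquot
    exact finite_of_ker_le_range (f := Y.subtype.restrictScalars k)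
      (g := Y.mkQ.restrictScalars k) fun x hx => ⟨⟨x, (Submodule.Quotient.mk_eq_zero _).1 hx⟩, rfl⟩

end

lemma exists_pow_le_of_forall_isPrime [IsNoetherianRing R] {m J : Ideal R}
    (h : ∀ p : Ideal R, p.IsPrime → J ≤ p → m ≤ p) : ∃ s, m ^ s ≤ J := by
  refine Ideal.exists_pow_le_of_le_radical_of_fg ?_ (IsNoetherian.noetherian m)
  rw [Ideal.radical_eq_sInf]
  exact le_sInf fun p hp => h p hp.2 hp.1

end FiniteDimensional

lemma twoSided_isHomogeneous {k Λ : Type u} [Field k] [Ring Λ] [Algebra k Λ]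
    (𝒜 : ℤ → Submodule k Λ) [GradedAlgebra 𝒜] {e : Λ} (he : e ∈ 𝒜 0) :
    (twoSided e).IsHomogeneous 𝒜 := by
  have hspan : twoSided e = Ideal.span {x | ∃ (i : ℤ) (c : 𝒜 i), x = e * c} := by
    refine le_antisymm (fun x hx => ?_) (Ideal.span_le.2 ?_)
    · refine twoSided_induction (p := fun x => x ∈ Ideal.span _) (zero_mem _)
        (fun x y => add_mem) (fun b c => ?_) hx
      induction c using DirectSum.Decomposition.inductionOn 𝒜 with
      | zero => rw [mul_zero]; exact zero_mem _
      | @homogeneous i c =>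
        rw [mul_assoc]
        exact Ideal.mul_mem_left _ _ (Ideal.subset_span ⟨i, c, rfl⟩)
      | add x y hx hy => rw [mul_add]; exact add_mem hx hy
    · rintro _ ⟨i, c, rfl⟩
      exact Ideal.mul_mem_right _ _ mem_twoSided_self
  rw [hspan]
  refine Ideal.homogeneous_span 𝒜 _ ?_
  rintro _ ⟨i, c, rfl⟩
  exact ⟨0 + i, SetLike.GradedMul.mul_mem he c.2⟩

section EndAlg

variable {R : Type u} [CommRing R] {l : ℕ} {N : Fin l → Type u} [∀ i, AddCommGroup (N i)]
  [∀ i, Module R (N i)]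

/-- The projection of `R ⊕ ⨁ N i` onto the summand `N i`, as an element of `Λ`. -/
def summandProj (R : Type u) [CommRing R] [∀ i, Module R (N i)] (i : Fin l) : EndAlg N R :=
  LinearMap.inr R R (∀ i, N i) ∘ₗ LinearMap.single R N i ∘ₗ LinearMap.proj i ∘ₗ
    LinearMap.snd R R (∀ i, N i)

lemma e₀_add_sum_summandProj : e₀ N R + ∑ i, summandProj R i = 1 := by
  refine LinearMap.ext fun x => Prod.ext ?_ (funext fun i => ?_)
  · simp [e₀, summandProj, LinearMap.sum_apply, Prod.fst_sum]
  · simp [e₀, summandProj, LinearMap.sum_apply, Prod.snd_sum, Finset.sum_apply,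
      Finset.sum_pi_single]

lemma smul_summandProj_mem {s : R} {i : Fin l} {r : ℕ} (f : N i →ₗ[R] (Fin r → R))
    (g : (Fin r → R) →ₗ[R] N i) (hfg : g ∘ₗ f = s • LinearMap.id) :
    s • summandProj R i ∈ twoSided (e₀ N R) := by
  let outOf (t : Fin r) : EndAlg N R :=
    LinearMap.inl R R (∀ i, N i) ∘ₗ LinearMap.proj t ∘ₗ f ∘ₗ LinearMap.proj i ∘ₗ
      LinearMap.snd R R (∀ i, N i)
  let into (t : Fin r) : EndAlg N R :=
    LinearMap.inr R R (∀ i, N i) ∘ₗ LinearMap.single R N i ∘ₗ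
      LinearMap.toSpanSingleton R (N i) (g (Pi.single t 1)) ∘ₗ LinearMap.fst R R (∀ i, N i)
  have hsmul (y : N i) : s • y = ∑ t, f y t • g (Pi.single t 1) :=
    calc s • y = g (f y) := (LinearMap.congr_fun hfg y).symm
      _ = g (∑ t, f y t • Pi.single t 1) := congrArg g (pi_eq_sum_univ' (f y))
      _ = ∑ t, f y t • g (Pi.single t 1) := by simp only [map_sum, map_smul]
  have hsum : s • summandProj R i = ∑ t, into t * e₀ N R * outOf t := by
    refine LinearMap.ext fun x => ?_
    rw [LinearMap.sum_apply]
    refine ((map_smul (LinearMap.inr R R (∀ i, N i) ∘ₗ LinearMap.single R N i) s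
      (x.2 i)).symm.trans (congrArg _ (hsmul _))).trans ?_
    rw [map_sum]
    rfl
  rw [hsum]
  exact sum_mem fun t _ => mul_mem_twoSided _ _

variable (N) in
/-- The ideal of all `r : R` with `r · 1 ∈ Λe₀Λ`; its vanishing locus is the locus where `M` is not
locally free. -/
def scalarIdeal (R : Type u) [CommRing R] [∀ i, Module R (N i)] : Ideal R :=
  (twoSided (e₀ N R)).comap (algebraMap R (EndAlg N R))

lemma mem_scalarIdeal {r : R} :
    r ∈ scalarIdeal N R ↔ algebraMap R (EndAlg N R) r ∈ twoSided (e₀ N R) :=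
  Iff.rfl

variable [∀ i, Module.Finite R (N i)]

lemma scalarIdeal_isHomogeneous {k : Type u} [Field k] [Algebra k R] [∀ i, Module k (N i)]
    [∀ i, IsScalarTower k R (N i)] (𝓡 : ℤ → Submodule k R) [GradedAlgebra 𝓡]
    (𝒩 : ∀ i, ℤ → Submodule k (N i)) [∀ i, DirectSum.Decomposition (𝒩 i)]
    [∀ i, SetLike.GradedSMul 𝓡 (𝒩 i)] : (scalarIdeal N R).IsHomogeneous 𝓡 := by
  have hmem {i : ℤ} {r : R} (hr : r ∈ 𝓡 i) :
      algebraMap R (EndAlg N R) r ∈ endAlgGrading 𝓡 𝒩 i := fun j x hx =>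
    SetLike.GradedSMul.smul_mem hr hx
  have hdecompose (r : R) (n : ℤ) :
      (DirectSum.decompose (endAlgGrading 𝓡 𝒩) (algebraMap R (EndAlg N R) r) n : EndAlg N R) =
        algebraMap R (EndAlg N R) (DirectSum.decompose 𝓡 r n : R) := by
    induction r using DirectSum.Decomposition.inductionOn 𝓡 with
    | zero => simp
    | @homogeneous i r =>
      obtain rfl | hin := eq_or_ne i n
      · rw [DirectSum.decompose_of_mem_same _ (hmem r.2), DirectSum.decompose_of_mem_same _ r.2]
      · rw [DirectSum.decompose_of_mem_ne _ (hmem r.2) hin,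
          DirectSum.decompose_of_mem_ne _ r.2 hin, map_zero]
    | add x y hx hy => simp [DirectSum.decompose_add, hx, hy]
  intro n r hr
  rw [mem_scalarIdeal, ← hdecompose]
  exact twoSided_isHomogeneous (endAlgGrading 𝓡 𝒩) (e₀_mem 𝓡 𝒩) n hr

variable [IsNoetherianRing R] {m : Ideal R}

lemma finite_quotient_twoSided {k : Type u} [Field k] [Algebra k R] [∀ i, Module k (N i)]
    [∀ i, IsScalarTower k R (N i)] [Module.Finite k (R ⧸ m)]
    (h : ∀ p : Ideal R, p.IsPrime → scalarIdeal N R ≤ p → m ≤ p) :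
    Module.Finite k (EndAlg N R ⧸ twoSided (e₀ N R)) := by
  obtain ⟨s, hs⟩ := exists_pow_le_of_forall_isPrime h
  refine finite_of_pow_le_annihilator (R := R) (EndAlg N R ⧸ twoSided (e₀ N R))
    (hs.trans fun r hr => Module.mem_annihilator.2 fun x => ?_)
  obtain ⟨a, rfl⟩ := Ideal.Quotient.mk_surjective x
  refine Ideal.Quotient.eq_zero_iff_mem.2 ?_
  change r • a ∈ _
  rw [Algebra.smul_def]
  exact Ideal.mul_mem_right _ _ hr

variable [m.IsMaximal]

lemma not_scalarIdeal_le_of_lt (hGor : IsGorenstein R) (hsing : IsIsolatedSingularity m)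
    (hN : ∀ i, IsMaximalCohenMacaulay m (N i)) {p : Ideal R} [hp : p.IsPrime] (hpm : p < m) :
    ¬ scalarIdeal N R ≤ p := by
  choose s hs r f g hfg using fun i =>
    exists_factor_of_isMaximalCohenMacaulay hGor hsing (N i) (hN i) p hpm
  have smul_mem (a : R) {x : EndAlg N R} (hx : x ∈ twoSided (e₀ N R)) :
      a • x ∈ twoSided (e₀ N R) := by
    rw [Algebra.smul_def]
    exact Ideal.mul_mem_left _ _ hx
  have hprod : ∏ i, s i ∈ scalarIdeal N R := by
    rw [mem_scalarIdeal, Algebra.algebraMap_eq_smul_one, ← e₀_add_sum_summandProj, smul_add,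
      Finset.smul_sum]
    refine add_mem (smul_mem _ mem_twoSided_self) (sum_mem fun i _ => ?_)
    rw [← Finset.prod_erase_mul Finset.univ s (Finset.mem_univ i), mul_smul]
    exact smul_mem _ (smul_summandProj_mem (f i) (g i) (hfg i))
  intro hle
  obtain ⟨i, -, hi⟩ := hp.prod_mem_iff.1 (hle hprod)
  exact hs i hi

lemma le_of_scalarIdeal_le [IsLocalRing R] (hGor : IsGorenstein R)
    (hsing : IsIsolatedSingularity m) (hN : ∀ i, IsMaximalCohenMacaulay m (N i)) (p : Ideal R)
    (hp : p.IsPrime) (hle : scalarIdeal N R ≤ p) : m ≤ p := by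
  have hpm : p ≤ m := IsLocalRing.eq_maximalIdeal (inferInstance : m.IsMaximal) ▸
    IsLocalRing.le_maximalIdeal hp.ne_top
  exact (hpm.eq_or_lt.resolve_right
    fun h => not_scalarIdeal_le_of_lt hGor hsing hN h hle).ge

/- The homogeneous core of a prime is prime, lies in `m`, and still contains the homogeneous
ideal `scalarIdeal N R`. -/
lemma le_of_scalarIdeal_le_of_graded {k : Type u} [Field k] [Algebra k R] [∀ i, Module k (N i)]
    [∀ i, IsScalarTower k R (N i)] (𝓡 : ℤ → Submodule k R) [GradedAlgebra 𝓡]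
    (𝒩 : ∀ i, ℤ → Submodule k (N i)) [∀ i, DirectSum.Decomposition (𝒩 i)]
    [∀ i, SetLike.GradedSMul 𝓡 (𝒩 i)] (hm : ∀ I : Ideal R, I.IsHomogeneous 𝓡 → I ≠ ⊤ → I ≤ m)
    (hGor : IsGorenstein R) (hsing : IsIsolatedSingularity m)
    (hN : ∀ i, IsMaximalCohenMacaulay m (N i)) (p : Ideal R) (hp : p.IsPrime)
    (hle : scalarIdeal N R ≤ p) : m ≤ p := by
  have hcore : (p.homogeneousCore 𝓡).toIdeal.IsPrime := hp.homogeneousCore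
  have hle_core : scalarIdeal N R ≤ (p.homogeneousCore 𝓡).toIdeal := by
    rw [← (scalarIdeal_isHomogeneous 𝓡 𝒩).toIdeal_homogeneousCore_eq_self]
    exact Ideal.homogeneousCore_mono 𝓡 hle
  have hcore_le := hm _ (p.homogeneousCore 𝓡).isHomogeneous hcore.ne_top
  exact (hcore_le.eq_or_lt.resolve_right
    fun h => not_scalarIdeal_le_of_lt hGor hsing hN h hle_core).ge.trans
    (Ideal.toIdeal_homogeneousCore_le 𝓡 p)

end EndAlg

end NCResolution

end

open NCResolution in
theorem proposition5p1p4_general {k R : Type u} [Field k] [CommRing R] [Algebra k R]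
    [IsNoetherianRing R] (m : Ideal R) [m.IsMaximal] [Module.Finite k (R ⧸ m)]
    (hGor : IsGorenstein R) (hsing : IsIsolatedSingularity m)
    {l : ℕ} (N : Fin l → Type u) [∀ i, AddCommGroup (N i)] [∀ i, Module k (N i)]
    [∀ i, Module R (N i)] [∀ i, IsScalarTower k R (N i)] [∀ i, Module.Finite R (N i)]
    (hN : ∀ i, IsMaximalCohenMacaulay m (N i))
    (hΛ : HasFiniteGlobalDimension (EndAlg N R)) :
    (IsLocalRing R →
      HomFinite k (DbfQuotient (e₀ N R)) ∧
      ∃ φ : (EndAlg N R ⧸ twoSided (e₀ N R)) ≃ₐ[k]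
          (End ((toDbfQuotient (e₀ N R)).obj (regularObj (EndAlg N R))))ᵐᵒᵖ,
        ∀ a : EndAlg N R, φ (Ideal.Quotient.mk _ a) =
          .op ((toDbfQuotient (e₀ N R)).map (rightMul a))) ∧
    (∀ (𝓡 : ℤ → Submodule k R) [GradedAlgebra 𝓡] (𝒩 : ∀ i, ℤ → Submodule k (N i))
        [∀ i, DirectSum.Decomposition (𝒩 i)] [∀ i, SetLike.GradedSMul 𝓡 (𝒩 i)],
      (∀ I : Ideal R, I.IsHomogeneous 𝓡 → I ≠ ⊤ → I ≤ m) →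
      (HomFinite k (DbfQuotient (e₀ N R)) ∧
        ∃ φ : (EndAlg N R ⧸ twoSided (e₀ N R)) ≃ₐ[k]
            (End ((toDbfQuotient (e₀ N R)).obj (regularObj (EndAlg N R))))ᵐᵒᵖ,
          ∀ a : EndAlg N R, φ (Ideal.Quotient.mk _ a) =
            .op ((toDbfQuotient (e₀ N R)).map (rightMul a))) ∧
      HomFinite k (DbfGrQuotient 𝓡 𝒩) ∧
      ∀ n : ℤ,
        Function.Surjective (fun a : endAlgGrading 𝓡 𝒩 n =>
          (toDbfGrQuotient 𝓡 𝒩).map (rightMulGr a)) ∧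
        ∀ a : endAlgGrading 𝓡 𝒩 n, (toDbfGrQuotient 𝓡 𝒩).map (rightMulGr a) = 0 ↔
          (a : EndAlg N R) ∈ twoSided (e₀ N R)) := by
  have hee := e₀_mul_e₀ N R
  refine ⟨fun _ => ?_, fun 𝓡 _ 𝒩 _ _ hm => ?_⟩
  · have := finite_quotient_twoSided (k := k) (le_of_scalarIdeal_le hGor hsing hN)
    exact ⟨homFinite_dbfQuotient hee hΛ, exists_algEquiv_end hee hΛ⟩
  · have := finite_quotient_twoSided (k := k)
      (le_of_scalarIdeal_le_of_graded 𝓡 𝒩 hm hGor hsing hN)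
    have he := e₀_mem 𝓡 𝒩
    exact ⟨⟨homFinite_dbfQuotient hee hΛ, exists_algEquiv_end hee hΛ⟩,
      homFinite_gradedQuotient he hee hΛ,
      fun n => ⟨map_rightMulGr_surjective he hee hΛ n, map_rightMulGr_eq_zero_iff he hee hΛ⟩⟩

open NCResolution in
theorem proposition5p1p4 {k R : Type u} [Field k] [CommRing R] [Algebra k R]
    [IsNoetherianRing R] (m : Ideal R) [m.IsMaximal]
    (hk : Function.Bijective (algebraMap k (R ⧸ m)))
    (hGor : IsGorenstein R) (hsing : IsIsolatedSingularity m)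
    {l : ℕ} (N : Fin l → Type u) [∀ i, AddCommGroup (N i)] [∀ i, Module k (N i)]
    [∀ i, Module R (N i)] [∀ i, IsScalarTower k R (N i)] [∀ i, Module.Finite R (N i)]
    (hN : ∀ i, IsMaximalCohenMacaulay m (N i))
    (hΛ : HasFiniteGlobalDimension (EndAlg N R)) :
    -- the complete case
    (IsCompleteSetting N m →
      HomFinite k (DbfQuotient (e₀ N R)) ∧
      ∃ φ : (EndAlg N R ⧸ twoSided (e₀ N R)) ≃ₐ[k]
          (End ((toDbfQuotient (e₀ N R)).obj (regularObj (EndAlg N R))))ᵐᵒᵖ,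
        ∀ a : EndAlg N R, φ (Ideal.Quotient.mk _ a) =
          .op ((toDbfQuotient (e₀ N R)).map (rightMul a))) ∧
    -- the graded case
    (∀ (𝓡 : ℤ → Submodule k R) [GradedAlgebra 𝓡] (𝒩 : ∀ i, ℤ → Submodule k (N i))
        [∀ i, DirectSum.Decomposition (𝒩 i)] [∀ i, SetLike.GradedSMul 𝓡 (𝒩 i)],
      IsGradedSetting 𝓡 𝒩 m →
      -- for ungraded modules
      (HomFinite k (DbfQuotient (e₀ N R)) ∧
        ∃ φ : (EndAlg N R ⧸ twoSided (e₀ N R)) ≃ₐ[k]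
            (End ((toDbfQuotient (e₀ N R)).obj (regularObj (EndAlg N R))))ᵐᵒᵖ,
          ∀ a : EndAlg N R, φ (Ideal.Quotient.mk _ a) =
            .op ((toDbfQuotient (e₀ N R)).map (rightMul a))) ∧
      -- for graded modules: `Hom(Λ, Λ(n))` is the part of degree `n` of `Λ/Λe₀Λ`
      HomFinite k (DbfGrQuotient 𝓡 𝒩) ∧
      ∀ n : ℤ,
        Function.Surjective (fun a : endAlgGrading 𝓡 𝒩 n =>
          (toDbfGrQuotient 𝓡 𝒩).map (rightMulGr a)) ∧
        ∀ a : endAlgGrading 𝓡 𝒩 n, (toDbfGrQuotient 𝓡 𝒩).map (rightMulGr a) = 0 ↔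
          (a : EndAlg N R) ∈ twoSided (e₀ N R)) := by
  have : Module.Finite k (R ⧸ m) := .of_surjective (Algebra.linearMap k (R ⧸ m)) hk.2
  have general := proposition5p1p4_general (k := k) m hGor hsing N hN hΛ
  exact ⟨fun h => general.1 h.isLocalRing, fun 𝓡 _ 𝒩 _ _ h => general.2 𝓡 𝒩 h.le_of_isHomogeneous⟩
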